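/- Let $k$ be an algebraically closed field, let $m,n\in\mathbb N$ with $m$ invertible in $k$, and let $\delta=(\delta_i)_{i\in\mathbb Z/m}\in k^m$. **The algebra.** A reduced $(m,n)$-diagram has $n$ northern and $n$ southern nodes, joined in pairs by strands; every strand is oriented and labelled by an element of $\mathbb Z/m$, and reversing the orientation of a strand while negating its label does not change the diagram. $B^m_n(\delta)$ is the $k$-vector space with basis the reduced $(m,n)$-diagrams and with the bilinear product for which $x\cdot y$ is obtained by placing $x$ above $y$, adding labels along compatibly oriented strands, and replacing each closed loop by the factor $\delta_i$, where $i$ is the label of the loop oriented so that it points downwards at its leftmost central node. Let $\ast$ be the linear map of $B^m_n(\delta)$ that reflects diagrams in the horizontal axis, a strand from $p$ to $q$ with label $a$ becoming a strand from the mirror image of $q$ to the mirror image of $p$ with label $a$ (so downward labels of through strands are kept). **Dangles.** For $l\le\lfloor n/2\rfloor$, an $(m,n,l)$-dangle is a partition of $\{1,\dots,n\}$ into $l$ two-element subsets (arcs), each labelled (when oriented to the right) by an element of $\mathbb Z/m$, and $n-2l$ singletons (free nodes). $V(m,n,l)$ is the $k$-vector space with basis the $(m,n,l)$-dangles, and $H^m_N=k\big((\mathbb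 Z/m)\wr\Sigma_N\big)$, with the linear map $\tau$ that inverts permutations and fixes the elements of $(\mathbb Z/m)^N$ and satisfies $\tau(gh)=\tau(h)\tau(g)$. Two $(m,n,l)$-dangles $d,d'$ and an element $g=(f,\sigma)$ of $(\mathbb Z/m)\wr\Sigma_{n-2l}$ assemble to a diagram $X(d,d',g)$: its northern arcs are those of $d$, its southern arcs are the mirror image (in the sense of $\ast$) of those of $d'$, and the $i$-th free node of $d$ is joined to the $\sigma^{-1}(i)$-th free node of $d'$ by a strand with downward label $f(i)$. **Order.** $\Lambda(m,n)$ is the set of $m$-partitions $\lambda=(\lambda^0,\dots,\lambda^{m-1})$ of $n-2l$, for all $0\le l\le\lfloor n/2\rfloor$. Write $\mu\unlhd\lambda$ if $\sum_i|\mu^i|<\sum_i|\lambda^i|$, or if $\sum_i|\mu^i|=\sum_i|\lambda^i|$ and $\sum_{i<j}|\mu^i|+\sum_{i=1}^r\mu^j_i\le\sum_{i<j}|\lambda^i|+\sum_{i=1}^r\lambda^j_i$ for all $0\le j\le m-1$ and $r\ge 0$. **Theorem.** 1. The product of $B^m_n(\delta)$ is unital, with unit the diagram joining the $i$-th northern to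 the $i$-th southern node for all $i$, with labels $0$. It is associative if and only if $n\le1$ or $\delta_{-i}=\delta_i$ for all $i\in\mathbb Z/m$. 2. The assignment $d\otimes d'\otimes g\mapsto X(d,d',g)$ defines a linear isomorphism $$B^m_n(\delta)=\bigoplus_{l=0}^{\lfloor n/2\rfloor}V(m,n,l)\otimes V(m,n,l)\otimes H^m_{n-2l},$$ by which $B^m_n(\delta)$ is an iterated inflation of the algebras $H^m_{n-2l}$. That is: $\ast$ and $\tau$ are involutory anti-automorphisms; for every $r$ the sum $J_r$ of the summands with $l\ge r$ is a two-sided ideal; $(v\otimes w\otimes b)^\ast=w\otimes v\otimes\tau(b)$; and for every $l$ there is a bilinear form $\varphi_l:V(m,n,l)\times V(m,n,l)\to H^m_{n-2l}$ with $\tau(\varphi_l(v,w))=\varphi_l(w,v)$ and $$(v\otimes w\otimes b)(v'\otimes w'\otimes b')\equiv v\otimes w'\otimes b\,\varphi_l(w,v')\,b'\pmod{J_{l+1}}.$$ 3. $B^m_n(\delta)$ is cellular (in the sense of Graham and Lehrer) with respect to the poset $(\Lambda(m,n),\unlhd)$ and the anti-involution $\ast$: there are finite nonempty sets $M(\lambda)$,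 $\lambda\in\Lambda(m,n)$, and a basis $C^\lambda_{S,T}$ ($\lambda\in\Lambda(m,n)$, $S,T\in M(\lambda)$) of $B^m_n(\delta)$ with $(C^\lambda_{S,T})^\ast=C^\lambda_{T,S}$ such that for every $a\in B^m_n(\delta)$ there are scalars $r_a(S',S)$, independent of $T$, with $a\,C^\lambda_{S,T}\equiv\sum_{S'\in M(\lambda)}r_a(S',S)\,C^\lambda_{S',T}$ modulo the span of the $C^\mu_{U,W}$ with $\mu\lhd\lambda$. In particular, $B^m_n(\delta)$ is a cellular algebra in the usual, associative, sense whenever $n\le 1$ or $\delta_{-i}=\delta_i$ for all $i$. -/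

import Mathlib

open scoped TensorProduct DirectSum

namespace CyclotomicBrauer

noncomputable section

/-! ## Following strands

`α` pairs off the ends of the strands inside two stacked diagrams, `β` identifies the southern nodes
of the upper diagram with the northern nodes of the lower one and fixes exactly the outer nodes. -/

section Trace

variable {S : Type*} {α β : S → S}

/-- One step along a strand: traverse a strand of one of the two diagrams, then (unless an outer
node was reached) pass to the other diagram. -/
def step (α β : S → S) (s : S) : S := β (α s)

theorem step_injective (hα : Function.Involutive α) (hβ : Function.Involutive β) :
    Function.Injective (step α β) := hβ.injective.comp hα.injective

theorem exists_exit [Finite S] (hα : Function.Involutive α) (hβ : Function.Involutive β)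
    (p : S) (hp : β p = p) : ∃ k, 0 < k ∧ β ((step α β)^[k] p) = (step α β)^[k] p := by
  have h := (step_injective hα hβ).mem_periodicPts p
  obtain ⟨k, hk, hk'⟩ := h
  refine ⟨k, hk, ?_⟩
  rw [hk'.eq, hp]

/-- The number of steps from an outer node to the next outer node. -/
def exitTime (α β : S → S) (p : S) : ℕ :=
  sInf {k | 0 < k ∧ β ((step α β)^[k] p) = (step α β)^[k] p}

/-- The other end of the strand that starts at the outer node `p`. -/
def exitNode (α β : S → S) (p : S) : S := (step α β)^[exitTime α β p] p

/-- The sum of the labels along the first `k` pieces of the strand that starts at `p`. -/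
def pathLabel {M : Type*} [AddCommGroup M] (α β : S → S) (lab : S → M) (p : S) (k : ℕ) : M :=
  ∑ j ∈ Finset.range k, lab ((step α β)^[j] p)

theorem exitTime_spec [Finite S] (hα : Function.Involutive α) (hβ : Function.Involutive β)
    (p : S) (hp : β p = p) : 0 < exitTime α β p ∧ β (exitNode α β p) = exitNode α β p :=
  Nat.sInf_mem (s := {k | 0 < k ∧ β ((step α β)^[k] p) = (step α β)^[k] p})
    (exists_exit hα hβ p hp)

theorem exitTime_min (p : S) {j : ℕ} (hj : 0 < j) (hlt : j < exitTime α β p) :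
    β ((step α β)^[j] p) ≠ (step α β)^[j] p := fun h => by
  have := Nat.notMem_of_lt_sInf hlt
  exact this ⟨hj, h⟩

theorem step_reverse (hα : Function.Involutive α) (hβ : Function.Involutive β) (s : S) :
    step α β (β (step α β s)) = β s := by
  simp only [step, hβ (α s), hα s]

theorem iterate_reverse (hα : Function.Involutive α) (hβ : Function.Involutive β) (p : S) (k : ℕ)
    (hk : β ((step α β)^[k] p) = (step α β)^[k] p) :
    ∀ j ≤ k, (step α β)^[j] ((step α β)^[k] p) = β ((step α β)^[k - j] p)
  | 0, _ => by simp [hk]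
  | j + 1, hj => by
    rw [Function.iterate_succ_apply', iterate_reverse hα hβ p k hk j (by omega)]
    obtain ⟨i, hi⟩ : ∃ i, k - j = i + 1 := ⟨k - j - 1, by omega⟩
    have hi' : k - (j + 1) = i := by omega
    rw [hi, hi', Function.iterate_succ_apply', step_reverse hα hβ]

theorem exitTime_exitNode [Finite S] (hα : Function.Involutive α) (hβ : Function.Involutive β)
    (p : S) (hp : β p = p) : exitTime α β (exitNode α β p) = exitTime α β p := by
  obtain ⟨hpos, hfix⟩ := exitTime_spec hα hβ p hp
  obtain ⟨hpos', hfix'⟩ := exitTime_spec hα hβ (exitNode α β p) hfix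
  have key := iterate_reverse hα hβ p _ hfix
  apply le_antisymm
  · refine Nat.sInf_le ⟨hpos, ?_⟩
    have := key _ le_rfl
    simp only [exitNode] at this ⊢
    rw [this]
    simp [hp]
  · by_contra! hlt
    have h1 := key _ hlt.le
    rw [exitNode] at hfix'
    change β ((step α β)^[exitTime α β (exitNode α β p)] (exitNode α β p)) =
      (step α β)^[exitTime α β (exitNode α β p)] (exitNode α β p) at hfix'
    rw [exitNode] at hfix' h1 hpos' hlt
    rw [h1, hβ] at hfix'
    exact exitTime_min p (by omega) (by omega) hfix'.symm

theorem exitNode_exitNode [Finite S] (hα : Function.Involutive α) (hβ : Function.Involutive β)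
    (p : S) (hp : β p = p) : exitNode α β (exitNode α β p) = p := by
  obtain ⟨hpos, hfix⟩ := exitTime_spec hα hβ p hp
  have key := iterate_reverse hα hβ p _ hfix _ le_rfl
  conv_lhs => rw [exitNode, exitTime_exitNode hα hβ p hp]
  rw [exitNode, key]
  simp [hp]

theorem exitNode_ne [Finite S] (hα : Function.Involutive α) (hβ : Function.Involutive β)
    (hα' : ∀ s, α s ≠ s) (p : S) (hp : β p = p) : exitNode α β p ≠ p := by
  intro h
  obtain ⟨hpos, hfix⟩ := exitTime_spec hα hβ p hp
  have key := iterate_reverse hα hβ p _ hfix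
  change ∀ j ≤ _, (step α β)^[j] (exitNode α β p) = _ at key
  rw [h] at key
  rcases Nat.even_or_odd' (exitTime α β p) with ⟨j, hj | hj⟩
  · have h1 := key j (by omega)
    rw [show exitTime α β p - j = j by omega] at h1
    exact exitTime_min p (by omega) (by omega) h1.symm
  · have h1 := key (j + 1) (by omega)
    rw [show exitTime α β p - (j + 1) = j by omega, Function.iterate_succ_apply'] at h1
    exact hα' _ (hβ.injective h1)

theorem pathLabel_exitNode [Finite S] {M : Type*} [AddCommGroup M] (hα : Function.Involutive α)
    (hβ : Function.Involutive β) (lab : S → M) (hlab : ∀ s, lab (α s) = -lab s)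
    (p : S) (hp : β p = p) :
    pathLabel α β lab (exitNode α β p) (exitTime α β p) =
      -pathLabel α β lab p (exitTime α β p) := by
  obtain ⟨hpos, hfix⟩ := exitTime_spec hα hβ p hp
  have key := iterate_reverse hα hβ p _ hfix
  change ∀ j ≤ _, (step α β)^[j] (exitNode α β p) = _ at key
  unfold pathLabel
  rw [← Finset.sum_neg_distrib, ← Finset.sum_range_reflect]
  refine Finset.sum_congr rfl fun j hj => ?_
  rw [Finset.mem_range] at hj
  rw [key _ (by omega), show exitTime α β p - (exitTime α β p - 1 - j) = j + 1 by omega,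
    Function.iterate_succ_apply', step, hβ, hlab]

end Trace

/-! ## Diagrams and the algebra -/

/-- A node of an `(m,n)`-diagram: `inl i` is the `i`-th northern, `inr i` the `i`-th southern one. -/
abbrev Node (n : ℕ) : Type := Fin n ⊕ Fin n

/-- A reduced `(m,n)`-diagram. `partner p` is the node to which `p` is joined, and `label p` is the
label of the strand at `p` when this strand is oriented from `p` to `partner p`; so reversing the
orientation negates the label, and diagrams are equal iff they are identified in the usual sense. -/
@[ext] structure Diagram (m n : ℕ) : Type where
  partner : Node n → Node n
  label : Node n → ZMod m
  partner_partner : ∀ p, partner (partner p) = p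
  partner_ne : ∀ p, partner p ≠ p
  label_partner : ∀ p, label (partner p) = -label p

/-- The nodes of two stacked diagrams: `inl p` is a node of the upper one, `inr p` of the lower. -/
abbrev StackNode (n : ℕ) : Type := Node n ⊕ Node n

/-- The identification of the southern nodes of the upper diagram with the northern nodes of the
lower one; the outer nodes are fixed. -/
def glueNode {n : ℕ} : StackNode n → StackNode n
  | .inl (.inl i) => .inl (.inl i)
  | .inl (.inr i) => .inr (.inl i)
  | .inr (.inl i) => .inl (.inr i)
  | .inr (.inr i) => .inr (.inr i)

/-- The outer nodes of two stacked diagrams, seen as the nodes of one diagram. -/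
def outerNode {n : ℕ} : Node n → StackNode n := Sum.map Sum.inl Sum.inr

/-- The inverse of `outerNode` on outer nodes (and an irrelevant value on the middle nodes). -/
def toNode {n : ℕ} : StackNode n → Node n := Sum.elim id id

theorem glueNode_involutive {n : ℕ} : Function.Involutive (glueNode (n := n)) := by
  rintro ((i | i) | (i | i)) <;> rfl

theorem glueNode_outerNode {n : ℕ} (p : Node n) : glueNode (outerNode p) = outerNode p := by
  rcases p with i | i <;> rfl

theorem outerNode_toNode {n : ℕ} (s : StackNode n) (h : glueNode s = s) :
    outerNode (toNode s) = s := by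
  rcases s with (i | i) | (i | i) <;> simp_all [glueNode, outerNode, toNode]

theorem toNode_outerNode {n : ℕ} (p : Node n) : toNode (outerNode p) = p := by
  rcases p with i | i <;> rfl

variable {m n : ℕ}

/-- The strands of two stacked diagrams. -/
def stackPartner (X Y : Diagram m n) : StackNode n → StackNode n := Sum.map X.partner Y.partner

/-- The labels of two stacked diagrams. -/
def stackLabel (X Y : Diagram m n) : StackNode n → ZMod m := Sum.elim X.label Y.label

theorem stackPartner_involutive (X Y : Diagram m n) : Function.Involutive (stackPartner X Y) := by
  rintro (p | p) <;> simp [stackPartner, X.partner_partner, Y.partner_partner]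

theorem stackPartner_ne (X Y : Diagram m n) (s : StackNode n) : stackPartner X Y s ≠ s := by
  rcases s with p | p <;> simp [stackPartner, X.partner_ne, Y.partner_ne]

theorem stackLabel_stackPartner (X Y : Diagram m n) (s : StackNode n) :
    stackLabel X Y (stackPartner X Y s) = -stackLabel X Y s := by
  rcases s with p | p <;> simp [stackPartner, stackLabel, X.label_partner, Y.label_partner]

/-- The reduced diagram obtained by stacking `X` above `Y`, adding the labels along the strands
(compatibly oriented), and removing the closed loops. -/
def Diagram.stack (X Y : Diagram m n) : Diagram m n where
  partner p := toNode (exitNode (stackPartner X Y) glueNode (outerNode p))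
  label p := pathLabel (stackPartner X Y) glueNode (stackLabel X Y) (outerNode p)
    (exitTime (stackPartner X Y) glueNode (outerNode p))
  partner_partner p := by
    rw [outerNode_toNode _ (exitTime_spec (stackPartner_involutive X Y) glueNode_involutive _
      (glueNode_outerNode p)).2, exitNode_exitNode (stackPartner_involutive X Y)
      glueNode_involutive _ (glueNode_outerNode p), toNode_outerNode]
  partner_ne p h := by
    have h' := congrArg outerNode h
    rw [outerNode_toNode _ (exitTime_spec (stackPartner_involutive X Y) glueNode_involutive _
      (glueNode_outerNode p)).2] at h'
    exact exitNode_ne (stackPartner_involutive X Y) glueNode_involutive (stackPartner_ne X Y) _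
      (glueNode_outerNode p) h'
  label_partner p := by
    rw [outerNode_toNode _ (exitTime_spec (stackPartner_involutive X Y) glueNode_involutive _
      (glueNode_outerNode p)).2, exitTime_exitNode (stackPartner_involutive X Y)
      glueNode_involutive _ (glueNode_outerNode p), pathLabel_exitNode
      (stackPartner_involutive X Y) glueNode_involutive _ (stackLabel_stackPartner X Y) _
      (glueNode_outerNode p)]

/-- The node reached after `t` steps when one leaves the `i`-th central node downwards, that is,
along the strand of the lower diagram `Y`. -/
def fromCentral (X Y : Diagram m n) (i : Fin n) (t : ℕ) : StackNode n :=
  (step (stackPartner X Y) glueNode)^[t] (.inr (.inl i))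

/-- The `i`-th central node lies on a closed loop and is the leftmost central node of this loop. -/
def IsLoopStart (X Y : Diagram m n) (i : Fin n) : Prop :=
  (∀ t, glueNode (fromCentral X Y i t) ≠ fromCentral X Y i t) ∧
  (∀ t j, fromCentral X Y i t = .inl (.inr j) ∨ fromCentral X Y i t = .inr (.inl j) → i ≤ j)

/-- The label of the closed loop through the `i`-th central node, oriented so that it points
downwards at this node. -/
def loopLabel (X Y : Diagram m n) (i : Fin n) : ZMod m :=
  pathLabel (stackPartner X Y) glueNode (stackLabel X Y) (.inr (.inl i))
    (Function.minimalPeriod (step (stackPartner X Y) glueNode) (.inr (.inl i)))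

open Classical in
/-- The product of the parameters `δ_i` over the closed loops that arise when `X` is stacked
above `Y`. -/
def loopFactor {k : Type*} [Field k] (δ : ZMod m → k) (X Y : Diagram m n) : k :=
  ∏ i ∈ Finset.univ.filter (IsLoopStart X Y), δ (loopLabel X Y i)

/-- The diagram joining the `i`-th northern node with the `i`-th southern one for all `i`, with all
labels `0`. -/
def Diagram.id (m n : ℕ) : Diagram m n where
  partner := Sum.swap
  label _ := 0
  partner_partner := Sum.swap_swap
  partner_ne := by rintro (i | i) <;> simp
  label_partner _ := by simp

/-- The reflection of a diagram in its horizontal axis: a strand from `p` to `q` with label `a`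
becomes a strand from the mirror image of `q` to the mirror image of `p` with label `a`. In
particular the labels of the through strands, oriented downwards, do not change. -/
def Diagram.flip (X : Diagram m n) : Diagram m n where
  partner p := (X.partner p.swap).swap
  label p := -X.label p.swap
  partner_partner p := by simp [X.partner_partner]
  partner_ne p h := X.partner_ne p.swap (by
    have h' := congrArg Sum.swap h
    rwa [Sum.swap_swap] at h')
  label_partner p := by simp [X.label_partner]

/-- The underlying vector space of the cyclotomic Brauer algebra `B^m_n(δ)`: the span of the
reduced `(m,n)`-diagrams. -/
def BrauerAlg (k : Type*) [Field k] (m n : ℕ) (_δ : ZMod m → k) : Type _ := Diagram m n →₀ k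

section BrauerAlg

variable {k : Type*} [Field k] (δ : ZMod m → k)

instance : AddCommGroup (BrauerAlg k m n δ) := inferInstanceAs (AddCommGroup (Diagram m n →₀ k))

instance : Module k (BrauerAlg k m n δ) := inferInstanceAs (Module k (Diagram m n →₀ k))

/-- A diagram as an element of `B^m_n(δ)`. -/
def ofDiagram (X : Diagram m n) : BrauerAlg k m n δ := (Finsupp.single X 1 : Diagram m n →₀ k)

/-- The bilinear product with `X · Y = (product of the δ_i over the loops) • (X stacked above Y)`
for diagrams `X`, `Y`, on the space spanned by the diagrams. -/
def mulFinsupp : (Diagram m n →₀ k) →ₗ[k] (Diagram m n →₀ k) →ₗ[k] (Diagram m n →₀ k) :=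
  Finsupp.linearCombination k fun X =>
    Finsupp.linearCombination k fun Y => Finsupp.single (X.stack Y) (loopFactor δ X Y)

theorem mulFinsupp_single (X Y : Diagram m n) :
    mulFinsupp δ (Finsupp.single X 1) (Finsupp.single Y 1) =
      Finsupp.single (X.stack Y) (loopFactor δ X Y) := by
  rw [mulFinsupp, Finsupp.linearCombination_single, one_smul, Finsupp.linearCombination_single,
    one_smul]

/-- The product of `B^m_n(δ)` as a bilinear map. -/
def mulMap : BrauerAlg k m n δ →ₗ[k] BrauerAlg k m n δ →ₗ[k] BrauerAlg k m n δ := mulFinsupp δ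

instance : Mul (BrauerAlg k m n δ) := ⟨fun x y => mulMap δ x y⟩

instance : One (BrauerAlg k m n δ) := ⟨ofDiagram δ (Diagram.id m n)⟩

theorem mul_def (x y : BrauerAlg k m n δ) : x * y = mulMap δ x y := rfl

theorem ofDiagram_mul (X Y : Diagram m n) :
    ofDiagram δ X * ofDiagram δ Y = loopFactor δ X Y • ofDiagram δ (X.stack Y) :=
  (mulFinsupp_single δ X Y).trans
    (by rw [← Finsupp.smul_single_one]; rfl)

instance : NonUnitalNonAssocRing (BrauerAlg k m n δ) where
  left_distrib x y z := by simp only [mul_def, map_add]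
  right_distrib x y z := by simp only [mul_def, map_add, LinearMap.add_apply]
  zero_mul x := by simp only [mul_def, map_zero, LinearMap.zero_apply]
  mul_zero x := by simp only [mul_def, map_zero]

instance : IsScalarTower k (BrauerAlg k m n δ) (BrauerAlg k m n δ) where
  smul_assoc c x y := by simp only [smul_eq_mul, mul_def, map_smul, LinearMap.smul_apply]

instance : SMulCommClass k (BrauerAlg k m n δ) (BrauerAlg k m n δ) where
  smul_comm c x y := by simp only [smul_eq_mul, mul_def, map_smul]

/-- The linear map `∗` of `B^m_n(δ)` that reflects diagrams. -/
def flipMap : BrauerAlg k m n δ →ₗ[k] BrauerAlg k m n δ := Finsupp.lmapDomain k k Diagram.flip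

end BrauerAlg

/-! ## Dangles and wreath products -/

/-- An `(m,n,l)`-dangle. The arcs are the sets `{i, partner i}` with `partner i ≠ i`, the free nodes
are the `i` with `partner i = i`; there are `n - 2l` of these, so there are `l` arcs. `label i` is
the label of the arc at `i`, oriented from `i` to `partner i`; so an arc carries just one element
of `ℤ/m`, the label for its rightward orientation. -/
@[ext] structure Dangle (m n l : ℕ) : Type where
  partner : Fin n → Fin n
  label : Fin n → ZMod m
  partner_partner : ∀ i, partner (partner i) = i
  label_partner : ∀ i, label (partner i) = -label i
  label_free : ∀ i, partner i = i → label i = 0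
  card_free : (Finset.univ.filter fun i => partner i = i).card + 2 * l = n

/-- The set of free nodes of a dangle. -/
def Dangle.free {l : ℕ} (d : Dangle m n l) : Finset (Fin n) :=
  Finset.univ.filter fun i => d.partner i = i

theorem Dangle.mem_free {l : ℕ} (d : Dangle m n l) (i : Fin n) :
    i ∈ d.free ↔ d.partner i = i := by simp [Dangle.free]

theorem Dangle.card_free_eq {l : ℕ} (d : Dangle m n l) : d.free.card = n - 2 * l := by
  have := d.card_free
  rw [Dangle.free]
  omega

/-- The free nodes of a dangle, numbered from left to right. -/
def Dangle.freeIso {l : ℕ} (d : Dangle m n l) : Fin (n - 2 * l) ≃o d.free :=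
  d.free.orderIsoOfFin d.card_free_eq

/-- The wreath product `(ℤ/m) ≀ Σ_N`, i.e. the complex reflection group of type `G(m,1,N)`. -/
abbrev Wreath (m N : ℕ) : Type :=
  (Fin N → Multiplicative (ZMod m)) ⋊[mulAutArrow] Equiv.Perm (Fin N)

/-- The reflection in the horizontal axis on `(ℤ/m) ≀ Σ_N`: it inverts permutations and fixes the
elements of the base group `(ℤ/m)^N`. -/
def Wreath.flip {N : ℕ} (g : Wreath m N) : Wreath m N := ⟨fun i => g.left (g.right i), g.right⁻¹⟩

/-- The group algebra `H^m_N = k((ℤ/m) ≀ Σ_N)`. -/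
abbrev WreathAlg (k : Type*) [Field k] (m N : ℕ) : Type _ := MonoidAlgebra k (Wreath m N)

/-- The linear map of `H^m_N` that reflects diagrams. -/
def wreathFlipMap (k : Type*) [Field k] (m N : ℕ) : WreathAlg k m N →ₗ[k] WreathAlg k m N :=
  (MonoidAlgebra.coeffLinearEquiv k).symm.toLinearMap ∘ₗ
    Finsupp.lmapDomain k k Wreath.flip ∘ₗ (MonoidAlgebra.coeffLinearEquiv k).toLinearMap

/-- The space `V(m,n,l)` spanned by the `(m,n,l)`-dangles. -/
abbrev DangleSpace (k : Type*) [Field k] (m n l : ℕ) : Type _ := Dangle m n l →₀ k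

/-- The diagram with `n - 2l` through strands whose northern arcs are those of `d`, whose southern
arcs are those of the mirror image of `d'`, and whose through strands are given by `g = (f, σ)`:
for every `i` the `i`-th free node of `d` is joined to the `σ⁻¹ i`-th free node of `d'` by a strand
with label `f i`, oriented downwards. -/
def Dangle.assemble {l : ℕ} (d d' : Dangle m n l) (g : Wreath m (n - 2 * l)) : Diagram m n where
  partner
    | .inl i => if h : i ∈ d.free then .inr (d'.freeIso (g.right⁻¹ (d.freeIso.symm ⟨i, h⟩)))
        else .inl (d.partner i)
    | .inr j => if h : j ∈ d'.free then .inl (d.freeIso (g.right (d'.freeIso.symm ⟨j, h⟩)))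
        else .inr (d'.partner j)
  label
    | .inl i => if h : i ∈ d.free then (g.left (d.freeIso.symm ⟨i, h⟩)).toAdd else d.label i
    | .inr j => if h : j ∈ d'.free then -(g.left (g.right (d'.freeIso.symm ⟨j, h⟩))).toAdd
        else -d'.label j
  partner_partner := by
    rintro (i | i)
    · by_cases h : i ∈ d.free
      · simp [h]
      · have h' : d.partner i ∉ d.free := by
          simpa [Dangle.mem_free, d.partner_partner, eq_comm] using h
        simp [h, h', d.partner_partner]
    · by_cases h : i ∈ d'.free
      · simp [h]
      · have h' : d'.partner i ∉ d'.free := by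
          simpa [Dangle.mem_free, d'.partner_partner, eq_comm] using h
        simp [h, h', d'.partner_partner]
  partner_ne := by
    rintro (i | i)
    · by_cases h : i ∈ d.free
      · simp [h]
      · simpa [h] using fun h' => h ((d.mem_free i).2 h')
    · by_cases h : i ∈ d'.free
      · simp [h]
      · simpa [h] using fun h' => h ((d'.mem_free i).2 h')
  label_partner := by
    rintro (i | i)
    · by_cases h : i ∈ d.free
      · simp [h]
      · have h' : d.partner i ∉ d.free := by
          simpa [Dangle.mem_free, d.partner_partner, eq_comm] using h
        simp [h, h', d.label_partner]
    · by_cases h : i ∈ d'.free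
      · simp [h]
      · have h' : d'.partner i ∉ d'.free := by
          simpa [Dangle.mem_free, d'.partner_partner, eq_comm] using h
        simp [h, h', d'.label_partner]

/-! ## Iterated inflations and cellular algebras -/

/-- `f` is an involutory anti-automorphism of the `k`-algebra `A`. -/
structure IsAntiInvolution {k A : Type*} [Field k] [NonUnitalNonAssocRing A] [Module k A]
    (f : A →ₗ[k] A) : Prop where
  involutive : ∀ a, f (f a) = a
  map_mul : ∀ a b, f (a * b) = f b * f a

section Inflation

variable {k A : Type*} [Field k] [NonUnitalNonAssocRing A] [Module k A] {L : ℕ}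
  {V H : Fin L → Type*} [∀ l, AddCommGroup (V l)] [∀ l, Module k (V l)]
  [∀ l, Ring (H l)] [∀ l, Algebra k (H l)]

/-- The element of `A` that corresponds to an element of the layer `V_l ⊗ V_l ⊗ H_l`. -/
def ofLayer (Ψ : A ≃ₗ[k] ⨁ l, V l ⊗[k] (V l ⊗[k] H l)) (l : Fin L)
    (z : V l ⊗[k] (V l ⊗[k] H l)) : A :=
  Ψ.symm (DirectSum.lof k (Fin L) (fun l => V l ⊗[k] (V l ⊗[k] H l)) l z)

/-- The subspace `J_r` of `A` that corresponds to the sum of the layers with index `≥ r`. -/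
def layerIdeal (Ψ : A ≃ₗ[k] ⨁ l, V l ⊗[k] (V l ⊗[k] H l)) (r : ℕ) : Submodule k A where
  carrier := {a | ∀ l : Fin L, (l : ℕ) < r → Ψ a l = 0}
  zero_mem' l _ := by simp
  add_mem' {a b} ha hb l hl := by simp [ha l hl, hb l hl]
  smul_mem' c a ha l hl := by
    rw [map_smul, DirectSum.smul_apply, ha l hl, smul_zero]

/-- `A`, with the involution `star`, is an iterated inflation of the algebras `H_l`, with the
involutions `τ_l`, along the spaces `V_l`, with inflation decomposition
`Ψ : A = ⨁_l V_l ⊗ V_l ⊗ H_l`. That is, the sums `J_r` of the layers with index `≥ r` are two-sided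
ideals, and the layer `J_l / J_{l+1}` is the inflation of `H_l` along `V_l` for a bilinear form
`φ_l : V_l × V_l → H_l`, compatibly with the involutions. -/
structure IsIteratedInflation (star : A →ₗ[k] A) (τ : ∀ l, H l →ₗ[k] H l)
    (Ψ : A ≃ₗ[k] ⨁ l, V l ⊗[k] (V l ⊗[k] H l)) : Prop where
  star_antiInvolution : IsAntiInvolution star
  layer_antiInvolution : ∀ l, IsAntiInvolution (τ l)
  ideal_left : ∀ r a x, x ∈ layerIdeal Ψ r → a * x ∈ layerIdeal Ψ r
  ideal_right : ∀ r a x, x ∈ layerIdeal Ψ r → x * a ∈ layerIdeal Ψ r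
  star_layer : ∀ l v w b, star (ofLayer Ψ l (v ⊗ₜ (w ⊗ₜ b))) = ofLayer Ψ l (w ⊗ₜ (v ⊗ₜ τ l b))
  exists_form : ∃ φ : ∀ l, V l →ₗ[k] V l →ₗ[k] H l,
    (∀ l v w, τ l (φ l v w) = φ l w v) ∧
    ∀ (l : Fin L) (v w v' w' : V l) (b b' : H l),
      ofLayer Ψ l (v ⊗ₜ (w ⊗ₜ b)) * ofLayer Ψ l (v' ⊗ₜ (w' ⊗ₜ b')) -
        ofLayer Ψ l (v ⊗ₜ (w' ⊗ₜ (b * φ l w v' * b'))) ∈ layerIdeal Ψ ((l : ℕ) + 1)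

end Inflation

/-- A cell datum in the sense of Graham and Lehrer for the `k`-algebra `A`, with the poset `Λ` and
the anti-involution `star`: finite nonempty sets `M(λ)` for `λ ∈ Λ`, and a basis `C^λ_{S,T}`
(`λ ∈ Λ`, `S, T ∈ M(λ)`) of `A`, such that `star C^λ_{S,T} = C^λ_{T,S}`, and
`a C^λ_{S,T} ≡ ∑_{S'} r_a(S',S) C^λ_{S',T}` modulo the span of the `C^μ_{U,W}` with `μ < λ`,
where `r_a(S',S)` does not depend on `T`. -/
structure CellDatum (k A Λ : Type*) [Field k] [NonUnitalNonAssocRing A] [Module k A]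
    [PartialOrder Λ] (star : A →ₗ[k] A) where
  M : Λ → Type
  fintype : ∀ lam, Fintype (M lam)
  nonempty : ∀ lam, Nonempty (M lam)
  C : Module.Basis (Σ lam, M lam × M lam) k A
  star_antiInvolution : IsAntiInvolution star
  star_C : ∀ lam (S T : M lam), star (C ⟨lam, S, T⟩) = C ⟨lam, T, S⟩
  r : A → ∀ lam, M lam → M lam → k
  mul_C : ∀ (a : A) (lam : Λ) (S T : M lam),
    a * C ⟨lam, S, T⟩ - ∑ S' : M lam, r a lam S' S • C ⟨lam, S', T⟩ ∈
      Submodule.span k {x | ∃ mu < lam, ∃ U W : M mu, x = C ⟨mu, U, W⟩}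

/-- `A` is cellular with respect to the poset `Λ` and the anti-involution `star`. -/
def IsCellular (k A Λ : Type*) [Field k] [NonUnitalNonAssocRing A] [Module k A]
    [PartialOrder Λ] (star : A →ₗ[k] A) : Prop :=
  Nonempty (CellDatum k A Λ star)

/-! ## Multipartitions -/

/-- The number of boxes of an `m`-tuple of partitions. -/
def size (lam : Fin m → YoungDiagram) : ℕ := ∑ i, (lam i).card

/-- `|λ^0| + … + |λ^{j-1}| + λ^j_1 + … + λ^j_r`. -/
def partialSum (lam : Fin m → YoungDiagram) (j : Fin m) (r : ℕ) : ℕ :=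
  (∑ i ∈ Finset.univ.filter (· < j), (lam i).card) + ∑ i ∈ Finset.range r, (lam j).rowLen i

/-- `Λ(m,n)`: the set of `m`-partitions of `n - 2l`, for all `l ≤ ⌊n/2⌋`. -/
def MultiPart (m n : ℕ) : Type :=
  {lam : Fin m → YoungDiagram // ∃ l ≤ n / 2, size lam = n - 2 * l}

theorem eq_of_partialSum_eq {lam mu : Fin m → YoungDiagram}
    (h : ∀ j r, partialSum lam j r = partialSum mu j r) : lam = mu := by
  funext j
  have key : ∀ i, (lam j).rowLen i = (mu j).rowLen i := fun i => by
    have h0 := h j i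
    have h1 := h j (i + 1)
    simp only [partialSum, Finset.sum_range_succ] at h0 h1
    omega
  ext ⟨a, b⟩
  rw [YoungDiagram.mem_cells, YoungDiagram.mem_cells, YoungDiagram.mem_iff_lt_rowLen,
    YoungDiagram.mem_iff_lt_rowLen, key]

/-- The extended dominance order on `Λ(m,n)`: `μ ≤ λ` iff `λ` has more boxes than `μ`, or they have
equally many boxes and `λ` dominates `μ`. -/
instance : PartialOrder (MultiPart m n) where
  le mu lam := size mu.1 < size lam.1 ∨
    size mu.1 = size lam.1 ∧ ∀ j r, partialSum mu.1 j r ≤ partialSum lam.1 j r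
  le_refl lam := Or.inr ⟨rfl, fun _ _ => le_rfl⟩
  le_trans a b c := by
    rintro (h | ⟨h, h'⟩) (g | ⟨g, g'⟩)
    · exact Or.inl (h.trans g)
    · exact Or.inl (g ▸ h)
    · exact Or.inl (h ▸ g)
    · exact Or.inr ⟨h.trans g, fun j r => (h' j r).trans (g' j r)⟩
  le_antisymm a b := by
    rintro (h | ⟨h, h'⟩) (g | ⟨g, g'⟩)
    · omega
    · omega
    · omega
    · exact Subtype.ext (eq_of_partialSum_eq fun j r => le_antisymm (h' j r) (g' j r))

end

end CyclotomicBrauer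

/-!
The theorem has three parts, which rest on three ideas.

*Associativity.* Stacking two diagrams traces strands: one involution follows the strands inside the
diagrams, another one passes through the interface, and the strands and loops of the product are the
orbits of the two together. If three diagrams are stacked and one of the two interfaces is merged
first, the new pair of involutions is a contraction (`IsContraction`) of the pair of all three, a
kind of first return map. It has the same strands, and its loops are the remaining ones. Hence
stacking of reduced diagrams is associative (`stack_assoc`) whatever the parameters, and both ways
of multiplying three diagrams collect the same loops, possibly with opposite orientations; for
symmetric parameters the orientation does not matter (`loopFactor_assoc`). Conversely, sliding a
crossing from one side of a loop to the other reverses the loop, so that associativity forces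
symmetric parameters if `n ≥ 2` (`symmetric_of_assoc`).

*Inflation.* Cutting the through strands of a diagram leaves two dangles and an element of the
wreath product (`cutEquiv`). A product of diagrams has at most as many through strands as each
factor, and if none are lost, the middle dangles only permute and relabel the free nodes. This gives
the multiplication rule of the layers (`assemble_mul_assemble`) and `isIteratedInflation`.

*Cellularity.* The group algebra of `ℤ/m ≀ Σ_N` has a Murphy basis. Since `m` is invertible and the
field is algebraically closed, `ℤ/m` has a primitive character `ψ`. A tabloid puts the positions
into rows of `m` colours, and the Murphy element `murphy ψ t u` is supported on the group elements
that move the rows of `u` to the rows of `t`, and takes there the value of the character of the base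
group belonging to the colours of `t`. The relation `sum_murphy_place` straightens Murphy elements:
modulo elements of larger content they are combinations of those in which the first tabloid is a
ballot tabloid, with coefficients that do not depend on the second one (`murphy_mem_ballot`).
Fourier inversion writes every group element in terms of Murphy elements of tabloids with rows of
length at most one, so the Murphy elements of pairs of ballot tabloids of equal content span
(`span_ballot_eq_top`). An `m`-tuple of partitions has `m` more addable than removable rows
(`card_addable`), which leads to the branching identity `sum_ballotCount_add` and to the fact that
there are as many such pairs as group elements (`sum_ballotCount`). So they form a basis. The
content of a tabloid is read as the sequence of column lengths of a multipartition, since a larger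
content has to belong to a smaller cell (`partialSum_le_of_dominates`).

Putting the Murphy elements between two dangles gives the cellular basis `cellElem`. A diagram
placed above a basis element either loses a through strand, and then the product lies in lower
cells, or it permutes the free nodes of the northern dangle, and then the straightening rule gives
coefficients that depend on the first index only (`actsOnCell_ofDiagram`, `isCellular`).
-/

namespace CyclotomicBrauer

/-! ### Strands and closed loops of a pair of involutions -/

section Trace

variable {S : Type*} {α β : S → S}

theorem exitTime_eq_of_first {p : S} {k : ℕ} (hk : 0 < k)
    (hfix : β ((step α β)^[k] p) = (step α β)^[k] p)
    (hmin : ∀ j, 0 < j → j < k → β ((step α β)^[j] p) ≠ (step α β)^[j] p) :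
    exitTime α β p = k := by
  apply le_antisymm
  · exact Nat.sInf_le ⟨hk, hfix⟩
  · refine le_csInf ⟨k, hk, hfix⟩ ?_
    rintro j ⟨hj, hj'⟩
    by_contra! hlt
    exact hmin j hj hlt hj'

theorem step_iterate_reverse (hα : Function.Involutive α) (hβ : Function.Involutive β) (s : S) :
    ∀ k, (step α β)^[k] (β ((step α β)^[k] s)) = β s
  | 0 => rfl
  | k + 1 => by
    rw [Function.iterate_succ_apply, Function.iterate_succ_apply', step_reverse hα hβ,
      step_iterate_reverse hα hβ s k]

theorem exists_iterate_step_eq [Finite S] (hα : Function.Involutive α)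
    (hβ : Function.Involutive β) (s : S) (b : ℕ) :
    ∃ c, (step α β)^[c] ((step α β)^[b] s) = s := by
  obtain ⟨k, hk, hk'⟩ := (step_injective hα hβ).mem_periodicPts s
  refine ⟨b * k - b, ?_⟩
  rw [← Function.iterate_add_apply, Nat.sub_add_cancel (Nat.le_mul_of_pos_right b hk)]
  exact hk'.const_mul b

/-- The nodes `s` and `s'` lie on the same strand or closed loop, or become so after passing from
one diagram to the other: they have the same orbit under the group generated by `α` and `β`. -/
def Joined (α β : S → S) (s s' : S) : Prop :=
  ∃ t, (step α β)^[t] s = s' ∨ (step α β)^[t] s = β s'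

theorem Joined.refl (s : S) : Joined α β s s := ⟨0, Or.inl rfl⟩

theorem Joined.glue (hβ : Function.Involutive β) (s : S) : Joined α β s (β s) :=
  ⟨0, Or.inr (hβ s).symm⟩

theorem Joined.iterate (s : S) (t : ℕ) : Joined α β s ((step α β)^[t] s) := ⟨t, Or.inl rfl⟩

theorem Joined.symm [Finite S] (hα : Function.Involutive α) (hβ : Function.Involutive β) {s s' : S}
    (h : Joined α β s s') : Joined α β s' s := by
  obtain ⟨t, rfl | h⟩ := h
  · obtain ⟨c, hc⟩ := exists_iterate_step_eq hα hβ s t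
    exact ⟨c, Or.inl hc⟩
  · refine ⟨t, Or.inr ?_⟩
    rw [← step_iterate_reverse hα hβ s t, h, hβ]

theorem Joined.trans [Finite S] (hα : Function.Involutive α) (hβ : Function.Involutive β)
    {s s' s'' : S} (h : Joined α β s s') (h' : Joined α β s' s'') : Joined α β s s'' := by
  obtain ⟨a, h⟩ := h
  obtain ⟨b, h'⟩ := h'
  rcases h with rfl | h
  · exact ⟨b + a, by rwa [Function.iterate_add_apply]⟩
  · have key := step_iterate_reverse hα hβ s' b
    rw [← h] at key
    rcases h' with h' | h' <;> rw [h'] at key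
    · obtain ⟨c, hc⟩ := exists_iterate_step_eq hα hβ (β s'') b
      exact ⟨c + a, Or.inr (by rw [Function.iterate_add_apply, ← key, hc])⟩
    · rw [hβ] at key
      obtain ⟨c, hc⟩ := exists_iterate_step_eq hα hβ s'' b
      exact ⟨c + a, Or.inl (by rw [Function.iterate_add_apply, ← key, hc])⟩

/-- The node `s` lies on a closed loop: following the strand from `s` never leads outside. -/
def IsLoopPt (α β : S → S) (s : S) : Prop := ∀ t, β ((step α β)^[t] s) ≠ (step α β)^[t] s

theorem isLoopPt_iff (hβ : Function.Involutive β) (s : S) :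
    IsLoopPt α β s ↔ ∀ s', Joined α β s s' → β s' ≠ s' := by
  constructor
  · rintro h s' ⟨t, rfl | h'⟩ hs
    · exact h t hs
    · apply h t
      rw [h', hβ, hs]
  · intro h t
    exact h _ (Joined.iterate s t)

theorem IsLoopPt.congr [Finite S] (hα : Function.Involutive α) (hβ : Function.Involutive β)
    {s s' : S} (h : IsLoopPt α β s) (hs : Joined α β s s') : IsLoopPt α β s' := by
  rw [isLoopPt_iff hβ] at h ⊢
  exact fun s'' hs'' => h s'' (hs.trans hα hβ hs'')

/-- The sum of the labels along the closed loop through `s`. -/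
noncomputable def orbitSum {M : Type*} [AddCommGroup M] (α β : S → S) (lab : S → M) (s : S) : M :=
  pathLabel α β lab s (Function.minimalPeriod (step α β) s)

theorem pathLabel_succ_sub {M : Type*} [AddCommGroup M] (lab : S → M) (s : S) (k : ℕ) :
    pathLabel α β lab (step α β s) k + lab s =
      pathLabel α β lab s k + lab ((step α β)^[k] s) := by
  unfold pathLabel
  rw [← Finset.sum_range_succ, Finset.sum_range_succ']
  rfl

theorem pathLabel_two {M : Type*} [AddCommGroup M] (lab : S → M) (s : S) :
    pathLabel α β lab s 2 = lab s + lab (step α β s) := by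
  rw [pathLabel, Finset.sum_range_succ, Finset.sum_range_one]
  rfl

theorem pathLabel_three {M : Type*} [AddCommGroup M] (lab : S → M) (s : S) :
    pathLabel α β lab s 3 = lab s + lab (step α β s) + lab (step α β (step α β s)) := by
  rw [pathLabel, Finset.sum_range_succ, Finset.sum_range_succ, Finset.sum_range_one]
  rfl

theorem orbitSum_step [Finite S] {M : Type*} [AddCommGroup M] (hα : Function.Involutive α)
    (hβ : Function.Involutive β) (lab : S → M) (s : S) :
    orbitSum α β lab (step α β s) = orbitSum α β lab s := by
  have hper := (step_injective hα hβ).mem_periodicPts s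
  have := pathLabel_succ_sub (α := α) (β := β) lab s (Function.minimalPeriod (step α β) s)
  rw [Function.iterate_minimalPeriod] at this
  rw [orbitSum, orbitSum, Function.minimalPeriod_apply hper]
  exact add_right_cancel this

theorem orbitSum_iterate [Finite S] {M : Type*} [AddCommGroup M] (hα : Function.Involutive α)
    (hβ : Function.Involutive β) (lab : S → M) (s : S) :
    ∀ t, orbitSum α β lab ((step α β)^[t] s) = orbitSum α β lab s
  | 0 => rfl
  | t + 1 => by
    rw [Function.iterate_succ_apply', orbitSum_step hα hβ, orbitSum_iterate hα hβ lab s t]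

theorem iterate_step_glue (hα : Function.Involutive α) (hβ : Function.Involutive β) {s : S} {k : ℕ}
    (hk : (step α β)^[k] s = s) {j : ℕ} (hj : j ≤ k) :
    (step α β)^[j] (β s) = β ((step α β)^[k - j] s) := by
  have h := step_iterate_reverse hα hβ ((step α β)^[k - j] s) j
  rwa [← Function.iterate_add_apply, Nat.add_sub_cancel' hj, hk] at h

/-- Passing to the other diagram reverses the orientation in which a loop is traversed. -/
theorem orbitSum_glue {M : Type*} [AddCommGroup M] (hα : Function.Involutive α)
    (hβ : Function.Involutive β) (lab : S → M) (hlab : ∀ s, lab (α s) = -lab s) (s : S) :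
    orbitSum α β lab (β s) = -orbitSum α β lab s := by
  have aux : ∀ (s : S) (k : ℕ), Function.IsPeriodicPt (step α β) k s →
      Function.IsPeriodicPt (step α β) k (β s) := fun s k hk => by
    have := iterate_step_glue hα hβ hk le_rfl
    rwa [Nat.sub_self] at this
  have hper : Function.minimalPeriod (step α β) (β s) = Function.minimalPeriod (step α β) s := by
    rw [Function.minimalPeriod_eq_minimalPeriod_iff]
    exact fun k => ⟨fun h => by simpa [hβ s] using aux _ _ h, aux _ _⟩
  rw [orbitSum, orbitSum, hper, pathLabel, pathLabel, ← Finset.sum_neg_distrib,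
    ← Finset.sum_range_reflect]
  refine Finset.sum_congr rfl fun j hj => ?_
  rw [Finset.mem_range] at hj
  rw [iterate_step_glue hα hβ (Function.iterate_minimalPeriod (f := step α β)) (by omega),
    show Function.minimalPeriod (step α β) s - (Function.minimalPeriod (step α β) s - 1 - j)
      = j + 1 by omega, Function.iterate_succ_apply', step, hβ, hlab]

/-- For symmetric parameters the weight of a closed loop depends neither on the starting point nor
on the orientation. -/
theorem Joined.weight_eq [Finite S] {M K : Type*} [AddCommGroup M] (hα : Function.Involutive α)
    (hβ : Function.Involutive β) (lab : S → M) (hlab : ∀ s, lab (α s) = -lab s)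
    {δ : M → K} (hδ : ∀ i, δ (-i) = δ i) {s s' : S} (h : Joined α β s s') :
    δ (orbitSum α β lab s) = δ (orbitSum α β lab s') := by
  obtain ⟨t, rfl | h⟩ := h
  · rw [orbitSum_iterate hα hβ]
  · rw [← orbitSum_iterate hα hβ lab s t, h, orbitSum_glue hα hβ lab hlab, hδ]

/-- `R` contains exactly one node of every closed loop. -/
def IsTransversal (α β : S → S) (R : Finset S) : Prop :=
  (∀ r ∈ R, IsLoopPt α β r) ∧ ∀ s, IsLoopPt α β s → ∃! r, r ∈ R ∧ Joined α β s r

/-- A weight that is constant on every closed loop has the same product over any two sets of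
representatives of the loops. -/
theorem IsTransversal.prod_eq [Finite S] {K : Type*} [CommMonoid K] (hα : Function.Involutive α)
    (hβ : Function.Involutive β) {R R' : Finset S} (hR : IsTransversal α β R)
    (hR' : IsTransversal α β R') (w : S → K) (hw : ∀ s s', Joined α β s s' → w s = w s') :
    ∏ r ∈ R, w r = ∏ r ∈ R', w r := by
  choose f hf hf' using fun r : R => hR'.2 r (hR.1 r r.2)
  refine Finset.prod_bij (fun r hr => f ⟨r, hr⟩) (fun r hr => (hf ⟨r, hr⟩).1) ?_ ?_ ?_
  · intro r hr s hs h
    have h1 := (hf ⟨r, hr⟩).2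
    have h2 := (hf ⟨s, hs⟩).2
    change Joined α β r _ at h1
    rw [h] at h1
    exact (hR.2 r (hR.1 r hr)).unique ⟨hr, Joined.refl r⟩
      ⟨hs, h1.trans hα hβ (h2.symm hα hβ)⟩
  · intro r' hr'
    obtain ⟨r, ⟨hr, hj⟩, -⟩ := hR.2 r' (hR'.1 r' hr')
    exact ⟨r, hr, (hR'.2 r (hR.1 r hr)).unique (hf ⟨r, hr⟩) ⟨hr', hj.symm hα hβ⟩⟩
  · exact fun r hr => hw _ _ (hf ⟨r, hr⟩).2

/-! ### Relabelling the nodes -/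

variable {S' : Type*} {α' β' : S' → S'} {ρ : S → S'}

theorem iterate_step_conj (ha : ∀ s, α' (ρ s) = ρ (α s)) (hb : ∀ s, β' (ρ s) = ρ (β s)) (s : S) :
    ∀ k, (step α' β')^[k] (ρ s) = ρ ((step α β)^[k] s)
  | 0 => rfl
  | k + 1 => by
    rw [Function.iterate_succ_apply', iterate_step_conj ha hb s k, Function.iterate_succ_apply',
      step, ha, hb]
    rfl

theorem joined_conj (hρ : Function.Injective ρ) (ha : ∀ s, α' (ρ s) = ρ (α s))
    (hb : ∀ s, β' (ρ s) = ρ (β s)) (s s' : S) :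
    Joined α' β' (ρ s) (ρ s') ↔ Joined α β s s' := by
  simp only [Joined, iterate_step_conj ha hb, hb, hρ.eq_iff]

theorem isLoopPt_conj (hρ : Function.Injective ρ) (ha : ∀ s, α' (ρ s) = ρ (α s))
    (hb : ∀ s, β' (ρ s) = ρ (β s)) (s : S) :
    IsLoopPt α' β' (ρ s) ↔ IsLoopPt α β s := by
  simp only [IsLoopPt, iterate_step_conj ha hb, hb, hρ.ne_iff]

theorem exitTime_conj (hρ : Function.Injective ρ) (ha : ∀ s, α' (ρ s) = ρ (α s))
    (hb : ∀ s, β' (ρ s) = ρ (β s)) (s : S) :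
    exitTime α' β' (ρ s) = exitTime α β s := by
  simp only [exitTime, iterate_step_conj ha hb, hb, hρ.eq_iff]

theorem minimalPeriod_conj (hρ : Function.Injective ρ) (ha : ∀ s, α' (ρ s) = ρ (α s))
    (hb : ∀ s, β' (ρ s) = ρ (β s)) (s : S) :
    Function.minimalPeriod (step α' β') (ρ s) = Function.minimalPeriod (step α β) s := by
  rw [Function.minimalPeriod_eq_minimalPeriod_iff]
  intro k
  rw [Function.IsPeriodicPt, Function.IsPeriodicPt, Function.IsFixedPt, Function.IsFixedPt,
    iterate_step_conj ha hb, hρ.eq_iff]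

end Trace

/-! ### Stacking two diagrams -/

section Stack

variable {m n : ℕ}

theorem outerNode_injective : Function.Injective (outerNode (n := n)) :=
  Function.LeftInverse.injective toNode_outerNode

theorem exitNode_outerNode (X Y : Diagram m n) (p : Node n) :
    exitNode (stackPartner X Y) glueNode (outerNode p) = outerNode ((X.stack Y).partner p) :=
  (outerNode_toNode _ (exitTime_spec (stackPartner_involutive X Y) glueNode_involutive _
    (glueNode_outerNode p)).2).symm

theorem stack_eq_of_first (X Y : Diagram m n) {p q : Node n} {k : ℕ} (hk : 0 < k)
    (h : (step (stackPartner X Y) glueNode)^[k] (outerNode p) = outerNode q)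
    (hmin : ∀ j, 0 < j → j < k → glueNode ((step (stackPartner X Y) glueNode)^[j] (outerNode p)) ≠
      (step (stackPartner X Y) glueNode)^[j] (outerNode p)) :
    (X.stack Y).partner p = q ∧
      (X.stack Y).label p =
        pathLabel (stackPartner X Y) glueNode (stackLabel X Y) (outerNode p) k := by
  have ht : exitTime (stackPartner X Y) glueNode (outerNode p) = k :=
    exitTime_eq_of_first hk (by rw [h, glueNode_outerNode]) hmin
  constructor
  · apply outerNode_injective
    rw [← exitNode_outerNode, exitNode, ht, h]
  · rw [← ht]
    rfl

theorem stack_north_one (X Y : Diagram m n) {i j : Fin n} (h : X.partner (.inl i) = .inl j) :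
    (X.stack Y).partner (.inl i) = .inl j ∧ (X.stack Y).label (.inl i) = X.label (.inl i) := by
  have := stack_eq_of_first X Y (p := .inl i) (q := .inl j) one_pos
    (by simp [step, outerNode, stackPartner, h, glueNode]) (by omega)
  simpa [pathLabel, stackLabel, outerNode] using this

theorem stack_north_two (X Y : Diagram m n) {i c j : Fin n} (h : X.partner (.inl i) = .inr c)
    (h' : Y.partner (.inl c) = .inr j) :
    (X.stack Y).partner (.inl i) = .inr j ∧
      (X.stack Y).label (.inl i) = X.label (.inl i) + Y.label (.inl c) := by
  have h1 : step (stackPartner X Y) glueNode (.inl (.inl i)) = .inr (.inl c) := by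
    simp [step, stackPartner, h, glueNode]
  have := stack_eq_of_first X Y (p := .inl i) (q := .inr j) two_pos
    (by
      change step _ _ (step (stackPartner X Y) glueNode (.inl (.inl i))) = _
      rw [h1]
      simp [step, stackPartner, h', glueNode, outerNode])
    (by
      intro t ht ht'
      obtain rfl : t = 1 := by omega
      simp [outerNode, h1, glueNode])
  refine ⟨this.1, this.2.trans ?_⟩
  simp [pathLabel_two, outerNode, h1, stackLabel]

theorem stack_north_three (X Y : Diagram m n) {i c c' j : Fin n}
    (h : X.partner (.inl i) = .inr c) (h' : Y.partner (.inl c) = .inl c')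
    (h'' : X.partner (.inr c') = .inl j) :
    (X.stack Y).partner (.inl i) = .inl j ∧
      (X.stack Y).label (.inl i) = X.label (.inl i) + Y.label (.inl c) + X.label (.inr c') := by
  have h1 : step (stackPartner X Y) glueNode (.inl (.inl i)) = .inr (.inl c) := by
    simp [step, stackPartner, h, glueNode]
  have h2 : step (stackPartner X Y) glueNode (.inr (.inl c)) = .inl (.inr c') := by
    simp [step, stackPartner, h', glueNode]
  have := stack_eq_of_first X Y (p := .inl i) (q := .inl j) three_pos
    (by
      change step _ _ (step _ _ (step (stackPartner X Y) glueNode (.inl (.inl i)))) = _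
      rw [h1, h2]
      simp [step, stackPartner, h'', glueNode, outerNode])
    (by
      intro t ht ht'
      obtain rfl | rfl : t = 1 ∨ t = 2 := by omega
      all_goals simp [outerNode, h1, h2, glueNode])
  refine ⟨this.1, this.2.trans ?_⟩
  simp [pathLabel_three, outerNode, h1, h2, stackLabel]

/-! ### Reflection in the horizontal axis -/

theorem Diagram.flip_flip (X : Diagram m n) : X.flip.flip = X := by
  ext p <;> simp [Diagram.flip]

/-- The reflection of two stacked diagrams. -/
def stackSwap : StackNode n → StackNode n := Sum.elim (fun p => .inr p.swap) (fun p => .inl p.swap)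

theorem stackSwap_injective : Function.Injective (stackSwap (n := n)) := by
  rintro ((i | i) | (i | i)) ((j | j) | (j | j)) h <;> simp_all [stackSwap]

theorem stackPartner_stackSwap (X Y : Diagram m n) (s : StackNode n) :
    stackPartner Y.flip X.flip (stackSwap s) = stackSwap (stackPartner X Y s) := by
  rcases s with p | p <;> simp [stackSwap, stackPartner, Diagram.flip]

theorem stackLabel_stackSwap (X Y : Diagram m n) (s : StackNode n) :
    stackLabel Y.flip X.flip (stackSwap s) = -stackLabel X Y s := by
  rcases s with p | p <;> simp [stackSwap, stackLabel, Diagram.flip]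

theorem glueNode_stackSwap (s : StackNode n) : glueNode (stackSwap s) = stackSwap (glueNode s) := by
  rcases s with (i | i) | (i | i) <;> rfl

theorem outerNode_swap (p : Node n) : outerNode p.swap = stackSwap (outerNode p) := by
  rcases p with i | i <;> rfl

theorem pathLabel_stackSwap (X Y : Diagram m n) (s : StackNode n) (t : ℕ) :
    pathLabel (stackPartner Y.flip X.flip) glueNode (stackLabel Y.flip X.flip) (stackSwap s) t =
      -pathLabel (stackPartner X Y) glueNode (stackLabel X Y) s t := by
  simp only [pathLabel, iterate_step_conj (stackPartner_stackSwap X Y) glueNode_stackSwap,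
    stackLabel_stackSwap, Finset.sum_neg_distrib]

theorem stack_flip (X Y : Diagram m n) : (X.stack Y).flip = Y.flip.stack X.flip := by
  have ht : ∀ p : Node n, exitTime (stackPartner Y.flip X.flip) glueNode (outerNode p) =
      exitTime (stackPartner X Y) glueNode (outerNode p.swap) := fun p => by
    rw [← exitTime_conj stackSwap_injective (stackPartner_stackSwap X Y) glueNode_stackSwap,
      ← outerNode_swap, Sum.swap_swap]
  ext p
  · apply outerNode_injective
    rw [← exitNode_outerNode, exitNode, ht]
    have hp : outerNode p = stackSwap (outerNode p.swap) := by
      rw [← outerNode_swap, Sum.swap_swap]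
    conv_rhs => rw [hp, iterate_step_conj (stackPartner_stackSwap X Y) glueNode_stackSwap]
    change _ = stackSwap (exitNode (stackPartner X Y) glueNode (outerNode p.swap))
    rw [exitNode_outerNode, ← outerNode_swap]
    rfl
  · change -(X.stack Y).label p.swap = pathLabel _ _ _ (outerNode p) _
    rw [ht]
    have hp : outerNode p = stackSwap (outerNode p.swap) := by
      rw [← outerNode_swap, Sum.swap_swap]
    conv_rhs => rw [hp, pathLabel_stackSwap]
    rfl

theorem flip_id : (Diagram.id m n).flip = Diagram.id m n := by
  ext p <;> simp [Diagram.flip, Diagram.id]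

/-- The leftmost central node of a loop, in terms of the orbits of the two involutions. -/
theorem isLoopStart_iff (X Y : Diagram m n) (i : Fin n) :
    IsLoopStart X Y i ↔ IsLoopPt (stackPartner X Y) glueNode (.inr (.inl i)) ∧
      ∀ j, Joined (stackPartner X Y) glueNode (.inr (.inl i)) (.inr (.inl j)) → i ≤ j := by
  refine and_congr Iff.rfl ⟨fun h j => ?_, fun h t j hj => ?_⟩
  · rintro ⟨t, ht⟩
    exact h t j (by rcases ht with ht | ht; exacts [Or.inr ht, Or.inl ht])
  · exact h j ⟨t, by rcases hj with hj | hj; exacts [Or.inr hj, Or.inl hj]⟩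

theorem isLoopStart_flip (X Y : Diagram m n) (i : Fin n) :
    IsLoopStart Y.flip X.flip i ↔ IsLoopStart X Y i := by
  have hα := stackPartner_involutive X Y
  have hβ := glueNode_involutive (n := n)
  have hc : ∀ i : Fin n, (.inr (.inl i) : StackNode n) = stackSwap (glueNode (.inr (.inl i))) :=
    fun _ => rfl
  have hg : ∀ i : Fin n, Joined (stackPartner X Y) glueNode (.inr (.inl i))
      (glueNode (.inr (.inl i))) := fun i => Joined.glue hβ _
  simp only [isLoopStart_iff]
  refine and_congr ?_ (forall_congr' fun j => imp_congr ?_ Iff.rfl)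
  · rw [hc, isLoopPt_conj stackSwap_injective (stackPartner_stackSwap X Y) glueNode_stackSwap]
    exact ⟨fun h => h.congr hα hβ ((hg i).symm hα hβ), fun h => h.congr hα hβ (hg i)⟩
  · have hconj := joined_conj stackSwap_injective (stackPartner_stackSwap X Y) glueNode_stackSwap
      (glueNode (.inr (.inl i))) (glueNode (.inr (.inl j)))
    refine hconj.trans ?_
    exact ⟨fun h => (hg i).trans hα hβ (h.trans hα hβ ((hg j).symm hα hβ)),
      fun h => ((hg i).symm hα hβ).trans hα hβ (h.trans hα hβ (hg j))⟩

/-- The reflected loop, traversed downwards from the same central node, has the same label: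
reflecting and reversing a strand each change the sign. -/
theorem loopLabel_flip (X Y : Diagram m n) (i : Fin n) :
    loopLabel Y.flip X.flip i = loopLabel X Y i := by
  have hc : (.inr (.inl i) : StackNode n) = stackSwap (glueNode (.inr (.inl i))) := rfl
  rw [loopLabel, hc, pathLabel_stackSwap,
    minimalPeriod_conj stackSwap_injective (stackPartner_stackSwap X Y) glueNode_stackSwap]
  change -orbitSum _ _ _ (glueNode _) = _
  rw [orbitSum_glue (stackPartner_involutive X Y) glueNode_involutive _
    (stackLabel_stackPartner X Y), neg_neg]
  rfl

theorem loopFactor_flip {k : Type*} [Field k] (δ : ZMod m → k) (X Y : Diagram m n) :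
    loopFactor δ Y.flip X.flip = loopFactor δ X Y := by
  classical
  unfold loopFactor
  refine Finset.prod_congr ?_ fun i _ => by rw [loopLabel_flip]
  ext i
  simp only [Finset.mem_filter, isLoopStart_flip]

theorem flip_eq_of_partner {X : Diagram m n} {p q : Node n} (h : X.partner p = q) :
    X.flip.partner p.swap = q.swap := by
  simp [Diagram.flip, h]

theorem stack_south_one (X Y : Diagram m n) {i j : Fin n} (h : Y.partner (.inr i) = .inr j) :
    (X.stack Y).partner (.inr i) = .inr j ∧ (X.stack Y).label (.inr i) = Y.label (.inr i) := by
  have := stack_north_one Y.flip X.flip (flip_eq_of_partner h)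
  rw [← stack_flip] at this
  have h1 := flip_eq_of_partner this.1
  rw [Diagram.flip_flip] at h1
  exact ⟨h1, neg_injective this.2⟩

theorem stack_south_two (X Y : Diagram m n) {i c j : Fin n} (h : Y.partner (.inr i) = .inl c)
    (h' : X.partner (.inr c) = .inl j) :
    (X.stack Y).partner (.inr i) = .inl j ∧
      (X.stack Y).label (.inr i) = Y.label (.inr i) + X.label (.inr c) := by
  have := stack_north_two Y.flip X.flip (flip_eq_of_partner h) (flip_eq_of_partner h')
  rw [← stack_flip] at this
  have h1 := flip_eq_of_partner this.1
  rw [Diagram.flip_flip] at h1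
  refine ⟨h1, neg_injective ?_⟩
  rw [neg_add]
  exact this.2

theorem stack_south_three (X Y : Diagram m n) {i c c' j : Fin n}
    (h : Y.partner (.inr i) = .inl c) (h' : X.partner (.inr c) = .inr c')
    (h'' : Y.partner (.inl c') = .inr j) :
    (X.stack Y).partner (.inr i) = .inr j ∧
      (X.stack Y).label (.inr i) = Y.label (.inr i) + X.label (.inr c) + Y.label (.inl c') := by
  have := stack_north_three Y.flip X.flip (flip_eq_of_partner h) (flip_eq_of_partner h')
    (flip_eq_of_partner h'')
  rw [← stack_flip] at this
  have h1 := flip_eq_of_partner this.1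
  rw [Diagram.flip_flip] at h1
  refine ⟨h1, neg_injective ?_⟩
  rw [neg_add, neg_add]
  exact this.2

/-! ### The unit -/

theorem id_stack (X : Diagram m n) : (Diagram.id m n).stack X = X := by
  have key : ∀ p, ((Diagram.id m n).stack X).partner p = X.partner p ∧
      ((Diagram.id m n).stack X).label p = X.label p := by
    rintro (i | i)
    · rcases h : X.partner (.inl i) with j | j
      · have := stack_north_three (Diagram.id m n) X (i := i) rfl h rfl
        exact ⟨this.1, this.2.trans (by simp [Diagram.id])⟩
      · have := stack_north_two (Diagram.id m n) X (i := i) rfl h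
        exact ⟨this.1, this.2.trans (by simp [Diagram.id])⟩
    · rcases h : X.partner (.inr i) with j | j
      · have := stack_south_two (Diagram.id m n) X (i := i) h rfl
        exact ⟨this.1, this.2.trans (by simp [Diagram.id])⟩
      · exact stack_south_one (Diagram.id m n) X h
  ext p
  exacts [(key p).1, (key p).2]

theorem stack_id (X : Diagram m n) : X.stack (Diagram.id m n) = X := by
  rw [← Diagram.flip_flip (X.stack _), stack_flip, flip_id, id_stack, Diagram.flip_flip]

theorem not_isLoopStart_of_south (X Y : Diagram m n) {i j : Fin n}
    (h : Y.partner (.inl i) = .inr j) : ¬ IsLoopStart X Y i := fun hs => by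
  refine hs.1 1 ?_
  simp [fromCentral, step, stackPartner, h, glueNode]

theorem not_isLoopStart_of_north (X Y : Diagram m n) {i c j : Fin n}
    (h : Y.partner (.inl i) = .inl c) (h' : X.partner (.inr c) = .inl j) :
    ¬ IsLoopStart X Y i := fun hs => by
  refine hs.1 2 ?_
  simp [fromCentral, step, stackPartner, h, h', glueNode]

theorem loopFactor_eq_one {k : Type*} [Field k] (δ : ZMod m → k) {X Y : Diagram m n}
    (h : ∀ i, ¬ IsLoopStart X Y i) : loopFactor δ X Y = 1 := by
  classical
  rw [loopFactor, Finset.filter_false_of_mem fun i _ => h i, Finset.prod_empty]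

theorem loopFactor_id_left {k : Type*} [Field k] (δ : ZMod m → k) (X : Diagram m n) :
    loopFactor δ (Diagram.id m n) X = 1 := by
  refine loopFactor_eq_one δ fun i => ?_
  rcases h : X.partner (.inl i) with j | j
  · exact not_isLoopStart_of_north _ X h rfl
  · exact not_isLoopStart_of_south _ X h

theorem loopFactor_id_right {k : Type*} [Field k] (δ : ZMod m → k) (X : Diagram m n) :
    loopFactor δ X (Diagram.id m n) = 1 := by
  rw [← loopFactor_flip, flip_id, loopFactor_id_left]

end Stack

end CyclotomicBrauer

namespace CyclotomicBrauer

/-! ### Contracting one of two interfaces -/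

section Contraction

variable {S S₁ S₂ M : Type*} [AddCommGroup M] {α β : S → S} {lab : S → M} {α₁ β₁ : S₁ → S₁}
  {lab₁ : S₁ → M} {α₂ β₂ : S₂ → S₂} {lab₂ : S₂ → M} {ι : S₁ → S} {κ : S₂ → S}

/-- The pair `(α₁, β₁)` arises from `(α, β)` by contracting the strands of the part `κ : S₂ → S`, in
which only some of the nodes are glued: `ι` embeds the nodes that survive, which are those not glued
inside `S₂`, and a strand of `S₁` is a strand of `S` outside `S₂` or a maximal strand of `S₂`. -/
structure IsContraction (α β : S → S) (lab : S → M) (α₁ β₁ : S₁ → S₁) (lab₁ : S₁ → M)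
    (α₂ β₂ : S₂ → S₂) (lab₂ : S₂ → M) (ι : S₁ → S) (κ : S₂ → S) : Prop where
  ι_inj : Function.Injective ι
  κ_inj : Function.Injective κ
  strand_κ : ∀ y, α (κ y) = κ (α₂ y)
  glue_κ : ∀ y, β₂ y ≠ y → β (κ y) = κ (β₂ y)
  glue_ι : ∀ s, β (ι s) = ι (β₁ s)
  lab_κ : ∀ y, lab (κ y) = lab₂ y
  outer_mem : ∀ y, β₂ y = y → κ y ∈ Set.range ι
  inner_notMem : ∀ y, β₂ y ≠ y → κ y ∉ Set.range ι
  cover : ∀ x, x ∉ Set.range ι → ∃ y, κ y = x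
  strand_ι : ∀ s, (α (ι s) = ι (α₁ s) ∧ lab₁ s = lab (ι s)) ∨
    ∃ p, β₂ p = p ∧ ι s = κ p ∧ ι (α₁ s) = κ (exitNode α₂ β₂ p) ∧
      lab₁ s = pathLabel α₂ β₂ lab₂ p (exitTime α₂ β₂ p)

theorem pathLabel_add (s : S) (a b : ℕ) :
    pathLabel α β lab s (a + b) =
      pathLabel α β lab s a + pathLabel α β lab ((step α β)^[a] s) b := by
  simp only [pathLabel, Finset.sum_range_add, ← Function.iterate_add_apply, add_comm]

namespace IsContraction

variable (h : IsContraction α β lab α₁ β₁ lab₁ α₂ β₂ lab₂ ι κ)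
include h

theorem step_κ {y : S₂}
    (hy : β₂ (step α₂ β₂ y) ≠ step α₂ β₂ y) : step α β (κ y) = κ (step α₂ β₂ y) := by
  rw [step, h.strand_κ, h.glue_κ]
  · rfl
  · intro h'
    exact hy (by rw [step, h', h'])

theorem iterate_κ (y : S₂) : ∀ k : ℕ,
    (∀ j, 0 < j → j ≤ k → β₂ ((step α₂ β₂)^[j] y) ≠ (step α₂ β₂)^[j] y) →
    (step α β)^[k] (κ y) = κ ((step α₂ β₂)^[k] y)
  | 0, _ => rfl
  | k + 1, hk => by
    have hk' := hk (k + 1) (by omega) le_rfl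
    rw [Function.iterate_succ_apply'] at hk'
    rw [Function.iterate_succ_apply', iterate_κ y k fun j hj hj' => hk j hj (by omega),
      h.step_κ hk', Function.iterate_succ_apply']

/-- The step on `S₁` is the first return map of the step on `S`. -/
theorem exists_return [Finite S₂] (hα₂ : Function.Involutive α₂) (hβ₂ : Function.Involutive β₂)
    (s : S₁) : ∃ k, 0 < k ∧ (step α β)^[k] (ι s) = ι (step α₁ β₁ s) ∧
      (∀ j, 0 < j → j < k → (step α β)^[j] (ι s) ∉ Set.range ι) ∧
      pathLabel α β lab (ι s) k = lab₁ s := by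
  rcases h.strand_ι s with ⟨h1, h2⟩ | ⟨p, hp, hs, h1, h2⟩
  · refine ⟨1, one_pos, ?_, by omega, ?_⟩
    · simp only [Function.iterate_one, step, h1, h.glue_ι]
    · simp [pathLabel, h2]
  · obtain ⟨hpos, hfix⟩ := exitTime_spec hα₂ hβ₂ p hp
    have hit : ∀ j < exitTime α₂ β₂ p, (step α β)^[j] (κ p) = κ ((step α₂ β₂)^[j] p) :=
      fun j hj => h.iterate_κ p j fun i hi hi' => exitTime_min p hi (by omega)
    refine ⟨exitTime α₂ β₂ p, hpos, ?_, ?_, ?_⟩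
    · obtain ⟨t, ht⟩ : ∃ t, exitTime α₂ β₂ p = t + 1 := ⟨_, (Nat.succ_pred_eq_of_pos hpos).symm⟩
      have h3 : α₂ ((step α₂ β₂)^[t] p) = exitNode α₂ β₂ p := by
        apply hβ₂.injective
        rw [hfix, exitNode, ht, Function.iterate_succ_apply']
        rfl
      rw [ht, Function.iterate_succ_apply', hs, hit t (by omega), step, h.strand_κ, h3, ← h1,
        h.glue_ι]
      rfl
    · intro j hj hj'
      rw [hs, hit j hj']
      exact h.inner_notMem _ (exitTime_min p hj hj')
    · rw [hs, h2, pathLabel, pathLabel]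
      refine Finset.sum_congr rfl fun j hj => ?_
      rw [hit j (Finset.mem_range.1 hj), h.lab_κ]

/-- The number of steps on `S` that make up `t` steps on `S₁`. -/
theorem exists_time [Finite S₂] (hα₂ : Function.Involutive α₂) (hβ₂ : Function.Involutive β₂)
    (s : S₁) : ∃ T : ℕ → ℕ, T 0 = 0 ∧ StrictMono T ∧
      (∀ t, (step α β)^[T t] (ι s) = ι ((step α₁ β₁)^[t] s)) ∧
      (∀ t, pathLabel α β lab (ι s) (T t) = pathLabel α₁ β₁ lab₁ s t) ∧
      ∀ j, (step α β)^[j] (ι s) ∈ Set.range ι → ∃ t, j = T t := by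
  choose k hk0 hk1 hk2 hk3 using h.exists_return hα₂ hβ₂
  set T : ℕ → ℕ := fun t => ∑ i ∈ Finset.range t, k ((step α₁ β₁)^[i] s) with hT
  have hTs : ∀ t, T (t + 1) = T t + k ((step α₁ β₁)^[t] s) := fun t => Finset.sum_range_succ _ _
  have hmono : StrictMono T := strictMono_nat_of_lt_succ fun t => by
    rw [hTs]
    exact Nat.lt_add_of_pos_right (hk0 _)
  have hit : ∀ t, (step α β)^[T t] (ι s) = ι ((step α₁ β₁)^[t] s) := fun t => by
    induction t with
    | zero => simp [hT]
    | succ t ih =>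
      rw [hTs, add_comm, Function.iterate_add_apply, ih, hk1, Function.iterate_succ_apply']
  refine ⟨T, by simp [hT], hmono, hit, fun t => ?_, fun j hj => ?_⟩
  · induction t with
    | zero => simp [hT, pathLabel]
    | succ t ih =>
      rw [hTs, pathLabel_add, ih, hit, hk3, pathLabel, pathLabel, Finset.sum_range_succ]
  · by_contra! hne
    -- `j` lies strictly between two consecutive return times
    have hex : ∃ t, j < T t := ⟨j + 1, (Nat.lt_succ_self j).trans_le (hmono.id_le (j + 1))⟩
    classical
    have h1 := Nat.find_spec hex
    obtain ⟨t, ht⟩ : ∃ t, Nat.find hex = t + 1 := by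
      refine Nat.exists_eq_succ_of_ne_zero fun h0 => ?_
      rw [h0] at h1
      simp [hT] at h1
    have h2 : T t < j := lt_of_le_of_ne (not_lt.1 (Nat.find_min hex (by omega))) (hne t).symm
    rw [ht, hTs] at h1
    refine hk2 ((step α₁ β₁)^[t] s) (j - T t) (by omega) (by omega) ?_
    rwa [← hit, ← Function.iterate_add_apply, Nat.sub_add_cancel h2.le]

theorem outer_mem_range {x : S} (hx : β x = x) : x ∈ Set.range ι := by
  by_contra hn
  obtain ⟨y, rfl⟩ := h.cover x hn
  have hy : β₂ y ≠ y := fun hy => hn (h.outer_mem y hy)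
  rw [h.glue_κ y hy] at hx
  exact hy (h.κ_inj hx)

theorem glue_ι_iff (s : S₁) : β (ι s) = ι s ↔ β₁ s = s := by rw [h.glue_ι, h.ι_inj.eq_iff]

theorem exit_ι [Finite S₁] [Finite S₂] (hα₁ : Function.Involutive α₁)
    (hβ₁ : Function.Involutive β₁) (hα₂ : Function.Involutive α₂) (hβ₂ : Function.Involutive β₂)
    (p : S₁) (hp : β₁ p = p) :
    exitNode α β (ι p) = ι (exitNode α₁ β₁ p) ∧
      pathLabel α β lab (ι p) (exitTime α β (ι p)) =
        pathLabel α₁ β₁ lab₁ p (exitTime α₁ β₁ p) := by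
  obtain ⟨T, hT0, hmono, hit, hlab, hmem⟩ := h.exists_time hα₂ hβ₂ p
  obtain ⟨hpos, hfix⟩ := exitTime_spec hα₁ hβ₁ p hp
  have ht : exitTime α β (ι p) = T (exitTime α₁ β₁ p) := by
    refine exitTime_eq_of_first (hT0 ▸ hmono hpos) ?_ fun j hj hj' hf => ?_
    · rw [hit, h.glue_ι_iff]
      exact hfix
    · obtain ⟨t, rfl⟩ := hmem j (h.outer_mem_range hf)
      rw [hit, h.glue_ι_iff] at hf
      exact exitTime_min p (hmono.lt_iff_lt.1 (by rwa [hT0])) (hmono.lt_iff_lt.1 hj') hf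
  rw [exitNode, ht, hit, hlab]
  exact ⟨rfl, rfl⟩

theorem orbitSum_ι [Finite S] [Finite S₁] [Finite S₂] (hα : Function.Involutive α)
    (hβ : Function.Involutive β) (hα₁ : Function.Involutive α₁)
    (hβ₁ : Function.Involutive β₁) (hα₂ : Function.Involutive α₂) (hβ₂ : Function.Involutive β₂)
    (s : S₁) : orbitSum α β lab (ι s) = orbitSum α₁ β₁ lab₁ s := by
  obtain ⟨T, hT0, hmono, hit, hlab, hmem⟩ := h.exists_time hα₂ hβ₂ s
  have hp := Function.minimalPeriod_pos_of_mem_periodicPts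
    ((step_injective hα hβ).mem_periodicPts (ι s))
  have hp₁ := Function.minimalPeriod_pos_of_mem_periodicPts
    ((step_injective hα₁ hβ₁).mem_periodicPts s)
  have : Function.minimalPeriod (step α β) (ι s) = T (Function.minimalPeriod (step α₁ β₁) s) := by
    apply le_antisymm
    · refine Function.IsPeriodicPt.minimalPeriod_le (hT0 ▸ hmono hp₁) ?_
      change _ = _
      rw [hit, Function.iterate_minimalPeriod]
    · obtain ⟨t, ht⟩ := hmem (Function.minimalPeriod (step α β) (ι s))
        ⟨s, Function.iterate_minimalPeriod.symm⟩
      rw [ht, hmono.le_iff_le]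
      refine Function.IsPeriodicPt.minimalPeriod_le (hmono.lt_iff_lt.1 (by rwa [hT0, ← ht])) ?_
      apply h.ι_inj
      rw [← hit, ← ht, Function.iterate_minimalPeriod]
  rw [orbitSum, this, hlab]
  rfl

theorem isLoopPt_ι [Finite S₂] (hα₂ : Function.Involutive α₂) (hβ₂ : Function.Involutive β₂)
    (s : S₁) : IsLoopPt α β (ι s) ↔ IsLoopPt α₁ β₁ s := by
  obtain ⟨T, hT0, hmono, hit, hlab, hmem⟩ := h.exists_time hα₂ hβ₂ s
  constructor
  · intro hl t ht
    apply hl (T t)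
    rw [hit, h.glue_ι_iff]
    exact ht
  · intro hl t ht
    obtain ⟨t, rfl⟩ := hmem t (h.outer_mem_range ht)
    rw [hit, h.glue_ι_iff] at ht
    exact hl t ht

theorem joined_ι [Finite S₂] (hα₂ : Function.Involutive α₂) (hβ₂ : Function.Involutive β₂)
    (s s' : S₁) : Joined α β (ι s) (ι s') ↔ Joined α₁ β₁ s s' := by
  obtain ⟨T, hT0, hmono, hit, hlab, hmem⟩ := h.exists_time hα₂ hβ₂ s
  constructor
  · rintro ⟨t, ht⟩
    obtain ⟨t, rfl⟩ := hmem t (by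
      rcases ht with ht | ht
      · exact ⟨_, ht.symm⟩
      · exact ⟨β₁ s', by rw [ht, h.glue_ι]⟩)
    rw [hit, h.glue_ι, h.ι_inj.eq_iff, h.ι_inj.eq_iff] at ht
    exact ⟨t, ht⟩
  · rintro ⟨t, ht⟩
    refine ⟨T t, ?_⟩
    rwa [hit, h.glue_ι, h.ι_inj.eq_iff, h.ι_inj.eq_iff]

theorem iterate_κ_of_isLoopPt {y : S₂} (hy : IsLoopPt α₂ β₂ y)
    (k : ℕ) : (step α β)^[k] (κ y) = κ ((step α₂ β₂)^[k] y) :=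
  h.iterate_κ y k fun j _ _ => hy j

theorem orbitSum_κ {y : S₂} (hy : IsLoopPt α₂ β₂ y) :
    orbitSum α β lab (κ y) = orbitSum α₂ β₂ lab₂ y := by
  have : Function.minimalPeriod (step α β) (κ y) = Function.minimalPeriod (step α₂ β₂) y := by
    rw [Function.minimalPeriod_eq_minimalPeriod_iff]
    intro k
    rw [Function.IsPeriodicPt, Function.IsPeriodicPt, Function.IsFixedPt, Function.IsFixedPt,
      h.iterate_κ_of_isLoopPt hy, h.κ_inj.eq_iff]
  rw [orbitSum, orbitSum, this, pathLabel, pathLabel]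
  refine Finset.sum_congr rfl fun j _ => ?_
  rw [h.iterate_κ_of_isLoopPt hy, h.lab_κ]

theorem isLoopPt_κ {y : S₂} (hy : IsLoopPt α₂ β₂ y) :
    IsLoopPt α β (κ y) := fun t => by
  rw [h.iterate_κ_of_isLoopPt hy, h.glue_κ _ (hy t), h.κ_inj.ne_iff]
  exact hy t

theorem not_joined_κ_ι {y : S₂} (hy : IsLoopPt α₂ β₂ y)
    (s : S₁) : ¬ Joined α β (κ y) (ι s) := by
  rintro ⟨t, ht⟩
  rw [h.iterate_κ_of_isLoopPt hy, h.glue_ι] at ht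
  rcases ht with ht | ht
  · exact h.inner_notMem _ (hy t) ⟨_, ht.symm⟩
  · exact h.inner_notMem _ (hy t) ⟨_, ht.symm⟩

theorem joined_κ {y y' : S₂} (hy : IsLoopPt α₂ β₂ y)
    (hy' : IsLoopPt α₂ β₂ y') : Joined α β (κ y) (κ y') ↔ Joined α₂ β₂ y y' := by
  have hg : β (κ y') = κ (β₂ y') := h.glue_κ _ (hy' 0)
  simp only [Joined, h.iterate_κ_of_isLoopPt hy, hg, h.κ_inj.eq_iff]

/-- The closed loops of `S` are those of `S₂`, which disappear in the contraction, and those of the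
contraction `S₁`. -/
theorem isTransversal [Finite S] [Finite S₂] [DecidableEq S] (hα : Function.Involutive α)
    (hβ : Function.Involutive β) (hα₂ : Function.Involutive α₂) (hβ₂ : Function.Involutive β₂)
    {R₁ : Finset S₁} {R₂ : Finset S₂} (h₁ : IsTransversal α₁ β₁ R₁)
    (h₂ : IsTransversal α₂ β₂ R₂) :
    IsTransversal α β (R₂.image κ ∪ R₁.image ι) := by
  constructor
  · intro r hr
    rw [Finset.mem_union, Finset.mem_image, Finset.mem_image] at hr
    rcases hr with ⟨y, hy, rfl⟩ | ⟨s, hs, rfl⟩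
    · exact h.isLoopPt_κ (h₂.1 y hy)
    · exact (h.isLoopPt_ι hα₂ hβ₂ s).2 (h₁.1 s hs)
  · intro s hs
    by_cases hmem : ∃ t, (step α β)^[t] s ∈ Set.range ι
    · obtain ⟨t, s₁, hs₁⟩ := hmem
      have hj : Joined α β s (ι s₁) := ⟨t, Or.inl hs₁.symm⟩
      have hl := (h.isLoopPt_ι hα₂ hβ₂ s₁).1 (hs.congr hα hβ hj)
      obtain ⟨r, ⟨hr, hr'⟩, huniq⟩ := h₁.2 s₁ hl
      refine ⟨ι r, ⟨Finset.mem_union_right _ (Finset.mem_image_of_mem _ hr),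
        hj.trans hα hβ ((h.joined_ι hα₂ hβ₂ _ _).2 hr')⟩, ?_⟩
      rintro x ⟨hx, hxj⟩
      have hx' := (hj.symm hα hβ).trans hα hβ hxj
      rw [Finset.mem_union, Finset.mem_image, Finset.mem_image] at hx
      rcases hx with ⟨y, hy, rfl⟩ | ⟨r', hr'', rfl⟩
      · exact absurd (hx'.symm hα hβ) (h.not_joined_κ_ι (h₂.1 y hy) s₁)
      · rw [huniq r' ⟨hr'', (h.joined_ι hα₂ hβ₂ _ _).1 hx'⟩]
    · push Not at hmem
      obtain ⟨y, rfl⟩ := h.cover s (hmem 0)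
      have key : ∀ t, (step α β)^[t] (κ y) = κ ((step α₂ β₂)^[t] y) ∧
          β₂ ((step α₂ β₂)^[t] y) ≠ (step α₂ β₂)^[t] y := fun t => by
        induction t with
        | zero => exact ⟨rfl, fun hy => hmem 0 (h.outer_mem y hy)⟩
        | succ t ih =>
          have h1 : β₂ ((step α₂ β₂)^[t + 1] y) ≠ (step α₂ β₂)^[t + 1] y := by
            intro hf
            rw [Function.iterate_succ_apply', step, hβ₂] at hf
            obtain ⟨s', hs'⟩ := h.outer_mem (α₂ ((step α₂ β₂)^[t] y)) hf.symm
            apply hmem (t + 1)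
            rw [Function.iterate_succ_apply', ih.1, step, h.strand_κ, ← hs', h.glue_ι]
            exact ⟨_, rfl⟩
          refine ⟨?_, h1⟩
          rw [Function.iterate_succ_apply'] at h1
          rw [Function.iterate_succ_apply', ih.1, h.step_κ h1, Function.iterate_succ_apply']
      have hy : IsLoopPt α₂ β₂ y := fun t => (key t).2
      obtain ⟨r, ⟨hr, hr'⟩, huniq⟩ := h₂.2 y hy
      refine ⟨κ r, ⟨Finset.mem_union_left _ (Finset.mem_image_of_mem _ hr),
        (h.joined_κ hy (h₂.1 r hr)).2 hr'⟩, ?_⟩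
      rintro x ⟨hx, hxj⟩
      rw [Finset.mem_union, Finset.mem_image, Finset.mem_image] at hx
      rcases hx with ⟨y', hy', rfl⟩ | ⟨r', -, rfl⟩
      · rw [huniq y' ⟨hy', (h.joined_κ hy (h₂.1 y' hy')).1 hxj⟩]
      · exact absurd hxj (h.not_joined_κ_ι hy r')

/-- The product over the loops before a contraction is the product over the loops that disappear
times the product over the remaining ones. -/
theorem prod_transversal [Finite S] [Finite S₁] [Finite S₂] [DecidableEq S] {K : Type*}
    [CommMonoid K] (δ : M → K) (hα : Function.Involutive α) (hβ : Function.Involutive β)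
    (hα₁ : Function.Involutive α₁) (hβ₁ : Function.Involutive β₁) (hα₂ : Function.Involutive α₂)
    (hβ₂ : Function.Involutive β₂) {R₁ : Finset S₁} {R₂ : Finset S₂}
    (h₂ : IsTransversal α₂ β₂ R₂) :
    ∏ r ∈ R₂.image κ ∪ R₁.image ι, δ (orbitSum α β lab r) =
      (∏ r ∈ R₂, δ (orbitSum α₂ β₂ lab₂ r)) * ∏ r ∈ R₁, δ (orbitSum α₁ β₁ lab₁ r) := by
  rw [Finset.prod_union, Finset.prod_image h.κ_inj.injOn, Finset.prod_image h.ι_inj.injOn]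
  · congr 1
    · exact Finset.prod_congr rfl fun r hr => by rw [h.orbitSum_κ (h₂.1 r hr)]
    · exact Finset.prod_congr rfl fun r _ => by rw [h.orbitSum_ι hα hβ hα₁ hβ₁ hα₂ hβ₂]
  · rw [Finset.disjoint_left]
    intro x hx hx'
    obtain ⟨y, hy, rfl⟩ := Finset.mem_image.1 hx
    obtain ⟨s, -, hs⟩ := Finset.mem_image.1 hx'
    exact h.inner_notMem y (h₂.1 y hy 0) ⟨s, hs⟩

end IsContraction

end Contraction

/-! ### Associativity -/

section Assoc

variable {m n : ℕ}

/-- The nodes of three stacked diagrams, from top to bottom. -/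
abbrev TripleNode (n : ℕ) : Type := Node n ⊕ (Node n ⊕ Node n)

/-- The identification of the nodes at the two interfaces of three stacked diagrams. -/
def glueTriple : TripleNode n → TripleNode n
  | .inl (.inl i) => .inl (.inl i)
  | .inl (.inr i) => .inr (.inl (.inl i))
  | .inr (.inl (.inl i)) => .inl (.inr i)
  | .inr (.inl (.inr i)) => .inr (.inr (.inl i))
  | .inr (.inr (.inl i)) => .inr (.inl (.inr i))
  | .inr (.inr (.inr i)) => .inr (.inr (.inr i))

/-- The strands of three stacked diagrams. -/
def triplePartner (X Y Z : Diagram m n) : TripleNode n → TripleNode n :=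
  Sum.map X.partner (Sum.map Y.partner Z.partner)

/-- The labels of three stacked diagrams. -/
def tripleLabel (X Y Z : Diagram m n) : TripleNode n → ZMod m :=
  Sum.elim X.label (Sum.elim Y.label Z.label)

theorem glueTriple_involutive : Function.Involutive (glueTriple (n := n)) := by
  rintro ((i | i) | ((i | i) | (i | i))) <;> rfl

theorem triplePartner_involutive (X Y Z : Diagram m n) :
    Function.Involutive (triplePartner X Y Z) := by
  rintro (p | p | p) <;> simp [triplePartner, Diagram.partner_partner]

theorem tripleLabel_triplePartner (X Y Z : Diagram m n) (s : TripleNode n) :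
    tripleLabel X Y Z (triplePartner X Y Z s) = -tripleLabel X Y Z s := by
  rcases s with p | p | p <;> simp [triplePartner, tripleLabel, Diagram.label_partner]

/-- The upper two of three stacked diagrams. -/
def upperPair : StackNode n → TripleNode n := Sum.elim .inl fun p => .inr (.inl p)

/-- The lower two of three stacked diagrams. -/
def lowerPair : StackNode n → TripleNode n := .inr

/-- The nodes that remain when the upper two of three diagrams are merged. -/
def mergeUpper : StackNode n → TripleNode n
  | .inl (.inl i) => .inl (.inl i)
  | .inl (.inr i) => .inr (.inl (.inr i))
  | .inr p => .inr (.inr p)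

/-- The nodes that remain when the lower two of three diagrams are merged. -/
def mergeLower : StackNode n → TripleNode n
  | .inl p => .inl p
  | .inr (.inl i) => .inr (.inl (.inl i))
  | .inr (.inr i) => .inr (.inr (.inr i))

/-- Merging the upper two of three stacked diagrams is a contraction. -/
theorem isContraction_upper (X Y Z : Diagram m n) :
    IsContraction (triplePartner X Y Z) glueTriple (tripleLabel X Y Z)
      (stackPartner (X.stack Y) Z) glueNode (stackLabel (X.stack Y) Z)
      (stackPartner X Y) glueNode (stackLabel X Y) mergeUpper upperPair where
  ι_inj := by rintro ((i | i) | (i | i)) ((j | j) | (j | j)) h <;> simp_all [mergeUpper]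
  κ_inj := by rintro ((i | i) | (i | i)) ((j | j) | (j | j)) h <;> simp_all [upperPair]
  strand_κ := by rintro (p | p) <;> rfl
  glue_κ := by rintro ((i | i) | (i | i)) h <;> simp_all [upperPair, glueNode, glueTriple]
  glue_ι := by rintro ((i | i) | (i | i)) <;> rfl
  lab_κ := by rintro (p | p) <;> rfl
  outer_mem := by
    rintro ((i | i) | (i | i)) h
    · exact ⟨.inl (.inl i), rfl⟩
    · simp [glueNode] at h
    · simp [glueNode] at h
    · exact ⟨.inl (.inr i), rfl⟩
  inner_notMem := by
    rintro ((i | i) | (i | i)) h ⟨((j | j) | (j | j)), hj⟩ <;>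
      simp_all [upperPair, mergeUpper, glueNode]
  cover := by
    rintro (p | p | p) h
    · exact ⟨.inl p, rfl⟩
    · exact ⟨.inr p, rfl⟩
    · exact absurd ⟨.inr p, rfl⟩ h
  strand_ι := by
    have hout : ∀ p : Node n, mergeUpper (.inl p) = upperPair (outerNode p) := by
      rintro (i | i) <;> rfl
    rintro (p | p)
    · refine Or.inr ⟨outerNode p, glueNode_outerNode p, hout p, ?_, rfl⟩
      rw [exitNode_outerNode, ← hout]
      rfl
    · exact Or.inl ⟨rfl, rfl⟩

/-- Merging the lower two of three stacked diagrams is a contraction. -/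
theorem isContraction_lower (X Y Z : Diagram m n) :
    IsContraction (triplePartner X Y Z) glueTriple (tripleLabel X Y Z)
      (stackPartner X (Y.stack Z)) glueNode (stackLabel X (Y.stack Z))
      (stackPartner Y Z) glueNode (stackLabel Y Z) mergeLower lowerPair where
  ι_inj := by rintro ((i | i) | (i | i)) ((j | j) | (j | j)) h <;> simp_all [mergeLower]
  κ_inj := Sum.inr_injective
  strand_κ := fun _ => rfl
  glue_κ := by rintro ((i | i) | (i | i)) h <;> simp_all [lowerPair, glueNode, glueTriple]
  glue_ι := by rintro ((i | i) | (i | i)) <;> rfl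
  lab_κ := by rintro (p | p) <;> rfl
  outer_mem := by
    rintro ((i | i) | (i | i)) h
    · exact ⟨.inr (.inl i), rfl⟩
    · simp [glueNode] at h
    · simp [glueNode] at h
    · exact ⟨.inr (.inr i), rfl⟩
  inner_notMem := by
    rintro ((i | i) | (i | i)) h ⟨((j | j) | (j | j)), hj⟩ <;>
      simp_all [lowerPair, mergeLower, glueNode]
  cover := by
    rintro (p | p) h
    · exact absurd ⟨.inl p, rfl⟩ h
    · exact ⟨p, rfl⟩
  strand_ι := by
    have hout : ∀ p : Node n, mergeLower (.inr p) = lowerPair (outerNode p) := by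
      rintro (i | i) <;> rfl
    rintro (p | p)
    · exact Or.inl ⟨rfl, rfl⟩
    · refine Or.inr ⟨outerNode p, glueNode_outerNode p, hout p, ?_, rfl⟩
      rw [exitNode_outerNode, ← hout]
      rfl

/-- Stacking of reduced diagrams is associative, whatever the parameters. -/
theorem stack_assoc (X Y Z : Diagram m n) :
    (X.stack Y).stack Z = X.stack (Y.stack Z) := by
  have hu := fun p : Node n => (isContraction_upper X Y Z).exit_ι (stackPartner_involutive _ _)
    glueNode_involutive (stackPartner_involutive _ _) glueNode_involutive (outerNode p)
    (glueNode_outerNode p)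
  have hl := fun p : Node n => (isContraction_lower X Y Z).exit_ι (stackPartner_involutive _ _)
    glueNode_involutive (stackPartner_involutive _ _) glueNode_involutive (outerNode p)
    (glueNode_outerNode p)
  have hout : ∀ p : Node n, mergeUpper (outerNode p) = mergeLower (outerNode p) := by
    rintro (i | i) <;> rfl
  ext p
  · have h := (hu p).1.symm.trans ((congrArg _ (hout p)).trans (hl p).1)
    rw [exitNode_outerNode, exitNode_outerNode, hout] at h
    exact outerNode_injective ((isContraction_lower X Y Z).ι_inj h)
  · have h := (hu p).2
    rw [hout] at h
    exact h.symm.trans (hl p).2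

open Classical in
/-- The central nodes at which the loops of two stacked diagrams start. -/
noncomputable def loopStarts (X Y : Diagram m n) : Finset (StackNode n) :=
  (Finset.univ.filter (IsLoopStart X Y)).image fun i => .inr (.inl i)

theorem prod_loopStarts {k : Type*} [Field k] (δ : ZMod m → k) (X Y : Diagram m n) :
    ∏ s ∈ loopStarts X Y, δ (orbitSum (stackPartner X Y) glueNode (stackLabel X Y) s) =
      loopFactor δ X Y := by
  rw [loopStarts, Finset.prod_image fun i _ j _ h => Sum.inl_injective (Sum.inr_injective h)]
  rfl

/-- Every closed loop has exactly one leftmost central node. -/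
theorem isTransversal_loopStarts (X Y : Diagram m n) :
    IsTransversal (stackPartner X Y) glueNode (loopStarts X Y) := by
  classical
  have hα := stackPartner_involutive X Y
  have hβ := glueNode_involutive (n := n)
  constructor
  · intro r hr
    obtain ⟨i, hi, rfl⟩ := Finset.mem_image.1 hr
    exact ((isLoopStart_iff X Y i).1 (Finset.mem_filter.1 hi).2).1
  · intro s hs
    have hc : ∃ i : Fin n, Joined (stackPartner X Y) glueNode s (.inr (.inl i)) := by
      rcases s with (i | i) | (i | i)
      · exact absurd rfl (hs 0)
      · exact ⟨i, Joined.glue hβ _⟩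
      · exact ⟨i, Joined.refl _⟩
      · exact absurd rfl (hs 0)
    obtain ⟨i, hi, hmin⟩ := Finset.exists_min_image
      (Finset.univ.filter fun i : Fin n => Joined (stackPartner X Y) glueNode s (.inr (.inl i)))
      (fun i => i) (by
        obtain ⟨i, hi⟩ := hc
        exact ⟨i, by simpa using hi⟩)
    simp only [Finset.mem_filter, Finset.mem_univ, true_and] at hi hmin
    have hstart : IsLoopStart X Y i := (isLoopStart_iff X Y i).2
      ⟨hs.congr hα hβ hi, fun j hj => hmin j (hi.trans hα hβ hj)⟩
    refine ⟨.inr (.inl i), ⟨Finset.mem_image_of_mem _ (by simpa using hstart), hi⟩, ?_⟩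
    rintro r ⟨hr, hr'⟩
    obtain ⟨j, hj, rfl⟩ := Finset.mem_image.1 hr
    have hj' := ((isLoopStart_iff X Y j).1 (Finset.mem_filter.1 hj).2).2
    rw [le_antisymm (hmin j hr') (hj' i ((hr'.symm hα hβ).trans hα hβ hi))]

/-- For symmetric parameters the factor of a loop does not depend on its orientation, so both ways
of merging three diagrams produce the product over all the closed loops of the three diagrams. -/
theorem loopFactor_assoc {k : Type*} [Field k] {δ : ZMod m → k} (hδ : ∀ i, δ (-i) = δ i)
    (X Y Z : Diagram m n) :
    loopFactor δ X Y * loopFactor δ (X.stack Y) Z =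
      loopFactor δ Y Z * loopFactor δ X (Y.stack Z) := by
  classical
  have hα := triplePartner_involutive X Y Z
  have hβ := glueTriple_involutive (n := n)
  have hu := isContraction_upper X Y Z
  have hl := isContraction_lower X Y Z
  simp only [← prod_loopStarts]
  rw [← hu.prod_transversal δ hα hβ (stackPartner_involutive _ _) glueNode_involutive
      (stackPartner_involutive _ _) glueNode_involutive (isTransversal_loopStarts X Y),
    ← hl.prod_transversal δ hα hβ (stackPartner_involutive _ _) glueNode_involutive
      (stackPartner_involutive _ _) glueNode_involutive (isTransversal_loopStarts Y Z)]
  exact (hu.isTransversal hα hβ (stackPartner_involutive _ _) glueNode_involutive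
    (isTransversal_loopStarts _ _) (isTransversal_loopStarts _ _)).prod_eq hα hβ
    (hl.isTransversal hα hβ (stackPartner_involutive _ _) glueNode_involutive
    (isTransversal_loopStarts _ _) (isTransversal_loopStarts _ _)) _
    fun s s' h => h.weight_eq hα hβ _ (tripleLabel_triplePartner X Y Z) hδ

theorem not_isLoopStart_of_le_one (hn : n ≤ 1) (X Y : Diagram m n) (i : Fin n) :
    ¬ IsLoopStart X Y i := by
  have : Subsingleton (Fin n) := Fin.subsingleton_iff_le_one.2 hn
  rcases h : Y.partner (.inl i) with j | j
  · exact absurd (by rw [h, Subsingleton.elim i j]) (Y.partner_ne (.inl i))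
  · exact not_isLoopStart_of_south X Y h

theorem loopFactor_assoc_of_le_one {k : Type*} [Field k] (δ : ZMod m → k) (hn : n ≤ 1)
    (X Y Z : Diagram m n) :
    loopFactor δ X Y * loopFactor δ (X.stack Y) Z =
      loopFactor δ Y Z * loopFactor δ X (Y.stack Z) := by
  simp only [fun X Y : Diagram m n => loopFactor_eq_one δ (not_isLoopStart_of_le_one hn X Y)]

end Assoc

end CyclotomicBrauer

namespace CyclotomicBrauer

/-! ### The unit and associativity of the algebra -/

section Algebra

variable {m n : ℕ} {k : Type*} [Field k] (δ : ZMod m → k)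

/-- The diagrams form a basis of the algebra. -/
noncomputable def diagramBasis : Module.Basis (Diagram m n) k (BrauerAlg k m n δ) :=
  (Finsupp.basisSingleOne : Module.Basis (Diagram m n) k (Diagram m n →₀ k))

theorem diagramBasis_apply (X : Diagram m n) : diagramBasis δ X = ofDiagram δ X :=
  congrFun Finsupp.coe_basisSingleOne X

theorem span_ofDiagram : Submodule.span k (Set.range (ofDiagram (n := n) δ)) = ⊤ := by
  rw [← (diagramBasis (n := n) δ).span_eq]
  congr 1

theorem linearMap_ext_diagram {N : Type*} [AddCommGroup N] [Module k N]
    {f g : BrauerAlg k m n δ →ₗ[k] N} (h : ∀ X, f (ofDiagram δ X) = g (ofDiagram δ X)) : f = g :=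
  (diagramBasis δ).ext fun X => by rw [diagramBasis_apply, h]

theorem ofDiagram_ne_zero (X : Diagram m n) : ofDiagram δ X ≠ 0 := by
  rw [← diagramBasis_apply]
  exact (diagramBasis δ).ne_zero X

theorem one_mul_brauer (x : BrauerAlg k m n δ) : 1 * x = x := by
  have : mulMap δ 1 = LinearMap.id := linearMap_ext_diagram δ fun X => by
    change ofDiagram δ (Diagram.id m n) * ofDiagram δ X = _
    rw [ofDiagram_mul, loopFactor_id_left, id_stack, one_smul, LinearMap.id_apply]
  exact LinearMap.congr_fun this x

theorem mul_one_brauer (x : BrauerAlg k m n δ) : x * 1 = x := by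
  have : (mulMap δ).flip 1 = LinearMap.id := linearMap_ext_diagram δ fun X => by
    change ofDiagram δ X * ofDiagram δ (Diagram.id m n) = _
    rw [ofDiagram_mul, loopFactor_id_right, stack_id, one_smul, LinearMap.id_apply]
  exact LinearMap.congr_fun this x

theorem ofDiagram_mul_mul (X Y Z : Diagram m n) :
    ofDiagram δ X * ofDiagram δ Y * ofDiagram δ Z =
      (loopFactor δ X Y * loopFactor δ (X.stack Y) Z) • ofDiagram δ ((X.stack Y).stack Z) := by
  rw [ofDiagram_mul, smul_mul_assoc, ofDiagram_mul, smul_smul]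

theorem ofDiagram_mul_mul' (X Y Z : Diagram m n) :
    ofDiagram δ X * (ofDiagram δ Y * ofDiagram δ Z) =
      (loopFactor δ Y Z * loopFactor δ X (Y.stack Z)) • ofDiagram δ ((X.stack Y).stack Z) := by
  rw [ofDiagram_mul, mul_smul_comm, ofDiagram_mul, smul_smul, stack_assoc]

/-- Since stacking is associative, only the loop factors can obstruct the associativity of the
algebra. -/
theorem mul_assoc_brauer_iff :
    (∀ x y z : BrauerAlg k m n δ, x * y * z = x * (y * z)) ↔
      ∀ X Y Z : Diagram m n, loopFactor δ X Y * loopFactor δ (X.stack Y) Z =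
        loopFactor δ Y Z * loopFactor δ X (Y.stack Z) := by
  constructor
  · intro h X Y Z
    have := h (ofDiagram δ X) (ofDiagram δ Y) (ofDiagram δ Z)
    rw [ofDiagram_mul_mul, ofDiagram_mul_mul'] at this
    exact smul_left_injective k (ofDiagram_ne_zero δ _) this
  · intro h
    have h1 : ∀ (X Y : Diagram m n) (z : BrauerAlg k m n δ),
        ofDiagram δ X * ofDiagram δ Y * z = ofDiagram δ X * (ofDiagram δ Y * z) := fun X Y z => by
      have : mulMap δ (ofDiagram δ X * ofDiagram δ Y) =
          mulMap δ (ofDiagram δ X) ∘ₗ mulMap δ (ofDiagram δ Y) :=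
            linearMap_ext_diagram δ fun Z => by
        change ofDiagram δ X * ofDiagram δ Y * ofDiagram δ Z =
          ofDiagram δ X * (ofDiagram δ Y * ofDiagram δ Z)
        rw [ofDiagram_mul_mul, ofDiagram_mul_mul', h]
      exact LinearMap.congr_fun this z
    have h2 : ∀ (X : Diagram m n) (y z : BrauerAlg k m n δ),
        ofDiagram δ X * y * z = ofDiagram δ X * (y * z) := fun X y z => by
      have : (mulMap δ).flip z ∘ₗ mulMap δ (ofDiagram δ X) =
          mulMap δ (ofDiagram δ X) ∘ₗ (mulMap δ).flip z :=
        linearMap_ext_diagram δ fun Y => h1 X Y z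
      exact LinearMap.congr_fun this y
    intro x y z
    have : (mulMap δ).flip z ∘ₗ (mulMap δ).flip y = (mulMap δ).flip (y * z) :=
      linearMap_ext_diagram δ fun X => h2 X y z
    exact LinearMap.congr_fun this x

/-! ### Associativity forces symmetric parameters -/

section Counterexample

variable {i₀ i₁ : Fin n}

/-- The diagram with a northern arc and a southern arc joining the nodes `i₀` and `i₁`, where the
southern arc has the label `a` and all other labels are `0`. -/
def hook (h : i₀ ≠ i₁) (a : ZMod m) : Diagram m n where
  partner
    | .inl i => if i = i₀ then .inl i₁ else if i = i₁ then .inl i₀ else .inr i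
    | .inr i => if i = i₀ then .inr i₁ else if i = i₁ then .inr i₀ else .inl i
  label
    | .inl _ => 0
    | .inr i => if i = i₀ then a else if i = i₁ then -a else 0
  partner_partner := by
    rintro (i | i) <;> by_cases h0 : i = i₀ <;> by_cases h1 : i = i₁ <;> simp_all [h.symm]
  partner_ne := by
    rintro (i | i) <;> by_cases h0 : i = i₀ <;> by_cases h1 : i = i₁ <;> simp_all [h.symm]
  label_partner := by
    rintro (i | i) <;> by_cases h0 : i = i₀ <;> by_cases h1 : i = i₁ <;> simp_all [h.symm]

/-- The diagram of the transposition of `i₀` and `i₁`, with all labels `0`. -/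
def crossing (i₀ i₁ : Fin n) : Diagram m n where
  partner := Sum.elim (fun i => .inr (Equiv.swap i₀ i₁ i)) (fun i => .inl (Equiv.swap i₀ i₁ i))
  label _ := 0
  partner_partner := by rintro (i | i) <;> simp
  partner_ne := by rintro (i | i) <;> simp
  label_partner _ := by simp

/-- The two arcs at `i₀` and `i₁` form the only loop, which is traversed downwards from its left
node `i₀`, that is, against the orientation of the southern arc from `i₀` to `i₁`. -/
theorem loopFactor_of_arcs (h : i₀ < i₁) {X Y : Diagram m n}
    (hX : X.partner (.inr i₀) = .inr i₁) (hY : Y.partner (.inl i₀) = .inl i₁)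
    (hY' : Y.label (.inl i₀) = 0)
    (hY'' : ∀ i, i ≠ i₀ → i ≠ i₁ → ∃ j, Y.partner (.inl i) = .inr j) :
    loopFactor δ X Y = δ (-X.label (.inr i₀)) := by
  classical
  have hX' : X.partner (.inr i₁) = .inr i₀ := by rw [← hX, X.partner_partner]
  have hYs : Y.partner (.inl i₁) = .inl i₀ := by rw [← hY, Y.partner_partner]
  have h1 : step (stackPartner X Y) glueNode (.inr (.inl i₀)) = .inl (.inr i₁) := by
    simp [step, stackPartner, hY, glueNode]
  have h2 : step (stackPartner X Y) glueNode (.inl (.inr i₁)) = .inr (.inl i₀) := by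
    simp [step, stackPartner, hX', glueNode]
  have h3 : step (stackPartner X Y) glueNode (.inr (.inl i₁)) = .inl (.inr i₀) := by
    simp [step, stackPartner, hYs, glueNode]
  have hit : ∀ t, fromCentral X Y i₀ t = .inr (.inl i₀) ∨ fromCentral X Y i₀ t = .inl (.inr i₁) :=
    fun t => by
      induction t with
      | zero => exact Or.inl rfl
      | succ t ih =>
        rw [fromCentral, Function.iterate_succ_apply']
        rcases ih with ih | ih <;> rw [fromCentral] at ih <;> rw [ih]
        · exact Or.inr h1
        · exact Or.inl h2
  have hper : Function.minimalPeriod (step (stackPartner X Y) glueNode) (.inr (.inl i₀)) = 2 := by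
    apply Function.minimalPeriod_eq_prime
    · change step (stackPartner X Y) glueNode
        (step (stackPartner X Y) glueNode (.inr (.inl i₀))) = _
      rw [h1, h2]
    · intro hf
      rw [Function.IsFixedPt, h1] at hf
      simp at hf
  have hfilter : Finset.univ.filter (IsLoopStart X Y) = {i₀} := by
    ext i
    simp only [Finset.mem_filter, Finset.mem_univ, true_and, Finset.mem_singleton]
    constructor
    · intro hi
      by_contra hi0
      by_cases hi1 : i = i₁
      · subst hi1
        exact absurd (((isLoopStart_iff X Y i).1 hi).2 i₀ ⟨1, Or.inr h3⟩) (not_le.2 h)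
      · obtain ⟨j, hj⟩ := hY'' i hi0 hi1
        exact not_isLoopStart_of_south X Y hj hi
    · rintro rfl
      constructor
      · intro t
        rcases hit t with ht | ht <;> rw [ht] <;> simp [glueNode]
      · intro t j hj
        rcases hit t with ht | ht <;> rw [ht] at hj <;> simp at hj
        · exact hj.le
        · exact hj ▸ h.le
  rw [loopFactor, hfilter, Finset.prod_singleton, loopLabel, hper, pathLabel_two, h1]
  simp [stackLabel, hY', ← hX, X.label_partner]

/-- Sliding the crossing from the lower to the upper side of a loop turns the loop around. -/
theorem symmetric_of_assoc (h : i₀ < i₁)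
    (H : ∀ X Y Z : Diagram m n, loopFactor δ X Y * loopFactor δ (X.stack Y) Z =
        loopFactor δ Y Z * loopFactor δ X (Y.stack Z)) (a : ZMod m) : δ (-a) = δ a := by
  have hne := h.ne
  have hs : ∀ i, i ≠ i₀ → i ≠ i₁ → Equiv.swap i₀ i₁ i = i := fun i =>
    Equiv.swap_apply_of_ne_of_ne
  let Y : Diagram m n := crossing i₀ i₁
  have key := H (hook hne a) Y (hook hne 0)
  have hXY : loopFactor δ (hook hne a) Y = 1 :=
    loopFactor_eq_one δ fun i => not_isLoopStart_of_south _ _ (j := Equiv.swap i₀ i₁ i) rfl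
  have hYZ : loopFactor δ Y (hook hne (0 : ZMod m)) = 1 := by
    refine loopFactor_eq_one δ fun i => ?_
    rcases h' : (hook hne (0 : ZMod m)).partner (.inl i) with j | j
    · exact not_isLoopStart_of_north _ _ h' (j := Equiv.swap i₀ i₁ j) rfl
    · exact not_isLoopStart_of_south _ _ h'
  have h1 := stack_south_three (hook hne a) Y (i := i₀) (c := i₁) (c' := i₀) (j := i₁)
    (by simp [Y, crossing]) (by simp [hook, hne.symm]) (by simp [Y, crossing])
  have h2 := stack_north_three Y (hook hne (0 : ZMod m)) (i := i₀) (c := i₁) (c' := i₀) (j := i₁)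
    (by simp [Y, crossing]) (by simp [hook, hne.symm]) (by simp [Y, crossing])
  rw [hXY, hYZ, one_mul, one_mul, loopFactor_of_arcs δ h h1.1 (by simp [hook]) (by simp [hook])
      (fun i hi hi' => ⟨i, by simp [hook, hi, hi']⟩),
    loopFactor_of_arcs δ h (by simp [hook]) h2.1 (by rw [h2.2]; simp [Y, crossing, hook])
      (fun i hi hi' => ⟨i, (stack_north_two Y (hook hne (0 : ZMod m)) (c := i)
        (by simp [Y, crossing, hs i hi hi']) (by simp [hook, hi, hi'])).1⟩), h1.2] at key
  simpa [Y, crossing, hook, hne.symm] using key.symm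

end Counterexample

theorem mul_assoc_brauer_iff_symmetric :
    (∀ x y z : BrauerAlg k m n δ, x * y * z = x * (y * z)) ↔ (2 ≤ n → ∀ i, δ (-i) = δ i) := by
  rw [mul_assoc_brauer_iff]
  constructor
  · intro H hn a
    exact symmetric_of_assoc δ (i₀ := ⟨0, by omega⟩) (i₁ := ⟨1, by omega⟩) (by simp) H a
  · intro H X Y Z
    by_cases hn : 2 ≤ n
    · exact loopFactor_assoc (H hn) X Y Z
    · exact loopFactor_assoc_of_le_one δ (by omega) X Y Z

end Algebra

end CyclotomicBrauer

namespace CyclotomicBrauer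

/-! ### Cutting diagrams into dangles -/

section Dangles

variable {m n l : ℕ}

namespace Wreath

variable {N : ℕ}

theorem flip_flip (g : Wreath m N) : g.flip.flip = g := by
  ext i <;> simp [Wreath.flip]

theorem mul_left_apply (g h : Wreath m N) (i : Fin N) :
    (g * h).left i = g.left i * h.left (g.right⁻¹ i) := rfl

theorem flip_mul (g h : Wreath m N) : (g * h).flip = h.flip * g.flip := by
  refine SemidirectProduct.ext (funext fun i => ?_) (mul_inv_rev _ _)
  rw [mul_left_apply]
  change (g * h).left (g.right (h.right i)) = h.left (h.right i) * g.left (g.right (h.right⁻¹⁻¹ i))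
  rw [mul_left_apply, inv_inv, mul_comm]
  simp

theorem flip_one : (1 : Wreath m N).flip = 1 := by
  ext i <;> simp [Wreath.flip]

end Wreath

namespace Dangle

theorem assemble_flip (d d' : Dangle m n l) (g : Wreath m (n - 2 * l)) :
    (d.assemble d' g).flip = d'.assemble d g.flip := by
  ext (i | i)
  · by_cases h : i ∈ d'.free <;> simp [Diagram.flip, assemble, Wreath.flip, h]
  · by_cases h : i ∈ d.free <;> simp [Diagram.flip, assemble, Wreath.flip, h]
  · by_cases h : i ∈ d'.free <;> simp [Diagram.flip, assemble, Wreath.flip, h]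
  · by_cases h : i ∈ d.free <;> simp [Diagram.flip, assemble, Wreath.flip, h]

theorem assemble_north_free (d d' : Dangle m n l) (g : Wreath m (n - 2 * l))
    (q : Fin (n - 2 * l)) :
    (d.assemble d' g).partner (.inl (d.freeIso q)) = .inr (d'.freeIso (g.right⁻¹ q)) ∧
      (d.assemble d' g).label (.inl (d.freeIso q)) = (g.left q).toAdd := by
  simp [assemble]

theorem assemble_north_arc (d d' : Dangle m n l) (g : Wreath m (n - 2 * l)) {i : Fin n}
    (h : i ∉ d.free) : (d.assemble d' g).partner (.inl i) = .inl (d.partner i) ∧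
      (d.assemble d' g).label (.inl i) = d.label i := by
  simp [assemble, h]

theorem assemble_south_arc (d d' : Dangle m n l) (g : Wreath m (n - 2 * l)) {i : Fin n}
    (h : i ∉ d'.free) : (d.assemble d' g).partner (.inr i) = .inr (d'.partner i) ∧
      (d.assemble d' g).label (.inr i) = -d'.label i := by
  simp [assemble, h]

theorem exists_freeIso (d : Dangle m n l) {i : Fin n} (h : i ∈ d.free) :
    ∃ q, (d.freeIso q : Fin n) = i := by
  obtain ⟨q, hq⟩ := d.freeIso.surjective ⟨i, h⟩
  exact ⟨q, by rw [hq]⟩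

/-- A diagram is assembled from two dangles and a group element as soon as its arcs and through
strands are the prescribed ones. -/
theorem eq_assemble (d d' : Dangle m n l) (g : Wreath m (n - 2 * l)) {X : Diagram m n}
    (hn : ∀ i, i ∉ d.free → X.partner (.inl i) = .inl (d.partner i) ∧ X.label (.inl i) = d.label i)
    (ht : ∀ q, X.partner (.inl (d.freeIso q)) = .inr (d'.freeIso (g.right⁻¹ q)) ∧
      X.label (.inl (d.freeIso q)) = (g.left q).toAdd)
    (hs : ∀ i, i ∉ d'.free → X.partner (.inr i) = .inr (d'.partner i) ∧
      X.label (.inr i) = -d'.label i) : X = d.assemble d' g := by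
  have key : ∀ p, X.partner p = (d.assemble d' g).partner p ∧
      X.label p = (d.assemble d' g).label p := by
    rintro (i | i)
    · by_cases h : i ∈ d.free
      · obtain ⟨q, rfl⟩ := d.exists_freeIso h
        rw [(ht q).1, (ht q).2, (assemble_north_free d d' g q).1, (assemble_north_free d d' g q).2]
        exact ⟨rfl, rfl⟩
      · rw [(hn i h).1, (hn i h).2, (assemble_north_arc d d' g h).1,
          (assemble_north_arc d d' g h).2]
        exact ⟨rfl, rfl⟩
    · by_cases h : i ∈ d'.free
      · obtain ⟨q, rfl⟩ := d'.exists_freeIso h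
        have h1 := ht (g.right q)
        have h2 := assemble_north_free d d' g (g.right q)
        rw [show g.right⁻¹ (g.right q) = q by simp] at h1 h2
        rw [← h1.1, X.partner_partner, X.label_partner, h1.1,
          h1.2, ← h2.1, Diagram.partner_partner, Diagram.label_partner, h2.2]
        exact ⟨rfl, rfl⟩
      · rw [(hs i h).1, (hs i h).2, (assemble_south_arc d d' g h).1,
          (assemble_south_arc d d' g h).2]
        exact ⟨rfl, rfl⟩
  ext p
  exacts [(key p).1, (key p).2]

/-- If the arcs of the dangle `d` are arcs of `e`, which has equally many arcs, then `d = e`. -/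
theorem eq_of_arcs {d e : Dangle m n l}
    (h : ∀ i, i ∉ d.free → e.partner i = d.partner i ∧ e.label i = d.label i) : d = e := by
  have hsub : e.free ⊆ d.free := fun i hi => by
    by_contra hd
    rw [mem_free] at hi hd
    exact hd (by rw [← (h i (by rwa [mem_free])).1, hi])
  have hfree : e.free = d.free :=
    Finset.eq_of_subset_of_card_le hsub (by rw [card_free_eq, card_free_eq])
  ext i
  · by_cases hi : i ∈ d.free
    · have hi' := hi
      rw [← hfree] at hi'
      rw [(d.mem_free i).1 hi, (e.mem_free i).1 hi']
    · rw [(h i hi).1]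
  · by_cases hi : i ∈ d.free
    · have hi' := hi
      rw [← hfree] at hi'
      rw [d.label_free i ((d.mem_free i).1 hi), e.label_free i ((e.mem_free i).1 hi')]
    · rw [(h i hi).2]

theorem north_notMem_free {d d' : Dangle m n l} {g : Wreath m (n - 2 * l)} {i j : Fin n}
    (h : (d.assemble d' g).partner (.inl i) = .inl j) : i ∉ d.free := fun hi => by
  obtain ⟨q, rfl⟩ := d.exists_freeIso hi
  rw [(assemble_north_free d d' g q).1] at h
  simp at h

theorem assemble_injective {d d' e e' : Dangle m n l} {g h : Wreath m (n - 2 * l)}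
    (H : d.assemble d' g = e.assemble e' h) : d = e ∧ d' = e' ∧ g = h := by
  have hd : ∀ {d d' e e' : Dangle m n l} {g h : Wreath m (n - 2 * l)},
      d.assemble d' g = e.assemble e' h → d = e := fun {d d' e e' g h} H => by
    refine eq_of_arcs fun i hi => ?_
    have h1 := assemble_north_arc d d' g hi
    rw [H] at h1
    have h2 := assemble_north_arc e e' h (north_notMem_free h1.1)
    exact ⟨Sum.inl_injective (h2.1.symm.trans h1.1), h2.2.symm.trans h1.2⟩
  obtain rfl := hd H
  have H' := congrArg Diagram.flip H
  rw [assemble_flip, assemble_flip] at H'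
  obtain rfl := hd H'
  refine ⟨rfl, rfl, ?_⟩
  have key : ∀ q, g.right⁻¹ q = h.right⁻¹ q ∧ g.left q = h.left q := fun q => by
    have h1 := assemble_north_free d d' g q
    have h2 := assemble_north_free d d' h q
    rw [H] at h1
    have h3 := Sum.inr_injective (h1.1.symm.trans h2.1)
    exact ⟨d'.freeIso.injective (Subtype.ext h3), Multiplicative.toAdd.injective
      (h1.2.symm.trans h2.2)⟩
  refine SemidirectProduct.ext (funext fun q => (key q).2) (inv_injective ?_)
  exact Equiv.ext fun q => (key q).1

/-- Diagrams whose cut-open dangles match are multiplied like the group elements. -/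
theorem stack_assemble (d d' e : Dangle m n l) (g h : Wreath m (n - 2 * l)) :
    (d.assemble d' g).stack (d'.assemble e h) = d.assemble e (g * h) := by
  refine eq_assemble _ _ _ (fun i hi => ?_) (fun q => ?_) fun i hi => ?_
  · have h1 := assemble_north_arc d d' g hi
    have h2 := stack_north_one _ (d'.assemble e h) h1.1
    exact ⟨h2.1, h2.2.trans h1.2⟩
  · have h1 := assemble_north_free d d' g q
    have h2 := assemble_north_free d' e h (g.right⁻¹ q)
    have h3 := stack_north_two _ _ h1.1 h2.1
    refine ⟨h3.1.trans (by simp), ?_⟩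
    rw [h3.2, h1.2, h2.2, Wreath.mul_left_apply, toAdd_mul]
  · have h1 := assemble_south_arc d' e h hi
    have h2 := stack_south_one (d.assemble d' g) _ h1.1
    exact ⟨h2.1, h2.2.trans h1.2⟩

end Dangle

/-! ### The number of through strands -/

/-- The northern nodes of the through strands. -/
def Diagram.through (X : Diagram m n) : Finset (Fin n) :=
  Finset.univ.filter fun i => (X.partner (.inl i)).isRight

theorem Diagram.mem_through (X : Diagram m n) (i : Fin n) :
    i ∈ X.through ↔ ∃ j, X.partner (.inl i) = .inr j := by
  rw [Diagram.through, Finset.mem_filter, Sum.isRight_iff]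
  simp

theorem Diagram.notMem_through (X : Diagram m n) (i : Fin n) :
    i ∉ X.through ↔ ∃ j, X.partner (.inl i) = .inl j := by
  rw [mem_through]
  rcases X.partner (.inl i) with j | j <;> simp

theorem Diagram.card_through_le_flip (X : Diagram m n) : X.through.card ≤ X.flip.through.card := by
  have h : ∀ i ∈ X.through, ∃ j, X.partner (.inl i) = .inr j := fun i => (X.mem_through i).1
  choose f hf using h
  refine Finset.card_le_card_of_injOn (fun i => if hi : i ∈ X.through then f i hi else i) ?_ ?_
  · intro i hi
    have hi' : i ∈ X.through := hi
    simp only [hi', dite_true, Finset.mem_coe]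
    rw [mem_through]
    exact ⟨i, flip_eq_of_partner (p := .inr (f i hi')) (q := .inl i)
      (by rw [← hf i hi', X.partner_partner])⟩
  · intro i hi j hj hij
    have hi' : i ∈ X.through := hi
    have hj' : j ∈ X.through := hj
    simp only [hi', hj', dite_true] at hij
    have := (hf i hi').trans ((congrArg _ hij).trans (hf j hj').symm)
    exact Sum.inl_injective (Function.LeftInverse.injective X.partner_partner this)

theorem Diagram.card_through_flip (X : Diagram m n) : X.flip.through.card = X.through.card :=
  le_antisymm (by simpa [Diagram.flip_flip] using X.flip.card_through_le_flip)
    X.card_through_le_flip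

theorem card_through_stack_left (X Y : Diagram m n) :
    (X.stack Y).through.card ≤ X.through.card := by
  refine Finset.card_le_card fun i hi => ?_
  by_contra hX
  obtain ⟨j, hj⟩ := (X.notMem_through i).1 hX
  exact ((X.stack Y).notMem_through i).2 ⟨j, (stack_north_one X Y hj).1⟩ hi

theorem card_through_stack_right (X Y : Diagram m n) :
    (X.stack Y).through.card ≤ Y.through.card := by
  rw [← Diagram.card_through_flip, stack_flip, ← Diagram.card_through_flip Y]
  exact card_through_stack_left _ _

theorem Dangle.through_assemble (d d' : Dangle m n l) (g : Wreath m (n - 2 * l)) :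
    (d.assemble d' g).through = d.free := by
  ext i
  constructor
  · intro h
    by_contra hi
    exact (Diagram.notMem_through _ i).2 ⟨_, (assemble_north_arc d d' g hi).1⟩ h
  · intro h
    obtain ⟨q, rfl⟩ := d.exists_freeIso h
    exact (Diagram.mem_through _ _).2 ⟨_, (assemble_north_free d d' g q).1⟩

/-- The other end of the northern arc at `i`, or `i` itself if `i` lies on a through strand. -/
def Diagram.northPartner (X : Diagram m n) (i : Fin n) : Fin n :=
  (X.partner (.inl i)).elim (fun j => j) (fun _ => i)

theorem Diagram.northPartner_of_inl {X : Diagram m n} {i j : Fin n}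
    (h : X.partner (.inl i) = .inl j) : X.northPartner i = j := by
  rw [northPartner, h, Sum.elim_inl]

theorem Diagram.northPartner_of_inr {X : Diagram m n} {i j : Fin n}
    (h : X.partner (.inl i) = .inr j) : X.northPartner i = i := by
  rw [northPartner, h, Sum.elim_inr]

theorem Diagram.northPartner_northPartner (X : Diagram m n) (i : Fin n) :
    X.northPartner (X.northPartner i) = i := by
  rcases h : X.partner (.inl i) with j | j
  · rw [northPartner_of_inl h,
      northPartner_of_inl (i := j) (j := i) (by rw [← h, X.partner_partner])]
  · rw [northPartner_of_inr h, northPartner_of_inr h]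

theorem Diagram.northPartner_eq_self_iff (X : Diagram m n) (i : Fin n) :
    X.northPartner i = i ↔ i ∈ X.through := by
  rw [mem_through]
  rcases h : X.partner (.inl i) with j | j
  · rw [northPartner_of_inl h]
    have : j ≠ i := by
      rintro rfl
      exact X.partner_ne _ h
    simp [this]
  · simp [northPartner_of_inr h]

/-- The dangle of the northern arcs of a diagram. -/
def Diagram.northDangle (X : Diagram m n) (h : X.through.card + 2 * l = n) : Dangle m n l where
  partner := X.northPartner
  label i := if i ∈ X.through then 0 else X.label (.inl i)
  partner_partner := X.northPartner_northPartner
  label_partner i := by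
    by_cases hi : i ∈ X.through
    · rw [(X.northPartner_eq_self_iff i).2 hi, if_pos hi, neg_zero]
    · obtain ⟨j, hj⟩ := (X.notMem_through i).1 hi
      have hj' : j ∉ X.through := (X.notMem_through j).2 ⟨i, by rw [← hj, X.partner_partner]⟩
      rw [northPartner_of_inl hj, if_neg hi, if_neg hj', ← X.label_partner, hj]
  label_free i h' := if_pos ((X.northPartner_eq_self_iff i).1 h')
  card_free := by
    simp only [northPartner_eq_self_iff, Finset.filter_mem_eq_inter, Finset.univ_inter, h]

theorem Diagram.northDangle_free (X : Diagram m n) (h : X.through.card + 2 * l = n) {i : Fin n} :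
    i ∈ (X.northDangle h).free ↔ i ∈ X.through := by
  rw [Dangle.mem_free, ← northPartner_eq_self_iff]
  rfl

theorem Diagram.northDangle_arc (X : Diagram m n) (h : X.through.card + 2 * l = n) {i : Fin n}
    (hi : i ∉ (X.northDangle h).free) :
    X.partner (.inl i) = .inl ((X.northDangle h).partner i) ∧
      X.label (.inl i) = (X.northDangle h).label i := by
  rw [northDangle_free] at hi
  obtain ⟨j, hj⟩ := (X.notMem_through i).1 hi
  exact ⟨hj.trans (congrArg _ (northPartner_of_inl hj).symm), (if_neg hi).symm⟩

theorem Diagram.exists_layer (X : Diagram m n) : ∃ l ≤ n / 2, X.through.card + 2 * l = n := by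
  classical
  let f : Function.End (Fin n) := X.northPartner
  have hf : f ^ 2 ^ 1 = 1 := by
    rw [pow_one, pow_two]
    exact funext X.northPartner_northPartner
  have h1 := Equiv.Perm.card_fixedPoints_modEq hf
  have h2 : Fintype.card f.fixedPoints = X.through.card := by
    rw [Fintype.card_subtype]
    congr 1
    ext i
    rw [Finset.mem_filter, ← X.northPartner_eq_self_iff]
    exact and_iff_right (Finset.mem_univ i)
  rw [h2, Fintype.card_fin] at h1
  have h3 : X.through.card ≤ n := (Finset.card_le_univ _).trans_eq (Fintype.card_fin n)
  have h4 : n % 2 = X.through.card % 2 := h1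
  exact ⟨(n - X.through.card) / 2, by omega, by omega⟩

theorem exists_assemble (X : Diagram m n) (h : X.through.card + 2 * l = n) :
    ∃ (d d' : Dangle m n l) (g : Wreath m (n - 2 * l)), X = d.assemble d' g := by
  have h' : X.flip.through.card + 2 * l = n := by rw [X.card_through_flip, h]
  set d := X.northDangle h
  set d' := X.flip.northDangle h'
  have hmem : ∀ i, i ∈ d'.free ↔ ∃ j, X.partner (.inr i) = .inl j := fun i => by
    rw [Diagram.northDangle_free, Diagram.mem_through]
    change (∃ j, (X.partner (.inr i)).swap = .inr j) ↔ _
    rcases X.partner (.inr i) with j | j <;> simp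
  have hex : ∀ q, ∃ q', X.partner (.inl (d.freeIso q)) = .inr (d'.freeIso q') := fun q => by
    obtain ⟨j, hj⟩ := (X.mem_through _).1 ((X.northDangle_free h).1 (d.freeIso q).2)
    have hj' : j ∈ d'.free := (hmem j).2 ⟨d.freeIso q, by rw [← hj, X.partner_partner]⟩
    obtain ⟨q', rfl⟩ := d'.exists_freeIso hj'
    exact ⟨q', hj⟩
  choose s hs using hex
  have hinj : Function.Injective s := fun q q' hq => by
    have := (hs q).trans ((congrArg _ (congrArg _ (congrArg _ hq))).trans (hs q').symm)
    have := Function.LeftInverse.injective X.partner_partner this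
    exact d.freeIso.injective (Subtype.ext (Sum.inl_injective this))
  let σ : Equiv.Perm (Fin (n - 2 * l)) :=
    Equiv.ofBijective s (Finite.injective_iff_bijective.1 hinj)
  refine ⟨d, d', ⟨fun q => Multiplicative.ofAdd (X.label (.inl (d.freeIso q))), σ⁻¹⟩,
    Dangle.eq_assemble _ _ _ (fun i hi => X.northDangle_arc h hi)
    (fun q => ⟨hs q, rfl⟩) fun i hi => ?_⟩
  have := X.flip.northDangle_arc h' hi
  have h1 := flip_eq_of_partner this.1
  rw [Diagram.flip_flip] at h1
  exact ⟨h1, neg_injective ((this.2).trans (neg_neg _).symm)⟩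

theorem Dangle.two_mul_le (d : Dangle m n l) : 2 * l ≤ n := by
  have := d.card_free
  omega

variable (m n) in
/-- A layer, two dangles with that many arcs and a group element: the data of a diagram. -/
abbrev CutData : Type :=
  Σ l : Fin (n / 2 + 1), Dangle m n l × (Dangle m n l × Wreath m (n - 2 * l))

/-- The diagram assembled from its parts. -/
def CutData.toDiagram (x : CutData m n) : Diagram m n := x.2.1.assemble x.2.2.1 x.2.2.2

theorem Dangle.card_through_assemble (d d' : Dangle m n l) (g : Wreath m (n - 2 * l)) :
    (d.assemble d' g).through.card = n - 2 * l := by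
  rw [Dangle.through_assemble, Dangle.card_free_eq]

theorem CutData.toDiagram_bijective : Function.Bijective (CutData.toDiagram (m := m) (n := n)) := by
  constructor
  · rintro ⟨l, d, d', g⟩ ⟨l', e, e', h⟩ H
    have hc := congrArg (fun X : Diagram m n => X.through.card) H
    simp only [toDiagram, Dangle.card_through_assemble] at hc
    have hd := d.two_mul_le
    have he := e.two_mul_le
    obtain rfl : l = l' := Fin.ext (by omega)
    obtain ⟨rfl, rfl, rfl⟩ := Dangle.assemble_injective H
    rfl
  · intro X
    obtain ⟨l, hl, hX⟩ := X.exists_layer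
    obtain ⟨d, d', g, rfl⟩ := exists_assemble X hX
    exact ⟨⟨⟨l, Nat.lt_succ_of_le hl⟩, d, d', g⟩, rfl⟩

/-- Every diagram is assembled from unique parts. -/
noncomputable def cutEquiv (m n : ℕ) : CutData m n ≃ Diagram m n :=
  Equiv.ofBijective _ CutData.toDiagram_bijective

/-! ### Stacking above an assembled diagram -/

theorem card_through_stack_assemble_le (X : Diagram m n) (d d' : Dangle m n l)
    (g : Wreath m (n - 2 * l)) : (X.stack (d.assemble d' g)).through.card ≤ n - 2 * l :=
  (card_through_stack_right _ _).trans_eq (d.card_through_assemble d' g)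

/-- If no through strand is lost, then the southern dangle of the lower diagram survives. -/
theorem exists_stack_eq (X : Diagram m n) (d d' : Dangle m n l) (g : Wreath m (n - 2 * l))
    (h : (X.stack (d.assemble d' g)).through.card = n - 2 * l) :
    ∃ (e : Dangle m n l) (h : Wreath m (n - 2 * l)),
      X.stack (d.assemble d' g) = e.assemble d' h := by
  have hl := d.two_mul_le
  obtain ⟨e, e', x, hx⟩ := exists_assemble (l := l) _ (by rw [h]; omega)
  obtain rfl : d' = e' := by
    refine Dangle.eq_of_arcs fun i hi => ?_
    have h1 := Dangle.assemble_south_arc d d' g hi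
    have h2 := stack_south_one X _ h1.1
    rw [hx] at h2
    have h3 := flip_eq_of_partner h2.1
    rw [Dangle.assemble_flip] at h3
    have h4 := Dangle.assemble_south_arc e e' x (Dangle.north_notMem_free h3)
    exact ⟨Sum.inr_injective (h4.1.symm.trans h2.1),
      neg_injective (h4.2.symm.trans (h2.2.trans h1.2))⟩
  exact ⟨e, x, hx⟩

/-- Stacking `X` above the diagram assembled from `d`, `d'` and `g` either loses a through strand,
or only replaces `d` and multiplies `g` from the left, in a way that depends on `X` and `d` only. -/
theorem stack_assemble_cases (X : Diagram m n) (d : Dangle m n l) :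
    (∃ (e : Dangle m n l) (h : Wreath m (n - 2 * l)), ∀ d' g,
        X.stack (d.assemble d' g) = e.assemble d' (h * g)) ∨
      ∀ d' g, (X.stack (d.assemble d' g)).through.card < n - 2 * l := by
  have key : ∀ d' g, X.stack (d.assemble d' g) =
      (X.stack (d.assemble d 1)).stack (d.assemble d' g) := fun d' g => by
    rw [stack_assoc, Dangle.stack_assemble, one_mul]
  rcases (card_through_stack_assemble_le X d d 1).lt_or_eq with h | h
  · right
    intro d' g
    rw [key]
    exact (card_through_stack_left _ _).trans_lt h
  · left
    obtain ⟨e, x, hx⟩ := exists_stack_eq X d d 1 h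
    exact ⟨e, x, fun d' g => by rw [key, hx, Dangle.stack_assemble]⟩

/-! ### The loops depend only on the arcs -/

theorem isLoopStart_of_agree (X : Diagram m n) {Y Y' : Diagram m n}
    (h : ∀ i j, Y.partner (.inl i) = .inl j →
      Y'.partner (.inl i) = .inl j ∧ Y'.label (.inl i) = Y.label (.inl i)) {i : Fin n}
    (hi : IsLoopStart X Y i) :
    IsLoopStart X Y' i ∧ loopLabel X Y' i = loopLabel X Y i := by
  have hstep : ∀ s : StackNode n, glueNode s ≠ s →
      glueNode (step (stackPartner X Y) glueNode s) ≠ step (stackPartner X Y) glueNode s →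
      step (stackPartner X Y') glueNode s = step (stackPartner X Y) glueNode s ∧
        stackLabel X Y' s = stackLabel X Y s := by
    rintro ((i | i) | (i | i)) hs hs'
    · exact absurd rfl hs
    · exact ⟨rfl, rfl⟩
    · rcases hj : Y.partner (.inl i) with j | j
      · simp [step, stackPartner, stackLabel, hj, (h i j hj).1, (h i j hj).2]
      · simp [step, stackPartner, hj, glueNode] at hs'
    · exact absurd rfl hs
  have hs1 : ∀ t, step (stackPartner X Y') glueNode (fromCentral X Y i t) =
      fromCentral X Y i (t + 1) ∧
      stackLabel X Y' (fromCentral X Y i t) = stackLabel X Y (fromCentral X Y i t) := fun t => by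
    have h1 := hi.1 t
    have h2 := hi.1 (t + 1)
    rw [fromCentral, Function.iterate_succ_apply'] at h2
    rw [fromCentral, fromCentral, Function.iterate_succ_apply']
    exact hstep _ h1 h2
  have hit : ∀ t, fromCentral X Y' i t = fromCentral X Y i t := fun t => by
    induction t with
    | zero => rfl
    | succ t ih =>
      rw [← (hs1 t).1, fromCentral, Function.iterate_succ_apply']
      change step _ _ (fromCentral X Y' i t) = _
      rw [ih]
  constructor
  · simp only [IsLoopStart, hit]
    exact hi
  · have hper : Function.minimalPeriod (step (stackPartner X Y') glueNode) (.inr (.inl i)) =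
        Function.minimalPeriod (step (stackPartner X Y) glueNode) (.inr (.inl i)) := by
      rw [Function.minimalPeriod_eq_minimalPeriod_iff]
      intro t
      change fromCentral X Y' i t = _ ↔ fromCentral X Y i t = _
      rw [hit]
    rw [loopLabel, loopLabel, hper, pathLabel, pathLabel]
    refine Finset.sum_congr rfl fun t _ => ?_
    change stackLabel X Y' (fromCentral X Y' i t) = stackLabel X Y (fromCentral X Y i t)
    rw [hit, (hs1 t).2]

/-- The loops of two stacked diagrams depend on the lower diagram only through its northern arcs. -/
theorem loopFactor_congr_right {k : Type*} [Field k] (δ : ZMod m → k) (X : Diagram m n)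
    {Y Y' : Diagram m n}
    (h : ∀ i j, Y.partner (.inl i) = .inl j →
      Y'.partner (.inl i) = .inl j ∧ Y'.label (.inl i) = Y.label (.inl i))
    (h' : ∀ i j, Y'.partner (.inl i) = .inl j →
      Y.partner (.inl i) = .inl j ∧ Y.label (.inl i) = Y'.label (.inl i)) :
    loopFactor δ X Y = loopFactor δ X Y' := by
  classical
  rw [loopFactor, loopFactor]
  refine Finset.prod_congr ?_ fun i hi => ?_
  · ext i
    simp only [Finset.mem_filter, Finset.mem_univ, true_and]
    exact ⟨fun hi => (isLoopStart_of_agree X h hi).1, fun hi => (isLoopStart_of_agree X h' hi).1⟩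
  · rw [(isLoopStart_of_agree X h' (Finset.mem_filter.1 hi).2).2]

theorem loopFactor_assemble_right {k : Type*} [Field k] (δ : ZMod m → k) (X : Diagram m n)
    (d d' e' : Dangle m n l) (g h : Wreath m (n - 2 * l)) :
    loopFactor δ X (d.assemble d' g) = loopFactor δ X (d.assemble e' h) := by
  have key : ∀ (d' e' : Dangle m n l) (g h : Wreath m (n - 2 * l)) (i j : Fin n),
      (d.assemble e' h).partner (.inl i) = .inl j →
      (d.assemble d' g).partner (.inl i) = .inl j ∧
        (d.assemble d' g).label (.inl i) = (d.assemble e' h).label (.inl i) :=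
    fun d' e' g h i j hj => by
      have hi := Dangle.north_notMem_free hj
      have h1 := Dangle.assemble_north_arc d d' g hi
      have h2 := Dangle.assemble_north_arc d e' h hi
      exact ⟨h1.1.trans (h2.1.symm.trans hj), h1.2.trans h2.2.symm⟩
  exact loopFactor_congr_right δ X (key _ _ _ _) (key _ _ _ _)

theorem loopFactor_assemble_left {k : Type*} [Field k] (δ : ZMod m → k) (Y : Diagram m n)
    (d d' e : Dangle m n l) (g h : Wreath m (n - 2 * l)) :
    loopFactor δ (d.assemble d' g) Y = loopFactor δ (e.assemble d' h) Y := by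
  rw [← loopFactor_flip, ← loopFactor_flip δ (e.assemble d' h), Dangle.assemble_flip,
    Dangle.assemble_flip, loopFactor_assemble_right]

end Dangles

end CyclotomicBrauer

namespace CyclotomicBrauer

/-! ### The iterated inflation -/

section Inflation

variable {m n : ℕ} {k : Type*} [Field k] (δ : ZMod m → k)

theorem flipMap_ofDiagram (X : Diagram m n) :
    flipMap δ (ofDiagram δ X) = ofDiagram δ X.flip :=
  Finsupp.mapDomain_single

theorem wreathFlipMap_single {N : ℕ} (g : Wreath m N) :
    wreathFlipMap k m N (MonoidAlgebra.single g 1) = MonoidAlgebra.single g.flip 1 := by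
  simp [wreathFlipMap]

/-- Membership of the values of a linear map in a subspace is tested on a basis; linearity is asked
for in unbundled form. -/
theorem mem_of_basis {ι M A : Type*} [AddCommGroup M] [Module k M] [AddCommGroup A] [Module k A]
    (b : Module.Basis ι k M) (J : Submodule k A) (F : M → A)
    (hadd : ∀ x y, F (x + y) = F x + F y) (hsmul : ∀ (c : k) x, F (c • x) = c • F x)
    (h : ∀ i, F (b i) ∈ J) (x : M) : F x ∈ J := by
  let f : M →ₗ[k] A := ⟨⟨F, hadd⟩, hsmul⟩
  have : Submodule.span k (Set.range b) ≤ J.comap f := by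
    rw [Submodule.span_le]
    rintro _ ⟨i, rfl⟩
    exact h i
  rw [b.span_eq] at this
  exact this (Submodule.mem_top (x := x))

theorem flipMap_antiInvolution : IsAntiInvolution (flipMap (n := n) δ) where
  involutive a := by
    have : flipMap (n := n) δ ∘ₗ flipMap δ = LinearMap.id := linearMap_ext_diagram δ fun X => by
      rw [LinearMap.comp_apply, flipMap_ofDiagram, flipMap_ofDiagram, Diagram.flip_flip]
      rfl
    exact LinearMap.congr_fun this a
  map_mul a b := by
    rw [← sub_eq_zero, ← Submodule.mem_bot k]
    refine mem_of_basis (diagramBasis δ) ⊥ (fun a => flipMap δ (a * b) - flipMap δ b * flipMap δ a)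
      (fun x y => by simp only [map_add, add_mul, mul_add, add_sub_add_comm])
      (fun c x => by simp only [map_smul, smul_mul_assoc, mul_smul_comm, smul_sub]) (fun X => ?_) a
    refine mem_of_basis (diagramBasis δ) ⊥ (fun b => flipMap δ (_ * b) - flipMap δ b * flipMap δ _)
      (fun x y => by simp only [map_add, add_mul, mul_add, add_sub_add_comm])
      (fun c x => by simp only [map_smul, smul_mul_assoc, mul_smul_comm, smul_sub]) (fun Y => ?_) b
    rw [diagramBasis_apply, diagramBasis_apply, ofDiagram_mul, map_smul, flipMap_ofDiagram,
      flipMap_ofDiagram, flipMap_ofDiagram, ofDiagram_mul, stack_flip, loopFactor_flip, sub_self]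
    exact zero_mem _

theorem wreathFlipMap_antiInvolution (N : ℕ) : IsAntiInvolution (wreathFlipMap k m N) where
  involutive a := by
    have : wreathFlipMap k m N ∘ₗ wreathFlipMap k m N = LinearMap.id :=
      (MonoidAlgebra.basis (Wreath m N) k).ext fun g => by
        rw [MonoidAlgebra.basis_apply, LinearMap.comp_apply, wreathFlipMap_single,
          wreathFlipMap_single, Wreath.flip_flip]
        rfl
    exact LinearMap.congr_fun this a
  map_mul a b := by
    rw [← sub_eq_zero, ← Submodule.mem_bot k]
    refine mem_of_basis (MonoidAlgebra.basis (Wreath m N) k) ⊥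
      (fun a => wreathFlipMap k m N (a * b) - wreathFlipMap k m N b * wreathFlipMap k m N a)
      (fun x y => by simp only [map_add, add_mul, mul_add, add_sub_add_comm])
      (fun c x => by simp only [map_smul, smul_mul_assoc, mul_smul_comm, smul_sub]) (fun g => ?_) a
    refine mem_of_basis (MonoidAlgebra.basis (Wreath m N) k) ⊥
      (fun b => wreathFlipMap k m N (_ * b) - wreathFlipMap k m N b * wreathFlipMap k m N _)
      (fun x y => by simp only [map_add, add_mul, mul_add, add_sub_add_comm])
      (fun c x => by simp only [map_smul, smul_mul_assoc, mul_smul_comm, smul_sub]) (fun h => ?_) b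
    rw [MonoidAlgebra.basis_apply, MonoidAlgebra.basis_apply, MonoidAlgebra.single_mul_single,
      one_mul, wreathFlipMap_single, wreathFlipMap_single, wreathFlipMap_single,
      MonoidAlgebra.single_mul_single, one_mul, Wreath.flip_mul, sub_self]
    exact zero_mem _

/-- Bases of the summands form a basis of a direct sum. -/
noncomputable def directSumBasis {ι : Type*} [DecidableEq ι] {W : ι → Type*}
    [∀ i, AddCommMonoid (W i)] [∀ i, Module k (W i)] {η : ι → Type*}
    (B : ∀ i, Module.Basis (η i) k (W i)) : Module.Basis (Σ i, η i) k (⨁ i, W i) :=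
  DFinsupp.basis B

theorem directSumBasis_apply {ι : Type*} [DecidableEq ι] {W : ι → Type*}
    [∀ i, AddCommMonoid (W i)] [∀ i, Module k (W i)] {η : ι → Type*}
    (B : ∀ i, Module.Basis (η i) k (W i)) (i : ι) (x : η i) :
    directSumBasis B ⟨i, x⟩ = DirectSum.lof k ι W i (B i x) := by
  apply (directSumBasis B).repr.injective
  rw [Module.Basis.repr_self]
  change _ = (sigmaFinsuppLequivDFinsupp k).symm
    (DFinsupp.mapRange.linearEquiv (fun i => (B i).repr) (DFinsupp.single i (B i x)))
  rw [LinearEquiv.eq_symm_apply, DFinsupp.mapRange.linearEquiv_apply, DFinsupp.mapRange_single]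
  change _ = DFinsupp.single (β := fun i => η i →₀ k) i ((B i).repr (B i x))
  rw [Module.Basis.repr_self]
  exact sigmaFinsuppEquivDFinsupp_single _ _

section OfLayer

variable {A : Type*} [NonUnitalNonAssocRing A] [Module k A] {L : ℕ}
  {V H : Fin L → Type*} [∀ l, AddCommGroup (V l)] [∀ l, Module k (V l)]
  [∀ l, Ring (H l)] [∀ l, Algebra k (H l)] (Ψ : A ≃ₗ[k] ⨁ l, V l ⊗[k] (V l ⊗[k] H l))

/-- A layer as a subspace of the algebra. -/
noncomputable def ofLayerMap (l : Fin L) : V l ⊗[k] (V l ⊗[k] H l) →ₗ[k] A :=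
  Ψ.symm.toLinearMap ∘ₗ DirectSum.lof k (Fin L) (fun l => V l ⊗[k] (V l ⊗[k] H l)) l

theorem ofLayerMap_eq {l : Fin L} {z : V l ⊗[k] (V l ⊗[k] H l)} {a : A}
    (h : Ψ a = DirectSum.lof k (Fin L) (fun l => V l ⊗[k] (V l ⊗[k] H l)) l z) :
    ofLayerMap Ψ l z = a := by
  rw [ofLayerMap, LinearMap.comp_apply, ← h]
  exact Ψ.symm_apply_apply a

theorem sum_ofLayerMap (a : A) : ∑ l, ofLayerMap Ψ l (Ψ a l) = a := by
  apply Ψ.injective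
  rw [map_sum]
  conv_rhs => rw [← DirectSum.sum_univ_of (Ψ a)]
  refine Finset.sum_congr rfl fun l _ => ?_
  exact Ψ.apply_symm_apply _

theorem ofLayerMap_mem_layerIdeal (l : Fin L) (z : V l ⊗[k] (V l ⊗[k] H l)) {r : ℕ}
    (h : r ≤ l) : ofLayerMap Ψ l z ∈ layerIdeal Ψ r := fun l' hl' => by
  have h1 : Ψ (ofLayerMap Ψ l z) =
      DirectSum.lof k (Fin L) (fun l => V l ⊗[k] (V l ⊗[k] H l)) l z := Ψ.apply_symm_apply _
  rw [h1]
  exact DirectSum.of_eq_of_ne _ _ _ (by rintro rfl; omega)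

theorem mem_of_mem_layerIdeal {r : ℕ} {a : A} (ha : a ∈ layerIdeal Ψ r) (J : Submodule k A)
    (h : ∀ l : Fin L, r ≤ l → ∀ z, ofLayerMap Ψ l z ∈ J) : a ∈ J := by
  rw [← sum_ofLayerMap Ψ a]
  refine sum_mem fun l _ => ?_
  by_cases hl : (l : ℕ) < r
  · rw [ha l hl, map_zero]
    exact zero_mem _
  · exact h l (not_lt.1 hl) _

/-- The decomposition `A = ⨁_l V_l ⊗ V_l ⊗ H_l` that matches a basis of `A` with the bases of the
summands made from bases of the `V_l` and the `H_l`. -/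
noncomputable def decompOfBasis {κ η : Fin L → Type*} {ι : Type*}
    (bV : ∀ l, Module.Basis (κ l) k (V l)) (bH : ∀ l, Module.Basis (η l) k (H l))
    (bA : Module.Basis ι k A) (e : (Σ l, κ l × (κ l × η l)) ≃ ι) :
    A ≃ₗ[k] ⨁ l, V l ⊗[k] (V l ⊗[k] H l) :=
  bA.equiv (directSumBasis fun l => (bV l).tensorProduct ((bV l).tensorProduct (bH l))) e.symm

theorem ofLayerMap_decompOfBasis {κ η : Fin L → Type*} {ι : Type*}
    (bV : ∀ l, Module.Basis (κ l) k (V l)) (bH : ∀ l, Module.Basis (η l) k (H l))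
    (bA : Module.Basis ι k A) (e : (Σ l, κ l × (κ l × η l)) ≃ ι) (l : Fin L) (d d' : κ l)
    (g : η l) : ofLayerMap (decompOfBasis bV bH bA e) l (bV l d ⊗ₜ (bV l d' ⊗ₜ bH l g)) =
      bA (e ⟨l, d, d', g⟩) := by
  apply ofLayerMap_eq
  rw [decompOfBasis, Module.Basis.equiv_apply, Equiv.symm_apply_apply, directSumBasis_apply,
    Module.Basis.tensorProduct_apply, Module.Basis.tensorProduct_apply]

theorem mem_of_forall_tmul_basis {κ η : Fin L → Type*} (bV : ∀ l, Module.Basis (κ l) k (V l))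
    (bH : ∀ l, Module.Basis (η l) k (H l)) (J : Submodule k A) (l : Fin L)
    (h : ∀ d d' g, ofLayerMap Ψ l (bV l d ⊗ₜ (bV l d' ⊗ₜ bH l g)) ∈ J)
    (z : V l ⊗[k] (V l ⊗[k] H l)) : ofLayerMap Ψ l z ∈ J := by
  refine mem_of_basis ((bV l).tensorProduct ((bV l).tensorProduct (bH l))) J
    (fun z => ofLayerMap Ψ l z) (map_add _) (map_smul _) ?_ z
  rintro ⟨d, d', g⟩
  simp only [Module.Basis.tensorProduct_apply]
  exact h d d' g

end OfLayer

/-- The inflation decomposition of the algebra. -/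
noncomputable def inflationEquiv :
    BrauerAlg k m n δ ≃ₗ[k] ⨁ l : Fin (n / 2 + 1), DangleSpace k m n l ⊗[k]
      (DangleSpace k m n l ⊗[k] WreathAlg k m (n - 2 * l)) :=
  decompOfBasis (V := fun l : Fin (n / 2 + 1) => DangleSpace k m n l)
    (H := fun l : Fin (n / 2 + 1) => WreathAlg k m (n - 2 * l))
    (κ := fun l : Fin (n / 2 + 1) => Dangle m n l)
    (η := fun l : Fin (n / 2 + 1) => Wreath m (n - 2 * l))
    (fun _ => Finsupp.basisSingleOne) (fun _ => MonoidAlgebra.basis _ k) (diagramBasis δ)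
    (cutEquiv m n)

/-- A layer of the inflation decomposition as a subspace of the algebra. -/
noncomputable def layerMap (l : Fin (n / 2 + 1)) :=
  ofLayerMap (V := fun l : Fin (n / 2 + 1) => DangleSpace k m n l)
    (H := fun l : Fin (n / 2 + 1) => WreathAlg k m (n - 2 * l)) (inflationEquiv δ) l

theorem layerMap_basis (l : Fin (n / 2 + 1)) (d d' : Dangle m n l) (g : Wreath m (n - 2 * l)) :
    layerMap δ l (Finsupp.basisSingleOne d ⊗ₜ (Finsupp.basisSingleOne d' ⊗ₜ
      MonoidAlgebra.basis _ k g)) = ofDiagram δ (d.assemble d' g) :=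
  (ofLayerMap_decompOfBasis (V := fun l : Fin (n / 2 + 1) => DangleSpace k m n l)
    (H := fun l : Fin (n / 2 + 1) => WreathAlg k m (n - 2 * l))
    (κ := fun l : Fin (n / 2 + 1) => Dangle m n l)
    (η := fun l : Fin (n / 2 + 1) => Wreath m (n - 2 * l))
    (fun _ => Finsupp.basisSingleOne) (fun _ => MonoidAlgebra.basis _ k) (diagramBasis δ)
    (cutEquiv m n) l d d' g).trans (diagramBasis_apply δ _)

theorem layerMap_single (l : Fin (n / 2 + 1)) (d d' : Dangle m n l) (g : Wreath m (n - 2 * l)) :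
    layerMap δ l (Finsupp.single d 1 ⊗ₜ (Finsupp.single d' 1 ⊗ₜ MonoidAlgebra.single g 1)) =
      ofDiagram δ (d.assemble d' g) := by
  have h := layerMap_basis δ l d d' g
  rw [Finsupp.coe_basisSingleOne, MonoidAlgebra.basis_apply] at h
  exact h

/-- The span of the diagrams with at least `r` northern arcs. -/
noncomputable def arcIdeal (r : ℕ) : Submodule k (BrauerAlg k m n δ) :=
  Submodule.span k (ofDiagram δ '' {X | X.through.card + 2 * r ≤ n})

theorem ofDiagram_mem_arcIdeal {X : Diagram m n} {r : ℕ} (h : X.through.card + 2 * r ≤ n) :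
    ofDiagram δ X ∈ arcIdeal δ r :=
  Submodule.subset_span (Set.mem_image_of_mem _ h)

/-- The layers from `r` on are spanned by the diagrams with at least `r` northern arcs. -/
theorem layerIdeal_eq (r : ℕ) : layerIdeal (inflationEquiv (n := n) δ) r = arcIdeal δ r := by
  apply le_antisymm
  · intro a ha
    refine mem_of_mem_layerIdeal _ ha _ fun l hl z => ?_
    refine mem_of_forall_tmul_basis (V := fun l : Fin (n / 2 + 1) => DangleSpace k m n l)
      (H := fun l : Fin (n / 2 + 1) => WreathAlg k m (n - 2 * l))
      (κ := fun l : Fin (n / 2 + 1) => Dangle m n l)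
      (η := fun l : Fin (n / 2 + 1) => Wreath m (n - 2 * l)) (inflationEquiv δ)
      (fun _ => Finsupp.basisSingleOne) (fun _ => MonoidAlgebra.basis _ k) _ l
      (fun d d' g => ?_) z
    refine Set.mem_of_eq_of_mem (layerMap_basis δ l d d' g) ?_
    have := d.two_mul_le
    exact ofDiagram_mem_arcIdeal δ (by rw [Dangle.card_through_assemble]; omega)
  · rw [arcIdeal, Submodule.span_le]
    rintro _ ⟨X, hX, rfl⟩
    obtain ⟨⟨l, d, d', g⟩, rfl⟩ := (cutEquiv m n).surjective X
    have hd := d.two_mul_le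
    have h : cutEquiv m n ⟨l, d, d', g⟩ = d.assemble d' g := rfl
    rw [h] at hX ⊢
    rw [Set.mem_ofPred_eq, Dangle.card_through_assemble] at hX
    rw [← layerMap_single]
    exact ofLayerMap_mem_layerIdeal _ _ _ (by omega)

theorem arcIdeal_mul_left (r : ℕ) (a : BrauerAlg k m n δ) {x : BrauerAlg k m n δ}
    (hx : x ∈ arcIdeal δ r) : a * x ∈ arcIdeal δ r := by
  refine mem_of_basis (diagramBasis δ) _ (fun a => a * x) (fun _ _ => add_mul _ _ _)
    (fun _ _ => smul_mul_assoc _ _ _) (fun X => ?_) a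
  have : arcIdeal δ r ≤ (arcIdeal δ r).comap (mulMap δ (ofDiagram δ X)) := by
    conv_lhs => rw [arcIdeal]
    rw [Submodule.span_le]
    rintro _ ⟨Y, hY, rfl⟩
    change ofDiagram δ X * ofDiagram δ Y ∈ arcIdeal δ r
    rw [ofDiagram_mul]
    have h1 : Y.through.card + 2 * r ≤ n := hY
    have h2 := card_through_stack_right X Y
    exact Submodule.smul_mem _ _ (ofDiagram_mem_arcIdeal δ (by omega))
  rw [diagramBasis_apply]
  exact this hx

theorem arcIdeal_mul_right (r : ℕ) (a : BrauerAlg k m n δ) {x : BrauerAlg k m n δ}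
    (hx : x ∈ arcIdeal δ r) : x * a ∈ arcIdeal δ r := by
  refine mem_of_basis (diagramBasis δ) _ (fun a => x * a) (fun _ _ => mul_add _ _ _)
    (fun _ _ => mul_smul_comm _ _ _) (fun X => ?_) a
  have : arcIdeal δ r ≤ (arcIdeal δ r).comap ((mulMap δ).flip (ofDiagram δ X)) := by
    conv_lhs => rw [arcIdeal]
    rw [Submodule.span_le]
    rintro _ ⟨Y, hY, rfl⟩
    change ofDiagram δ Y * ofDiagram δ X ∈ arcIdeal δ r
    rw [ofDiagram_mul]
    have h1 : Y.through.card + 2 * r ≤ n := hY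
    have h2 := card_through_stack_left Y X
    exact Submodule.smul_mem _ _ (ofDiagram_mem_arcIdeal δ (by omega))
  rw [diagramBasis_apply]
  exact this hx

open Classical in
/-- The value of the bilinear form `φ_l` at two dangles: stack `d'`, reflected, above `e`. If all
free nodes are joined to each other, this gives a group element, multiplied by the parameters of the
loops; otherwise the value is `0`. -/
noncomputable def dangleForm {l : ℕ} (d' e : Dangle m n l) : WreathAlg k m (n - 2 * l) :=
  if h : ∃ g, (d'.assemble d' 1).stack (e.assemble e 1) = d'.assemble e g then
    loopFactor δ (d'.assemble d' 1) (e.assemble e 1) • MonoidAlgebra.single h.choose 1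
  else 0

theorem dangleForm_of_eq {l : ℕ} {d' e : Dangle m n l} {g : Wreath m (n - 2 * l)}
    (h : (d'.assemble d' 1).stack (e.assemble e 1) = d'.assemble e g) :
    dangleForm δ d' e =
      loopFactor δ (d'.assemble d' 1) (e.assemble e 1) • MonoidAlgebra.single g 1 := by
  have hex : ∃ g, (d'.assemble d' 1).stack (e.assemble e 1) = d'.assemble e g := ⟨g, h⟩
  rw [dangleForm, dif_pos hex,
    (Dangle.assemble_injective (hex.choose_spec.symm.trans h)).2.2]

theorem dangleForm_flip {l : ℕ} (d' e : Dangle m n l) :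
    wreathFlipMap k m _ (dangleForm δ d' e) = dangleForm δ e d' := by
  have key : ∀ {d' e : Dangle m n l} {g : Wreath m (n - 2 * l)},
      (d'.assemble d' 1).stack (e.assemble e 1) = d'.assemble e g →
        (e.assemble e 1).stack (d'.assemble d' 1) = e.assemble d' g.flip := fun {d' e g} h => by
    have := congrArg Diagram.flip h
    rwa [stack_flip, Dangle.assemble_flip, Dangle.assemble_flip, Dangle.assemble_flip,
      Wreath.flip_one] at this
  by_cases h : ∃ g, (d'.assemble d' 1).stack (e.assemble e 1) = d'.assemble e g
  · obtain ⟨g, hg⟩ := h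
    rw [dangleForm_of_eq δ hg, dangleForm_of_eq δ (key hg), map_smul, wreathFlipMap_single,
      ← loopFactor_flip, Dangle.assemble_flip, Dangle.assemble_flip, Wreath.flip_one]
  · have h' : ¬ ∃ g, (e.assemble e 1).stack (d'.assemble d' 1) = e.assemble d' g := by
      rintro ⟨g, hg⟩
      exact h ⟨_, key hg⟩
    rw [dangleForm, dif_neg h, dangleForm, dif_neg h', map_zero]

/-- The bilinear form `φ_l`. -/
noncomputable def layerForm (l : ℕ) :
    DangleSpace k m n l →ₗ[k] DangleSpace k m n l →ₗ[k] WreathAlg k m (n - 2 * l) :=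
  Finsupp.linearCombination k fun d' => Finsupp.linearCombination k fun e => dangleForm δ d' e

theorem layerForm_single {l : ℕ} (d' e : Dangle m n l) :
    layerForm δ l (Finsupp.single d' 1) (Finsupp.single e 1) = dangleForm δ d' e := by
  simp [layerForm]

theorem layerForm_flip (l : ℕ) (v w : DangleSpace k m n l) :
    wreathFlipMap k m _ (layerForm δ l v w) = layerForm δ l w v := by
  rw [← sub_eq_zero, ← Submodule.mem_bot k]
  refine mem_of_basis Finsupp.basisSingleOne ⊥
    (fun v => wreathFlipMap k m _ (layerForm δ l v w) - layerForm δ l w v)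
    (fun x y => by simp only [map_add, LinearMap.add_apply, add_sub_add_comm])
    (fun c x => by simp only [map_smul, LinearMap.smul_apply, smul_sub]) (fun d => ?_) v
  refine mem_of_basis Finsupp.basisSingleOne ⊥
    (fun w => wreathFlipMap k m _ (layerForm δ l _ w) - layerForm δ l w _)
    (fun x y => by simp only [map_add, LinearMap.add_apply, add_sub_add_comm])
    (fun c x => by simp only [map_smul, LinearMap.smul_apply, smul_sub]) (fun e => ?_) w
  simp only [Finsupp.coe_basisSingleOne, layerForm_single, dangleForm_flip, sub_self]
  exact zero_mem _

/-- The multiplication rule of a layer, for diagrams. -/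
theorem assemble_mul_assemble (l : Fin (n / 2 + 1)) (d d' e e' : Dangle m n l)
    (g h : Wreath m (n - 2 * l)) :
    ofDiagram δ (d.assemble d' g) * ofDiagram δ (e.assemble e' h) -
      layerMap δ l (Finsupp.single d 1 ⊗ₜ (Finsupp.single e' 1 ⊗ₜ
        (MonoidAlgebra.single g 1 * dangleForm δ d' e * MonoidAlgebra.single h 1))) ∈
      arcIdeal δ (l + 1) := by
  have hd := d.two_mul_le
  have hstack : (d.assemble d' g).stack (e.assemble e' h) =
      ((d.assemble d' g).stack ((d'.assemble d' 1).stack (e.assemble e 1))).stack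
        (e.assemble e' h) := by
    rw [← stack_assoc, stack_assoc _ (e.assemble e 1), Dangle.stack_assemble,
      Dangle.stack_assemble, one_mul, mul_one]
  rw [ofDiagram_mul, loopFactor_assemble_left δ _ d d' d' g 1,
    loopFactor_assemble_right δ _ e e' e h 1]
  by_cases hx : ∃ x, (d'.assemble d' 1).stack (e.assemble e 1) = d'.assemble e x
  · obtain ⟨x, hx⟩ := hx
    rw [hstack, hx, Dangle.stack_assemble, Dangle.stack_assemble, dangleForm_of_eq δ hx,
      mul_smul_comm, smul_mul_assoc, MonoidAlgebra.single_mul_single,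
      MonoidAlgebra.single_mul_single, one_mul, one_mul, TensorProduct.tmul_smul,
      TensorProduct.tmul_smul, map_smul, layerMap_single, sub_self]
    exact zero_mem _
  · rw [dangleForm, dif_neg hx, mul_zero, zero_mul, TensorProduct.tmul_zero,
      TensorProduct.tmul_zero, map_zero, sub_zero]
    refine Submodule.smul_mem _ _ (ofDiagram_mem_arcIdeal δ ?_)
    -- otherwise a through strand is lost in the middle
    have h1 : ((d'.assemble d' 1).stack (e.assemble e 1)).through.card ≠ n - 2 * l := by
      intro hc
      obtain ⟨f, x, hf⟩ := exists_stack_eq _ _ _ _ hc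
      apply hx
      have hc' : ((e.assemble e 1).stack (d'.assemble d' 1)).through.card = n - 2 * l := by
        refine Eq.trans ?_ hc
        rw [← Diagram.card_through_flip, stack_flip, Dangle.assemble_flip, Dangle.assemble_flip,
          Wreath.flip_one]
      obtain ⟨f', x', hf'⟩ := exists_stack_eq _ _ _ _ hc'
      have := congrArg Diagram.flip hf'
      rw [stack_flip, Dangle.assemble_flip, Dangle.assemble_flip, Dangle.assemble_flip,
        Wreath.flip_one, hf] at this
      obtain ⟨rfl, -, -⟩ := Dangle.assemble_injective this
      exact ⟨x, hf⟩
    have h2 := card_through_stack_assemble_le (d'.assemble d' 1) e e 1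
    have h3 := card_through_stack_left ((d.assemble d' g).stack ((d'.assemble d' 1).stack
      (e.assemble e 1))) (e.assemble e' h)
    have h4 := card_through_stack_right (d.assemble d' g) ((d'.assemble d' 1).stack
      (e.assemble e 1))
    obtain ⟨r, -, hr⟩ := ((d.assemble d' g).stack (e.assemble e' h)).exists_layer
    rw [hstack] at hr ⊢
    omega

theorem layerMap_mul_layerMap (l : Fin (n / 2 + 1)) (v w v' w' : DangleSpace k m n l)
    (b b' : WreathAlg k m (n - 2 * l)) :
    layerMap δ l (v ⊗ₜ (w ⊗ₜ b)) * layerMap δ l (v' ⊗ₜ (w' ⊗ₜ b')) -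
      layerMap δ l (v ⊗ₜ (w' ⊗ₜ (b * layerForm δ l w v' * b'))) ∈ arcIdeal δ (l + 1) := by
  let F (v w v' w' : DangleSpace k m n l) (b b' : WreathAlg k m (n - 2 * l)) :
      BrauerAlg k m n δ :=
    layerMap δ l (v ⊗ₜ (w ⊗ₜ b)) * layerMap δ l (v' ⊗ₜ (w' ⊗ₜ b')) -
      layerMap δ l (v ⊗ₜ (w' ⊗ₜ (b * layerForm δ l w v' * b')))
  change F v w v' w' b b' ∈ _
  refine mem_of_basis Finsupp.basisSingleOne _ (fun v => F v w v' w' b b')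
    (fun x y => by simp only [F, map_add, TensorProduct.add_tmul, add_mul, add_sub_add_comm])
    (fun c x => by simp only [F, map_smul, ← TensorProduct.smul_tmul', smul_mul_assoc, smul_sub])
    (fun d => ?_) v
  refine mem_of_basis Finsupp.basisSingleOne _ (fun w => F _ w v' w' b b')
    (fun x y => by simp only [F, map_add, TensorProduct.add_tmul, TensorProduct.tmul_add,
      LinearMap.add_apply, mul_add, add_mul, add_sub_add_comm])
    (fun c x => by simp only [F, map_smul, ← TensorProduct.smul_tmul', TensorProduct.tmul_smul,
      LinearMap.smul_apply, mul_smul_comm, smul_mul_assoc, smul_sub]) (fun d' => ?_) w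
  refine mem_of_basis Finsupp.basisSingleOne _ (fun v' => F _ _ v' w' b b')
    (fun x y => by simp only [F, map_add, TensorProduct.add_tmul, TensorProduct.tmul_add,
      mul_add, add_mul, add_sub_add_comm])
    (fun c x => by simp only [F, map_smul, ← TensorProduct.smul_tmul', TensorProduct.tmul_smul,
      mul_smul_comm, smul_mul_assoc, smul_sub]) (fun e => ?_) v'
  refine mem_of_basis Finsupp.basisSingleOne _ (fun w' => F _ _ _ w' b b')
    (fun x y => by simp only [F, map_add, TensorProduct.add_tmul, TensorProduct.tmul_add,
      mul_add, add_sub_add_comm])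
    (fun c x => by simp only [F, map_smul, ← TensorProduct.smul_tmul', TensorProduct.tmul_smul,
      mul_smul_comm, smul_sub]) (fun e' => ?_) w'
  refine mem_of_basis (MonoidAlgebra.basis _ k) _ (fun b => F _ _ _ _ b b')
    (fun x y => by simp only [F, map_add, TensorProduct.tmul_add, add_mul, add_sub_add_comm])
    (fun c x => by simp only [F, map_smul, TensorProduct.tmul_smul, smul_mul_assoc, smul_sub])
    (fun g => ?_) b
  refine mem_of_basis (MonoidAlgebra.basis _ k) _ (fun b' => F _ _ _ _ _ b')
    (fun x y => by simp only [F, map_add, TensorProduct.tmul_add, mul_add, add_sub_add_comm])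
    (fun c x => by simp only [F, map_smul, TensorProduct.tmul_smul, mul_smul_comm, smul_sub])
    (fun h => ?_) b'
  simp only [F, Finsupp.coe_basisSingleOne, MonoidAlgebra.basis_apply, layerForm_single]
  rw [layerMap_single, layerMap_single]
  exact assemble_mul_assemble δ l d d' e e' g h

theorem flipMap_layerMap (l : Fin (n / 2 + 1)) (v w : DangleSpace k m n l)
    (b : WreathAlg k m (n - 2 * l)) :
    flipMap δ (layerMap δ l (v ⊗ₜ (w ⊗ₜ b))) =
      layerMap δ l (w ⊗ₜ (v ⊗ₜ wreathFlipMap k m _ b)) := by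
  rw [← sub_eq_zero, ← Submodule.mem_bot k]
  let F (v w : DangleSpace k m n l) (b : WreathAlg k m (n - 2 * l)) : BrauerAlg k m n δ :=
    flipMap δ (layerMap δ l (v ⊗ₜ (w ⊗ₜ b))) -
      layerMap δ l (w ⊗ₜ (v ⊗ₜ wreathFlipMap k m _ b))
  change F v w b ∈ _
  refine mem_of_basis Finsupp.basisSingleOne _ (fun v => F v w b)
    (fun x y => by simp only [F, map_add, TensorProduct.add_tmul, TensorProduct.tmul_add,
      add_sub_add_comm])
    (fun c x => by simp only [F, map_smul, ← TensorProduct.smul_tmul', TensorProduct.tmul_smul,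
      smul_sub]) (fun d => ?_) v
  refine mem_of_basis Finsupp.basisSingleOne _ (fun w => F _ w b)
    (fun x y => by simp only [F, map_add, TensorProduct.add_tmul, TensorProduct.tmul_add,
      add_sub_add_comm])
    (fun c x => by simp only [F, map_smul, ← TensorProduct.smul_tmul', TensorProduct.tmul_smul,
      smul_sub]) (fun d' => ?_) w
  refine mem_of_basis (MonoidAlgebra.basis _ k) _ (fun b => F _ _ b)
    (fun x y => by simp only [F, map_add, TensorProduct.tmul_add, add_sub_add_comm])
    (fun c x => by simp only [F, map_smul, TensorProduct.tmul_smul, smul_sub]) (fun g => ?_) b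
  simp only [F, Finsupp.coe_basisSingleOne, MonoidAlgebra.basis_apply, wreathFlipMap_single]
  rw [layerMap_single, layerMap_single, flipMap_ofDiagram, Dangle.assemble_flip, sub_self]
  exact zero_mem _

theorem isIteratedInflation : IsIteratedInflation (flipMap δ)
    (fun l : Fin (n / 2 + 1) => wreathFlipMap k m (n - 2 * l)) (inflationEquiv (n := n) δ) where
  star_antiInvolution := flipMap_antiInvolution δ
  layer_antiInvolution _ := wreathFlipMap_antiInvolution _
  ideal_left r a x hx := by
    rw [layerIdeal_eq] at hx ⊢
    exact arcIdeal_mul_left δ r a hx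
  ideal_right r a x hx := by
    rw [layerIdeal_eq] at hx ⊢
    exact arcIdeal_mul_right δ r a hx
  star_layer l v w b := by
    exact flipMap_layerMap δ l v w b
  exists_form := ⟨fun l => layerForm δ l, fun l => layerForm_flip δ l,
    fun l v w v' w' b b' => by
      rw [layerIdeal_eq]
      exact layerMap_mul_layerMap δ l v w v' w' b b'⟩

end Inflation

end CyclotomicBrauer

namespace CyclotomicBrauer

/-! ### Murphy elements of the wreath product -/

section Murphy

/-- A tabloid: every position is put into a row, and the rows of a colour are numbered from `0`. -/
abbrev Tabloid (m N : ℕ) : Type := Fin N → Fin m × ℕ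

namespace Tabloid

variable {m N : ℕ}

/-- The lengths of the rows of a tabloid. -/
def content (t : Tabloid m N) (s : Fin m × ℕ) : ℕ := (Finset.univ.filter fun i => t i = s).card

/-- The sum of the row numbers of all positions. -/
def weight (t : Tabloid m N) : ℕ := ∑ i, (t i).2

/-- The content of `t'` is obtained from that of `t` by moving boxes to earlier rows of the same
colour. This is expressed by testing on the functions that weakly decrease along the rows. -/
def Dominates (t' t : Tabloid m N) : Prop :=
  (∀ φ : Fin m × ℕ → ℕ, (∀ c r, φ (c, r + 1) ≤ φ (c, r)) → ∑ i, φ (t i) ≤ ∑ i, φ (t' i)) ∧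
    t'.weight < t.weight

theorem Dominates.trans {t₁ t₂ t₃ : Tabloid m N} (h : Dominates t₁ t₂) (h' : Dominates t₂ t₃) :
    Dominates t₁ t₃ :=
  ⟨fun φ hφ => (h'.1 φ hφ).trans (h.1 φ hφ), h.2.trans h'.2⟩

/-- A tabloid is a ballot tabloid if, in all its prefixes, no row is longer than the preceding one
of the same colour. These are the standard tableaux. -/
def Ballot (t : Tabloid m N) : Prop :=
  ∀ (j : ℕ) (c : Fin m) (r : ℕ),
    (Finset.univ.filter fun i : Fin N => (i : ℕ) < j ∧ t i = (c, r + 1)).card ≤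
      (Finset.univ.filter fun i : Fin N => (i : ℕ) < j ∧ t i = (c, r)).card

theorem sum_comp_perm {M : Type*} [AddCommMonoid M] (t : Tabloid m N) (σ : Equiv.Perm (Fin N))
    (φ : Fin m × ℕ → M) : ∑ i, φ (t (σ i)) = ∑ i, φ (t i) :=
  Equiv.sum_comp σ fun i => φ (t i)

theorem content_eq_sum (t : Tabloid m N) (s : Fin m × ℕ) :
    t.content s = ∑ i, if t i = s then 1 else 0 := by
  simp [content]

theorem content_comp_perm (t : Tabloid m N) (σ : Equiv.Perm (Fin N)) :
    content (fun i => t (σ i)) = t.content :=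
  funext fun s => by
    rw [content_eq_sum, content_eq_sum]
    exact t.sum_comp_perm σ fun x => if x = s then 1 else 0

/-- Tabloids with the same content differ by a permutation of the positions. -/
theorem exists_perm_of_content_eq {t u : Tabloid m N} (h : t.content = u.content) :
    ∃ σ : Equiv.Perm (Fin N), ∀ i, t (σ i) = u i := by
  have h' : ∀ s, Nonempty ({i // u i = s} ≃ {i // t i = s}) := fun s => by
    have := congrFun h s
    rw [content, content] at this
    exact ⟨Fintype.equivOfCardEq (by rw [Fintype.card_subtype, Fintype.card_subtype, this])⟩
  let e := fun s => (h' s).some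
  refine ⟨(Equiv.sigmaFiberEquiv u).symm.trans ((Equiv.sigmaCongrRight e).trans
    (Equiv.sigmaFiberEquiv t)), fun i => ?_⟩
  exact (e (u i) ⟨i, rfl⟩).2

theorem sum_eq_of_content_eq {M : Type*} [AddCommMonoid M] {t u : Tabloid m N}
    (h : t.content = u.content) (φ : Fin m × ℕ → M) : ∑ i, φ (t i) = ∑ i, φ (u i) := by
  obtain ⟨σ, hσ⟩ := exists_perm_of_content_eq h
  rw [← t.sum_comp_perm σ]
  simp only [hσ]

theorem weight_eq_of_content_eq {t u : Tabloid m N} (h : t.content = u.content) :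
    t.weight = u.weight :=
  sum_eq_of_content_eq h Prod.snd

theorem Dominates.congr_left {t t' u : Tabloid m N} (h : Dominates t' u)
    (ht : t.content = t'.content) : Dominates t u := by
  refine ⟨fun φ hφ => ?_, ?_⟩
  · rw [sum_eq_of_content_eq ht]
    exact h.1 φ hφ
  · rw [weight_eq_of_content_eq ht]
    exact h.2

theorem Dominates.congr_right {t u u' : Tabloid m N} (h : Dominates t u')
    (hu : u.content = u'.content) : Dominates t u := by
  refine ⟨fun φ hφ => ?_, ?_⟩
  · rw [sum_eq_of_content_eq hu]
    exact h.1 φ hφ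
  · rw [weight_eq_of_content_eq hu]
    exact h.2

/-- The positions of a tabloid in two consecutive rows. -/
def pair (t : Tabloid m N) (c : Fin m) (r : ℕ) : Finset (Fin N) :=
  Finset.univ.filter fun i => t i = (c, r) ∨ t i = (c, r + 1)

/-- Redistribute the positions in two consecutive rows: those in `Y` go to the first one. -/
def place (t : Tabloid m N) (c : Fin m) (r : ℕ) (Y : Finset (Fin N)) : Tabloid m N := fun i =>
  if t i = (c, r) ∨ t i = (c, r + 1) then if i ∈ Y then (c, r) else (c, r + 1) else t i

theorem place_self (t : Tabloid m N) (c : Fin m) (r : ℕ) :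
    t.place c r (Finset.univ.filter fun i => t i = (c, r)) = t := by
  funext i
  simp only [place, Finset.mem_filter, Finset.mem_univ, true_and]
  split_ifs <;> simp_all

theorem place_fst (t : Tabloid m N) (c : Fin m) (r : ℕ) (Y : Finset (Fin N)) (i : Fin N) :
    (t.place c r Y i).1 = (t i).1 := by
  rw [place]
  split_ifs with h h'
  · rcases h with h | h <;> simp [h]
  · rcases h with h | h <;> simp [h]
  · rfl

theorem sum_place {M : Type*} [AddCommMonoid M] (t : Tabloid m N) (c : Fin m) (r : ℕ)
    {Y : Finset (Fin N)} (hY : Y ⊆ t.pair c r) (F : Fin N → Fin m × ℕ → M) :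
    ∑ i, F i (t.place c r Y i) + ∑ i ∈ Y, F i (c, r + 1) =
      ∑ i, F i (t.place c r ∅ i) + ∑ i ∈ Y, F i (c, r) := by
  have h : ∀ G : Fin N → M, ∑ i ∈ Y, G i = ∑ i, if i ∈ Y then G i else 0 := fun G => by simp
  rw [h, h, ← Finset.sum_add_distrib, ← Finset.sum_add_distrib]
  refine Finset.sum_congr rfl fun i _ => ?_
  by_cases hi : i ∈ Y
  · have := hY hi
    simp only [pair, Finset.mem_filter, Finset.mem_univ, true_and] at this
    simp [place, hi, this, add_comm]
  · simp [place, hi]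

theorem content_place (t : Tabloid m N) (c : Fin m) (r : ℕ) {Y : Finset (Fin N)}
    (hY : Y ⊆ t.pair c r) (hcard : Y.card = t.content (c, r)) :
    (t.place c r Y).content = t.content := by
  have hsub : (Finset.univ.filter fun i => t i = (c, r)) ⊆ t.pair c r := fun i hi => by
    simp_all [pair]
  funext s
  have h1 := t.sum_place c r hY fun _ x => if x = s then 1 else 0
  have h2 := t.sum_place c r hsub fun _ x => if x = s then 1 else 0
  rw [place_self] at h2
  rw [content_eq_sum, content_eq_sum]
  rw [content] at hcard
  rw [Finset.sum_const, Finset.sum_const, hcard] at h1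
  rw [Finset.sum_const, Finset.sum_const] at h2
  omega

/-- Moving positions to the earlier one of two consecutive rows leads to a larger content. -/
theorem dominates_place (t : Tabloid m N) (c : Fin m) (r : ℕ) {Z : Finset (Fin N)}
    (hZ : Z ⊆ t.pair c r) (hcard : t.content (c, r) < Z.card) :
    Dominates (t.place c r Z) t := by
  have hsub : (Finset.univ.filter fun i => t i = (c, r)) ⊆ t.pair c r := fun i hi => by
    simp_all [pair]
  refine ⟨fun φ hφ => ?_, ?_⟩
  · have h1 := t.sum_place c r hZ fun _ => φ
    have h2 := t.sum_place c r hsub fun _ => φ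
    rw [place_self] at h2
    simp only [Finset.sum_const, smul_eq_mul] at h1 h2
    rw [content] at hcard
    have := Nat.mul_le_mul hcard.le (hφ c r)
    obtain ⟨d, hd⟩ := Nat.exists_eq_add_of_lt hcard
    obtain ⟨e, he⟩ := Nat.exists_eq_add_of_le (hφ c r)
    rw [hd, he] at h1
    rw [he] at h2
    nlinarith
  · have h1 := t.sum_place c r hZ fun _ => Prod.snd
    have h2 := t.sum_place c r hsub fun _ => Prod.snd
    rw [place_self] at h2
    simp only [Finset.sum_const, smul_eq_mul] at h1 h2
    rw [content] at hcard
    rw [weight, weight]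
    nlinarith

end Tabloid

open Tabloid

variable {m N : ℕ} [NeZero m] {k : Type*} [Field k] (ψ : AddChar (ZMod m) k)

/-- The linear character of the base group `(ℤ/m)^N` that belongs to the colours of a tabloid. -/
def colourChar (t : Tabloid m N) (g : Wreath m N) : k :=
  ∏ i, ψ (-((g.left i).toAdd * ZMod.finEquiv m (t i).1))

/-- The Murphy element of the tabloids `t` and `u`, as a function on the wreath product: it is
supported on the group elements whose permutation moves the rows of `u` to those of `t`. -/
def murphy (t u : Tabloid m N) (g : Wreath m N) : k :=
  if ∀ i, t (g.right i) = u i then colourChar ψ t g else 0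

theorem murphy_flip (t u : Tabloid m N) (g : Wreath m N) :
    murphy ψ t u g.flip = murphy ψ u t g := by
  have h : (∀ i, t (g.flip.right i) = u i) ↔ ∀ i, u (g.right i) = t i := by
    change (∀ i, t (g.right⁻¹ i) = u i) ↔ _
    exact ⟨fun h i => by rw [← h]; simp, fun h i => by rw [← h]; simp⟩
  rw [murphy, murphy]
  by_cases hu : ∀ i, u (g.right i) = t i
  · rw [if_pos (h.2 hu), if_pos hu, colourChar, colourChar]
    conv_rhs => rw [← Equiv.prod_comp g.right]
    refine Finset.prod_congr rfl fun i _ => ?_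
    rw [hu]
    rfl
  · rw [if_neg (h.not.2 hu), if_neg hu]

theorem murphy_eq_zero {t u : Tabloid m N} (h : t.content ≠ u.content) : murphy ψ t u = 0 := by
  funext g
  refine if_neg fun h' => h ?_
  rw [← t.content_comp_perm g.right]
  exact congrArg content (funext h')

/-- Left translation of a Murphy element only changes the first tabloid, and the factor does not
depend on the second one. -/
theorem murphy_inv_mul (t u : Tabloid m N) (h g : Wreath m N) :
    murphy ψ t u (h⁻¹ * g) =
      (colourChar ψ (fun i => t (h.right⁻¹ i)) h)⁻¹ * murphy ψ (fun i => t (h.right⁻¹ i)) u g := by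
  have hc : (∀ i, t ((h⁻¹ * g).right i) = u i) ↔ ∀ i, t (h.right⁻¹ (g.right i)) = u i := Iff.rfl
  rw [murphy, murphy]
  by_cases hu : ∀ i, t (h.right⁻¹ (g.right i)) = u i
  · rw [if_pos (hc.2 hu), if_pos hu, colourChar, colourChar, colourChar, ← Finset.prod_inv_distrib,
      ← Finset.prod_mul_distrib, ← Equiv.prod_comp h.right⁻¹]
    refine Finset.prod_congr rfl fun i _ => ?_
    rw [← AddChar.map_neg_eq_inv, ← AddChar.map_add_eq_mul, Wreath.mul_left_apply]
    have h1 : h⁻¹.left (h.right⁻¹ i) = (h.left i)⁻¹ := by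
      change (h.left (h.right⁻¹⁻¹ (h.right⁻¹ i)))⁻¹ = _
      simp
    have h2 : (h⁻¹).right⁻¹ (h.right⁻¹ i) = i := by
      change h.right⁻¹⁻¹ (h.right⁻¹ i) = i
      simp
    rw [h1, h2, toAdd_mul, toAdd_inv]
    congr 1
    ring
  · rw [if_neg (hc.not.2 hu), if_neg hu, mul_zero]

/-- The span of the Murphy elements whose content dominates that of `t`. -/
def higherSpan (t : Tabloid m N) : Submodule k (Wreath m N → k) :=
  Submodule.span k {x | ∃ t' u', Dominates t' t ∧ x = murphy ψ t' u'}

theorem murphy_mem_higherSpan {t t' u' : Tabloid m N} (h : Dominates t' t) :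
    murphy ψ t' u' ∈ higherSpan ψ t :=
  Submodule.subset_span ⟨t', u', h, rfl⟩

theorem higherSpan_le {t t' : Tabloid m N} (h : t.content = t'.content) :
    higherSpan ψ t ≤ higherSpan ψ t' := by
  refine Submodule.span_mono ?_
  rintro _ ⟨t₁, u₁, h₁, rfl⟩
  exact ⟨t₁, u₁, h₁.congr_right h.symm, rfl⟩

theorem murphy_place_apply (t u : Tabloid m N) (c : Fin m) (r : ℕ) (Y : Finset (Fin N))
    (g : Wreath m N) : murphy ψ (t.place c r Y) u g =
      if ∀ i, t.place c r Y (g.right i) = u i then colourChar ψ t g else 0 := by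
  rw [murphy, colourChar, colourChar]
  simp only [place_fst]

theorem sum_ite_eq_of_unique {ι M : Type*} [AddCommMonoid M] {s : Finset ι} {P : ι → Prop}
    [DecidablePred P] (x : ι) (hx : x ∈ s) (hP : P x) (h : ∀ y ∈ s, P y → y = x) (a : M) :
    ∑ y ∈ s, (if P y then a else 0) = a := by
  rw [Finset.sum_eq_single_of_mem x hx fun y hy hne => if_neg fun h' => hne (h y hy h'), if_pos hP]

/-- The Garnir-type relation: summing over all ways to choose the first of two consecutive rows
inside `Z` is the same as putting all of `Z` into the first row and moving positions of `u` to the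
first row in all possible ways. If `Z` is longer than the first row, the contents on the right-hand
side are larger. -/
theorem sum_murphy_place (t u : Tabloid m N) (c : Fin m) (r : ℕ) {Z : Finset (Fin N)}
    (hZ : Z ⊆ t.pair c r) (hu : u.content = t.content) :
    ∑ Y ∈ Z.powerset.filter (fun Y => Y.card = t.content (c, r)), murphy ψ (t.place c r Y) u =
      ∑ W ∈ (Finset.univ.filter fun i => u i = (c, r + 1)).powerset,
        murphy ψ (t.place c r Z) fun i => if i ∈ W then (c, r) else u i := by
  funext g
  rw [Finset.sum_apply, Finset.sum_apply]
  simp only [murphy_place_apply]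
  have hmem : ∀ i, i ∈ Z → t i = (c, r) ∨ t i = (c, r + 1) := fun i hi => by
    have := hZ hi
    simpa [pair] using this
  have hne : (c, r + 1) ≠ (c, r) := by simp
  set Y₀ : Finset (Fin N) := Finset.univ.filter fun i => u (g.right⁻¹ i) = (c, r) with hY₀
  set W₀ : Finset (Fin N) := Finset.univ.filter fun i => u i = (c, r + 1) ∧ g.right i ∈ Z with hW₀
  have hY₀mem : ∀ i, g.right i ∈ Y₀ ↔ u i = (c, r) := fun i => by simp [hY₀]
  have hW₀mem : ∀ i, i ∈ W₀ ↔ u i = (c, r + 1) ∧ g.right i ∈ Z := fun i => by simp [hW₀]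
  have hcard : Y₀.card = t.content (c, r) := by
    rw [← hu, ← content_comp_perm u g.right⁻¹]
    rfl
  have hsurj : ∀ i, ∃ j, g.right j = i := g.right.surjective
  have hYZ : ∀ Y ∈ Z.powerset.filter (fun Y => Y.card = t.content (c, r)), ∀ j,
      g.right j ∈ Y → g.right j ∈ Z := fun Y hY j hj => by
    rw [Finset.mem_filter, Finset.mem_powerset] at hY
    exact hY.1 hj
  have hWs : ∀ W ∈ (Finset.univ.filter fun i => u i = (c, r + 1)).powerset, ∀ i ∈ W,
      u i = (c, r + 1) := fun W hW i hi => by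
    simpa using Finset.mem_powerset.1 hW hi
  have hYu : ∀ Y ∈ Z.powerset.filter (fun Y => Y.card = t.content (c, r)),
      (∀ i, t.place c r Y (g.right i) = u i) → Y = Y₀ := fun Y hY h => by
    ext i
    obtain ⟨j, rfl⟩ := hsurj i
    have h1 := h j
    have h2 := hYZ Y hY j
    have h3 := hmem (g.right j)
    rw [hY₀mem]
    simp only [place] at h1
    split_ifs at h1 <;> grind
  have hWu : ∀ W ∈ (Finset.univ.filter fun i => u i = (c, r + 1)).powerset,
      (∀ i, t.place c r Z (g.right i) = if i ∈ W then (c, r) else u i) → W = W₀ :=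
    fun W hW h => by
    ext i
    have h1 := h i
    have h2 := hWs W hW i
    have h3 := hmem (g.right i)
    rw [hW₀mem]
    simp only [place] at h1
    split_ifs at h1 <;> grind
  by_cases hQ : ∀ i, (u i = (c, r) → g.right i ∈ Z) ∧ t.place c r Y₀ (g.right i) = u i
  · rw [sum_ite_eq_of_unique Y₀ _ (fun i => (hQ i).2) hYu, sum_ite_eq_of_unique W₀ _ _ hWu]
    · rw [Finset.mem_powerset]
      intro i hi
      simpa using ((hW₀mem i).1 hi).1
    · intro i
      have h1 := hQ i
      have h3 := hmem (g.right i)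
      have h4 := hY₀mem i
      have h5 := hW₀mem i
      simp only [place] at h1 ⊢
      split_ifs at h1 ⊢ <;> grind
    · rw [Finset.mem_filter, Finset.mem_powerset]
      refine ⟨fun i hi => ?_, hcard⟩
      obtain ⟨j, rfl⟩ := hsurj i
      exact (hQ j).1 ((hY₀mem j).1 hi)
  · have h1 : ∀ Y ∈ Z.powerset.filter (fun Y => Y.card = t.content (c, r)),
        ¬ ∀ i, t.place c r Y (g.right i) = u i := fun Y hY h => hQ fun i => by
      have h0 := hYu Y hY h
      subst h0
      exact ⟨fun hi => hYZ _ hY i ((hY₀mem i).2 hi), h i⟩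
    have h2 : ∀ W ∈ (Finset.univ.filter fun i => u i = (c, r + 1)).powerset,
        ¬ ∀ i, t.place c r Z (g.right i) = if i ∈ W then (c, r) else u i :=
      fun W hW h => hQ fun i => by
      have h1 := h i
      have h2 := hWs W hW i
      have h3 := hmem (g.right i)
      have h4 := hY₀mem i
      simp only [place] at h1 ⊢
      split_ifs at h1 ⊢ <;> grind
    rw [Finset.sum_eq_zero fun Y hY => if_neg (h1 Y hY),
      Finset.sum_eq_zero fun W hW => if_neg (h2 W hW)]

/-- If `Z` is so large that `Z \ B` alone is longer than the first of the two rows, then also the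
sum over the `Y` between `B` and `Z` lies in the span of elements of larger content. -/
theorem sum_murphy_place_mem (t u : Tabloid m N) (c : Fin m) (r : ℕ) (B : Finset (Fin N))
    (hu : u.content = t.content) : ∀ Z : Finset (Fin N), Z ⊆ t.pair c r → B ⊆ Z →
      t.content (c, r) + B.card < Z.card →
    ∑ Y ∈ Z.powerset.filter (fun Y => B ⊆ Y ∧ Y.card = t.content (c, r)),
      murphy ψ (t.place c r Y) u ∈ higherSpan ψ t := by
  induction B using Finset.induction_on with
  | empty =>
    intro Z hZ _ hcard
    simp only [Finset.empty_subset, true_and]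
    rw [sum_murphy_place ψ t u c r hZ hu]
    exact sum_mem fun W _ => murphy_mem_higherSpan ψ
      (t.dominates_place c r hZ (by simpa using hcard))
  | insert b B hb ih =>
    intro Z hZ hB hcard
    rw [Finset.card_insert_of_notMem hb] at hcard
    have hbZ : b ∈ Z := hB (Finset.mem_insert_self _ _)
    have hBZ : B ⊆ Z := (Finset.subset_insert _ _).trans hB
    have h1 := ih Z hZ hBZ (by omega)
    have h2 := ih (Z.erase b) ((Finset.erase_subset _ _).trans hZ)
      (fun i hi => Finset.mem_erase.2 ⟨by rintro rfl; exact hb hi, hBZ hi⟩)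
      (by rw [Finset.card_erase_of_mem hbZ]; omega)
    rw [← Finset.sum_filter_add_sum_filter_not _ (fun Y => b ∈ Y), Finset.filter_filter,
      Finset.filter_filter] at h1
    have e1 : Z.powerset.filter (fun Y => (B ⊆ Y ∧ Y.card = t.content (c, r)) ∧ b ∈ Y) =
        Z.powerset.filter (fun Y => insert b B ⊆ Y ∧ Y.card = t.content (c, r)) := by
      refine Finset.filter_congr fun Y _ => ?_
      rw [Finset.insert_subset_iff]
      tauto
    have e2 : Z.powerset.filter (fun Y => (B ⊆ Y ∧ Y.card = t.content (c, r)) ∧ b ∉ Y) =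
        (Z.erase b).powerset.filter (fun Y => B ⊆ Y ∧ Y.card = t.content (c, r)) := by
      ext Y
      simp only [Finset.mem_filter, Finset.mem_powerset, Finset.subset_erase]
      tauto
    rw [e1, e2] at h1
    exact (Submodule.add_mem_iff_left _ h2).1 h1

/-- The functions of a tabloid `u` that, for `u` of the content of `t`, take values in the span of
the Murphy elements of larger content. -/
def higherFun (t : Tabloid m N) : Submodule k (Tabloid m N → Wreath m N → k) where
  carrier := {F | ∀ u : Tabloid m N, u.content = t.content → F u ∈ higherSpan ψ t}
  zero_mem' _ _ := zero_mem _
  add_mem' {_ _} h h' u hu := add_mem (h u hu) (h' u hu)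
  smul_mem' c {_} h u hu := Submodule.smul_mem _ c (h u hu)

theorem higherFun_le {t t' : Tabloid m N} (h : t.content = t'.content) :
    higherFun ψ t ≤ higherFun ψ t' := fun _ hF u hu =>
  higherSpan_le ψ h (hF u (hu.trans h.symm))

/-- If `Y` and `Y'` have equally many positions, and those of `Y` outside `Y'` lie before `j` and
those of `Y'` outside `Y` do not, then the positions in `Y` have the smaller sum. -/
theorem sum_val_lt {Y Y' : Finset (Fin N)} {j : ℕ} (hcard : Y.card = Y'.card) (hne : Y ≠ Y')
    (h : ∀ i ∈ Y \ Y', (i : ℕ) < j) (h' : ∀ i ∈ Y' \ Y, j ≤ i) :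
    ∑ i ∈ Y, (i : ℕ) < ∑ i ∈ Y', (i : ℕ) := by
  have hc := Finset.card_sdiff_add_card_inter Y Y'
  have hc' := Finset.card_sdiff_add_card_inter Y' Y
  rw [Finset.inter_comm] at hc'
  have hpos : (Y \ Y').Nonempty := by
    rw [Finset.sdiff_nonempty]
    exact fun hsub => hne (Finset.eq_of_subset_of_card_le hsub hcard.ge)
  have h1 : ∑ i ∈ Y \ Y', (i : ℕ) < ∑ i ∈ Y \ Y', j := Finset.sum_lt_sum_of_nonempty hpos h
  have h2 : ∑ i ∈ Y' \ Y, j ≤ ∑ i ∈ Y' \ Y, (i : ℕ) := Finset.sum_le_sum h'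
  have h3 := Finset.sum_inter_add_sum_sdiff Y Y' fun i => (i : ℕ)
  have h4 := Finset.sum_inter_add_sum_sdiff Y' Y fun i => (i : ℕ)
  rw [Finset.inter_comm] at h4
  rw [Finset.sum_const, smul_eq_mul] at h1 h2
  rw [show (Y' \ Y).card = (Y \ Y').card by omega] at h2
  omega

/-- The straightening rule: modulo elements of larger content, a Murphy element is a combination of
those whose first tabloid is a ballot tabloid, with coefficients that do not depend on the second
tabloid. -/
theorem murphy_mem_ballot (t : Tabloid m N) :
    murphy ψ t ∈ Submodule.span k (murphy ψ '' {t' | t'.Ballot ∧ t'.content = t.content}) ⊔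
      higherFun ψ t := by
  -- a step replaces a tabloid by ones where later positions lie in later rows
  induction hd : N * t.weight - ∑ i : Fin N, (i : ℕ) * (t i).2 using Nat.strong_induction_on
    generalizing t with
  | _ d ih =>
  by_cases hb : t.Ballot
  · exact Submodule.mem_sup_left (Submodule.subset_span ⟨t, ⟨hb, rfl⟩, rfl⟩)
  obtain ⟨j, c, r, hj⟩ : ∃ j c r,
      (Finset.univ.filter fun i : Fin N => (i : ℕ) < j ∧ t i = (c, r)).card <
        (Finset.univ.filter fun i : Fin N => (i : ℕ) < j ∧ t i = (c, r + 1)).card := by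
    simpa [Ballot] using hb
  set Y₀ : Finset (Fin N) := Finset.univ.filter fun i => t i = (c, r) with hY₀
  set B : Finset (Fin N) := Finset.univ.filter fun i : Fin N => (i : ℕ) < j ∧ t i = (c, r) with hB
  set Z : Finset (Fin N) := Y₀ ∪ Finset.univ.filter fun i : Fin N => (i : ℕ) < j ∧ t i = (c, r + 1)
    with hZ
  set a := t.content (c, r) with ha
  have hZcard : a + B.card < Z.card := by
    rw [hZ, Finset.card_union_of_disjoint]
    · have : Y₀.card = a := rfl
      omega
    · rw [Finset.disjoint_left]
      intro i hi hi'
      simp_all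
  have hZp : Z ⊆ t.pair c r := fun i hi => by
    simp only [hZ, hY₀, Finset.mem_union, Finset.mem_filter, Finset.mem_univ, true_and] at hi
    simp only [pair, Finset.mem_filter, Finset.mem_univ, true_and]
    tauto
  have hBY : B ⊆ Y₀ := fun i hi => by simp_all
  have hmem : Y₀ ∈ Z.powerset.filter (fun Y => B ⊆ Y ∧ Y.card = a) := by
    rw [Finset.mem_filter, Finset.mem_powerset]
    exact ⟨Finset.subset_union_left, hBY, rfl⟩
  have hsum : ∑ Y ∈ Z.powerset.filter (fun Y => B ⊆ Y ∧ Y.card = a), murphy ψ (t.place c r Y) ∈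
      higherFun ψ t := fun u hu => by
    rw [Finset.sum_apply]
    exact sum_murphy_place_mem ψ t u c r B hu Z hZp (hBY.trans Finset.subset_union_left) hZcard
  rw [← Finset.add_sum_erase _ _ hmem, hY₀, place_self, ← hY₀] at hsum
  have hrest : ∑ Y ∈ (Z.powerset.filter (fun Y => B ⊆ Y ∧ Y.card = a)).erase Y₀,
      murphy ψ (t.place c r Y) ∈
        Submodule.span k (murphy ψ '' {t' | t'.Ballot ∧ t'.content = t.content}) ⊔
          higherFun ψ t := by
    refine sum_mem fun Y hY => ?_
    rw [Finset.mem_erase, Finset.mem_filter, Finset.mem_powerset] at hY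
    obtain ⟨hne, hYZ, hBY', hcard⟩ := hY
    have hcont := content_place t c r (hYZ.trans hZp) hcard
    have hw := weight_eq_of_content_eq hcont
    have hlt : ∑ i ∈ Y, (i : ℕ) < ∑ i ∈ Y₀, (i : ℕ) := by
      refine sum_val_lt (j := j) hcard hne (fun i hi => ?_) fun i hi => ?_
      · rw [Finset.mem_sdiff] at hi
        have := hYZ hi.1
        rw [hZ, Finset.mem_union] at this
        have := this.resolve_left hi.2
        simp_all
      · rw [Finset.mem_sdiff] at hi
        by_contra! hlt
        refine hi.2 (hBY' ?_)
        simp_all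
    have hM : ∑ i : Fin N, (i : ℕ) * (t i).2 < ∑ i : Fin N, (i : ℕ) * (t.place c r Y i).2 := by
      have h1 := t.sum_place c r (hYZ.trans hZp) fun i x => (i : ℕ) * x.2
      have h2 := t.sum_place c r (Finset.subset_union_left.trans hZp) fun i x => (i : ℕ) * x.2
      rw [hY₀, place_self, ← hY₀] at h2
      simp only [← Finset.sum_mul] at h1 h2
      rw [mul_add, mul_one] at h1 h2
      have h3 := Nat.mul_le_mul_right r hlt.le
      omega
    have hle : ∑ i : Fin N, (i : ℕ) * (t.place c r Y i).2 ≤ N * t.weight := by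
      rw [← hw, weight, Finset.mul_sum]
      exact Finset.sum_le_sum fun i _ => Nat.mul_le_mul_right _ i.2.le
    have := ih _ (by rw [← hd, hw]; omega) (t.place c r Y) rfl
    rw [hcont] at this
    exact sup_le_sup_left (higherFun_le ψ hcont) _ this
  exact (Submodule.add_mem_iff_left _ hrest).1 (Submodule.mem_sup_right hsum)

end Murphy

end CyclotomicBrauer

namespace CyclotomicBrauer

/-! ### Ballot tabloids suffice to span -/

section MurphySpan

open Tabloid

variable {m N : ℕ} [NeZero m] {k : Type*} [Field k] (ψ : AddChar (ZMod m) k)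

/-- The reflection of functions on the wreath product. -/
def flipFun (k : Type*) [Field k] (m N : ℕ) : (Wreath m N → k) →ₗ[k] (Wreath m N → k) :=
  LinearMap.funLeft k k Wreath.flip

theorem flipFun_murphy (t u : Tabloid m N) : flipFun k m N (murphy ψ t u) = murphy ψ u t :=
  funext fun g => murphy_flip ψ t u g

theorem flipFun_mem_higherSpan (t : Tabloid m N) {x : Wreath m N → k}
    (hx : x ∈ higherSpan ψ t) : flipFun k m N x ∈ higherSpan ψ t := by
  have : higherSpan ψ t ≤ (higherSpan ψ t).comap (flipFun k m N) := by
    conv_lhs => rw [higherSpan]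
    rw [Submodule.span_le]
    rintro _ ⟨t', u', h, rfl⟩
    change flipFun k m N (murphy ψ t' u') ∈ higherSpan ψ t
    rw [flipFun_murphy]
    by_cases hc : u'.content = t'.content
    · exact murphy_mem_higherSpan ψ (h.congr_left hc)
    · rw [murphy_eq_zero ψ hc]
      exact zero_mem _
  exact this hx

/-- The span of the Murphy elements of pairs of ballot tabloids of the content of `t`. -/
def ballotLayer (t : Tabloid m N) : Submodule k (Wreath m N → k) :=
  Submodule.span k {x | ∃ t' u' : Tabloid m N, t'.Ballot ∧ u'.Ballot ∧ t'.content = t.content ∧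
    u'.content = t.content ∧ x = murphy ψ t' u'}

/-- The span of the Murphy elements of pairs of ballot tabloids whose content is equal and dominates
that of `t`. -/
def ballotSpan (t : Tabloid m N) : Submodule k (Wreath m N → k) :=
  Submodule.span k {x | ∃ t' u' : Tabloid m N, t'.Ballot ∧ u'.Ballot ∧ t'.content = u'.content ∧
    Dominates t' t ∧ x = murphy ψ t' u'}

theorem murphy_mem_of_ballot_left {t u : Tabloid m N} (hu : u.content = t.content) :
    murphy ψ t u ∈ Submodule.span k {x | ∃ t' : Tabloid m N, t'.Ballot ∧ t'.content = t.content ∧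
      x = murphy ψ t' u} ⊔ higherSpan ψ t := by
  obtain ⟨F, hF, G, hG, h⟩ := Submodule.mem_sup.1 (murphy_mem_ballot ψ t)
  rw [← h]
  refine Submodule.add_mem_sup ?_ (hG u hu)
  have hle : Submodule.span k (murphy ψ '' {t' | t'.Ballot ∧ t'.content = t.content}) ≤
      (Submodule.span k {x | ∃ t' : Tabloid m N, t'.Ballot ∧ t'.content = t.content ∧
        x = murphy ψ t' u}).comap (LinearMap.proj u) := by
    rw [Submodule.span_le]
    rintro _ ⟨t', ht', rfl⟩
    exact Submodule.subset_span ⟨t', ht'.1, ht'.2, rfl⟩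
  exact hle hF

theorem murphy_mem_ballotLayer {t u : Tabloid m N} (hu : u.content = t.content) :
    murphy ψ t u ∈ ballotLayer ψ t ⊔ higherSpan ψ t := by
  have hle : Submodule.span k {x | ∃ t' : Tabloid m N, t'.Ballot ∧ t'.content = t.content ∧
      x = murphy ψ t' u} ⊔ higherSpan ψ t ≤ ballotLayer ψ t ⊔ higherSpan ψ t := by
    refine sup_le ?_ le_sup_right
    rw [Submodule.span_le]
    rintro _ ⟨t', hb, hc, rfl⟩
    have h := murphy_mem_of_ballot_left ψ (t := u) (u := t') (hc.trans hu.symm)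
    rw [SetLike.mem_coe, ← flipFun_murphy]
    have hle' : Submodule.span k {x | ∃ u' : Tabloid m N, u'.Ballot ∧ u'.content = u.content ∧
        x = murphy ψ u' t'} ⊔ higherSpan ψ u ≤
        (ballotLayer ψ t ⊔ higherSpan ψ t).comap (flipFun k m N) := by
      refine sup_le ?_ fun x hx => Submodule.mem_sup_right
        (higherSpan_le ψ hu (flipFun_mem_higherSpan ψ u hx))
      rw [Submodule.span_le]
      rintro _ ⟨u', hb', hc', rfl⟩
      change flipFun k m N (murphy ψ u' t') ∈ ballotLayer ψ t ⊔ higherSpan ψ t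
      rw [flipFun_murphy]
      exact Submodule.mem_sup_left (Submodule.subset_span ⟨t', u', hb, hb', hc, hc'.trans hu, rfl⟩)
    exact hle' h
  exact hle (murphy_mem_of_ballot_left ψ hu)

theorem ballotSpan_le {t t' : Tabloid m N} (h : Dominates t' t) :
    ballotSpan ψ t' ≤ ballotSpan ψ t := by
  refine Submodule.span_mono ?_
  rintro _ ⟨t₁, u₁, h₁, h₂, h₃, h₄, rfl⟩
  exact ⟨t₁, u₁, h₁, h₂, h₃, h₄.trans h, rfl⟩

/-- Straightening on both sides, repeated for the elements of larger content, ends in ballot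
tabloids since a larger content has smaller weight. -/
theorem higherSpan_le_ballotSpan (t : Tabloid m N) : higherSpan ψ t ≤ ballotSpan ψ t := by
  induction hw : t.weight using Nat.strong_induction_on generalizing t with
  | _ w ih =>
  conv_lhs => rw [higherSpan]
  rw [Submodule.span_le]
  rintro _ ⟨t', u', h, rfl⟩
  by_cases hc : u'.content = t'.content
  · have hle : ballotLayer ψ t' ⊔ higherSpan ψ t' ≤ ballotSpan ψ t := by
      refine sup_le ?_ ((ih _ (by rw [← hw]; exact h.2) t' rfl).trans (ballotSpan_le ψ h))
      refine Submodule.span_mono ?_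
      rintro _ ⟨t₁, u₁, h₁, h₂, h₃, h₄, rfl⟩
      exact ⟨t₁, u₁, h₁, h₂, h₃.trans h₄.symm, h.congr_left h₃, rfl⟩
    exact hle (murphy_mem_ballotLayer ψ hc)
  · rw [murphy_eq_zero ψ (Ne.symm hc)]
    exact zero_mem _

/-- The straightening rule with coefficients: they do not depend on the second tabloid. -/
theorem exists_straightening (t : Tabloid m N) : ∃ r : Tabloid m N →₀ k,
    (∀ t' ∈ r.support, t'.Ballot ∧ t'.content = t.content) ∧
    ∀ u : Tabloid m N, u.content = t.content →
      murphy ψ t u - r.sum (fun t' a => a • murphy ψ t' u) ∈ ballotSpan ψ t := by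
  obtain ⟨F, hF, G, hG, h⟩ := Submodule.mem_sup.1 (murphy_mem_ballot ψ t)
  obtain ⟨r, hr, rfl⟩ := (Finsupp.mem_span_image_iff_linearCombination k).1 hF
  refine ⟨r, fun t' ht' => hr ht', fun u hu => ?_⟩
  have h1 : r.sum (fun t' a => a • murphy ψ t' u) =
      Finsupp.linearCombination k (murphy ψ) r u := by
    rw [Finsupp.linearCombination_apply, Finsupp.sum, Finsupp.sum, Finset.sum_apply]
    rfl
  rw [h1, ← h, Pi.add_apply, add_sub_cancel_left]
  exact higherSpan_le_ballotSpan ψ t (hG u hu)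

/-- The tabloid in which every row has at most one position, with prescribed colours. -/
def injTabloid (c : Fin N → Fin m) : Tabloid m N := fun i => (c i, i)

theorem sum_colour (hψ : ψ.IsPrimitive) (a : ZMod m) :
    ∑ c : Fin m, ψ (ZMod.finEquiv m c * a) = if a = 0 then (m : k) else 0 := by
  rw [(ZMod.finEquiv m).bijective.sum_comp (fun x => ψ (x * a)), AddChar.sum_mulShift a hψ,
    ZMod.card, Nat.cast_ite, Nat.cast_zero]

/-- Fourier inversion on the base group. -/
theorem smul_single_eq_sum (hψ : ψ.IsPrimitive) (g₀ : Wreath m N) :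
    (m : k) ^ N • (Pi.single g₀ 1 : Wreath m N → k) =
      ∑ c : Fin N → Fin m, (∏ i, ψ ((g₀.left i).toAdd * ZMod.finEquiv m (c i))) •
        murphy ψ (injTabloid c) fun i => injTabloid c (g₀.right i) := by
  funext g
  rw [Finset.sum_apply, Pi.smul_apply]
  have hiff : ∀ c : Fin N → Fin m,
      (∀ i, injTabloid c (g.right i) = injTabloid c (g₀.right i)) ↔ g.right = g₀.right :=
        fun c => by
    refine ⟨fun h => Equiv.ext fun i => ?_, fun h i => by rw [h]⟩
    have := congrArg Prod.snd (h i)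
    exact Fin.ext this
  simp only [Pi.smul_apply, murphy, hiff]
  by_cases hr : g.right = g₀.right
  · simp only [hr, if_true, colourChar, injTabloid, smul_eq_mul, ← Finset.prod_mul_distrib,
      ← AddChar.map_add_eq_mul]
    have h1 : ∑ c : Fin N → Fin m, ∏ i, ψ ((g₀.left i).toAdd * ZMod.finEquiv m (c i) +
        -((g.left i).toAdd * ZMod.finEquiv m (c i))) =
        ∏ i, ∑ c : Fin m, ψ (ZMod.finEquiv m c * ((g₀.left i).toAdd - (g.left i).toAdd)) := by
      rw [Finset.prod_univ_sum, Fintype.piFinset_univ]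
      refine Finset.sum_congr rfl fun c _ => Finset.prod_congr rfl fun i _ => ?_
      congr 1
      ring
    rw [h1]
    simp only [sum_colour ψ hψ]
    by_cases hl : g.left = g₀.left
    · have hg : g = g₀ := SemidirectProduct.ext hl hr
      simp [hg]
    · obtain ⟨i, hi⟩ := Function.ne_iff.1 hl
      have h2 : (g₀.left i).toAdd - (g.left i).toAdd ≠ 0 :=
        sub_ne_zero.2 fun h => hi (Multiplicative.toAdd.injective h.symm)
      rw [Finset.prod_eq_zero (Finset.mem_univ i) (if_neg h2),
        Pi.single_eq_of_ne (fun h => hl (congrArg SemidirectProduct.left h)), mul_zero]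
  · simp only [hr, if_false, smul_zero, Finset.sum_const_zero]
    rw [Pi.single_eq_of_ne, smul_zero]
    exact fun h => hr (congrArg SemidirectProduct.right h)

instance : Finite (Wreath m N) := Finite.of_equiv _ SemidirectProduct.equivProd.symm

/-- The Murphy elements of the pairs of ballot tabloids of equal content span. -/
theorem span_ballot_eq_top (hψ : ψ.IsPrimitive) (hm : (m : k) ≠ 0) :
    Submodule.span k {x | ∃ t u : Tabloid m N, t.Ballot ∧ u.Ballot ∧ t.content = u.content ∧
      x = murphy ψ t u} = ⊤ := by
  set J := Submodule.span k {x | ∃ t u : Tabloid m N, t.Ballot ∧ u.Ballot ∧ t.content = u.content ∧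
      x = murphy ψ t u} with hJ
  have hmem : ∀ t u : Tabloid m N, murphy ψ t u ∈ J := fun t u => by
    by_cases hc : u.content = t.content
    · have hle : ballotLayer ψ t ⊔ higherSpan ψ t ≤ J := by
        refine sup_le (Submodule.span_mono ?_)
          ((higherSpan_le_ballotSpan ψ t).trans (Submodule.span_mono ?_))
        · rintro _ ⟨t', u', h₁, h₂, h₃, h₄, rfl⟩
          exact ⟨t', u', h₁, h₂, h₃.trans h₄.symm, rfl⟩
        · rintro _ ⟨t', u', h₁, h₂, h₃, h₄, rfl⟩
          exact ⟨t', u', h₁, h₂, h₃, rfl⟩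
      exact hle (murphy_mem_ballotLayer ψ hc)
    · rw [murphy_eq_zero ψ (Ne.symm hc)]
      exact zero_mem _
  rw [eq_top_iff, ← (Pi.basisFun k (Wreath m N)).span_eq, Submodule.span_le]
  rintro _ ⟨g, rfl⟩
  rw [Pi.basisFun_apply, SetLike.mem_coe]
  have h := smul_single_eq_sum ψ hψ g
  rw [← inv_smul_smul₀ (pow_ne_zero N hm) (Pi.single g (1 : k) : Wreath m N → k), h]
  exact Submodule.smul_mem _ _ (sum_mem fun c _ => Submodule.smul_mem _ _ (hmem _ _))

theorem exists_primitive_addChar (k : Type*) [Field k] [IsAlgClosed k] (hm : (m : k) ≠ 0) :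
    ∃ ψ : AddChar (ZMod m) k, ψ.IsPrimitive := by
  have : NeZero (m : k) := ⟨hm⟩
  obtain ⟨ζ, hζ⟩ := HasEnoughRootsOfUnity.exists_primitiveRoot k m
  exact ⟨_, AddChar.zmodChar_primitive_of_primitive_root m hζ⟩

end MurphySpan

end CyclotomicBrauer

namespace CyclotomicBrauer

/-! ### Counting pairs of ballot tabloids -/

section Counting

open scoped Classical

/-- The function `μ` on rows describes an `m`-tuple of partitions. -/
def IsPart {m : ℕ} (μ : Fin m × ℕ → ℕ) : Prop := ∀ c r, μ (c, r + 1) ≤ μ (c, r)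

namespace Tabloid

variable {m N : ℕ}

/-- Add a last position to a tabloid. -/
def snoc (t : Tabloid m N) (s : Fin m × ℕ) : Tabloid m (N + 1) :=
  Fin.snoc (α := fun _ => Fin m × ℕ) t s

/-- Remove the last position from a tabloid. -/
def init (t : Tabloid m (N + 1)) : Tabloid m N := fun i => t i.castSucc

theorem snoc_init (t : Tabloid m (N + 1)) : t.init.snoc (t (Fin.last N)) = t :=
  Fin.snoc_init_self (α := fun _ => Fin m × ℕ) t

theorem init_snoc (t : Tabloid m N) (s : Fin m × ℕ) : (t.snoc s).init = t :=
  Fin.init_snoc (α := fun _ => Fin m × ℕ) s t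

theorem snoc_last (t : Tabloid m N) (s : Fin m × ℕ) : t.snoc s (Fin.last N) = s :=
  Fin.snoc_last (α := fun _ => Fin m × ℕ) s t

theorem snoc_castSucc (t : Tabloid m N) (s : Fin m × ℕ) (i : Fin N) :
    t.snoc s i.castSucc = t i :=
  Fin.snoc_castSucc (α := fun _ => Fin m × ℕ) s t i

theorem content_snoc (t : Tabloid m N) (s : Fin m × ℕ) :
    (t.snoc s).content = t.content + Pi.single s 1 := by
  funext x
  rw [content_eq_sum, Fin.sum_univ_castSucc, Pi.add_apply, content_eq_sum, Pi.single_apply]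
  simp only [snoc_castSucc, snoc_last, eq_comm (a := x)]

theorem card_prefix_snoc_of_le (t : Tabloid m N) (s x : Fin m × ℕ) {j : ℕ} (hj : j ≤ N) :
    (Finset.univ.filter fun i : Fin (N + 1) => (i : ℕ) < j ∧ t.snoc s i = x).card =
      (Finset.univ.filter fun i : Fin N => (i : ℕ) < j ∧ t i = x).card := by
  rw [Finset.card_filter, Finset.card_filter, Fin.sum_univ_castSucc]
  simp only [snoc_castSucc, Fin.val_castSucc, Fin.val_last, not_lt.2 hj, false_and, if_false,
    add_zero]

theorem card_prefix_of_le (t : Tabloid m N) (x : Fin m × ℕ) {j : ℕ} (hj : N ≤ j) :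
    (Finset.univ.filter fun i : Fin N => (i : ℕ) < j ∧ t i = x).card = t.content x := by
  rw [content]
  congr 1
  refine Finset.filter_congr fun i _ => ?_
  simp only [i.2.trans_le hj, true_and]

theorem Ballot.isPart {t : Tabloid m N} (h : t.Ballot) : IsPart t.content := fun c r => by
  have := h N c r
  rwa [card_prefix_of_le _ _ le_rfl, card_prefix_of_le _ _ le_rfl] at this

theorem ballot_snoc_iff (t : Tabloid m N) (s : Fin m × ℕ) :
    (t.snoc s).Ballot ↔ t.Ballot ∧ IsPart (t.content + Pi.single s 1) := by
  rw [← content_snoc]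
  refine ⟨fun h => ⟨fun j c r => ?_, h.isPart⟩, fun h j c r => ?_⟩
  · have h1 := h (min j N) c r
    rw [card_prefix_snoc_of_le _ _ _ (min_le_right _ _),
      card_prefix_snoc_of_le _ _ _ (min_le_right _ _)] at h1
    simpa only [lt_min_iff, Fin.is_lt, and_true] using h1
  · rcases le_or_gt j N with hj | hj
    · rw [card_prefix_snoc_of_le _ _ _ hj, card_prefix_snoc_of_le _ _ _ hj]
      exact h.1 j c r
    · rw [card_prefix_of_le _ _ hj, card_prefix_of_le _ _ hj]
      exact h.2 c r

theorem content_apply_pos (t : Tabloid m N) (i : Fin N) : 0 < t.content (t i) :=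
  Finset.card_pos.2 ⟨i, by simp⟩

theorem exists_of_content_pos {t : Tabloid m N} {s : Fin m × ℕ} (h : 0 < t.content s) :
    ∃ i, t i = s := by
  obtain ⟨i, hi⟩ := Finset.card_pos.1 h
  exact ⟨i, by simpa using hi⟩

/-- The rows of a tabloid of partition content are numbered below the number of positions. -/
theorem snd_lt_of_isPart {t : Tabloid m N} (h : IsPart t.content) (i : Fin N) : (t i).2 < N := by
  have hanti : Antitone fun r => t.content ((t i).1, r) := antitone_nat_of_succ_le (h _)
  have hex : ∀ r : Fin ((t i).2 + 1), ∃ j, t j = ((t i).1, (r : ℕ)) := fun r =>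
    exists_of_content_pos ((t.content_apply_pos i).trans_le (hanti (Nat.lt_succ_iff.1 r.2)))
  choose e he using hex
  have hinj : Function.Injective e := fun a b hab => by
    have := (he a).symm.trans ((congrArg t hab).trans (he b))
    exact Fin.ext (congrArg Prod.snd this)
  simpa using Fintype.card_le_of_injective e hinj

end Tabloid

open Tabloid

variable {m : ℕ}

/-- The first `K` rows of every colour. -/
def rows (m K : ℕ) : Finset (Fin m × ℕ) := Finset.univ ×ˢ Finset.range K

theorem mem_rows {K : ℕ} {s : Fin m × ℕ} : s ∈ rows m K ↔ s.2 < K := by simp [rows]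

/-- The ballot tabloids with `N` positions. -/
noncomputable def ballots (m N : ℕ) : Finset (Tabloid m N) :=
  (Fintype.piFinset fun _ => rows m N).filter fun t => t.Ballot

theorem mem_ballots {N : ℕ} {t : Tabloid m N} : t ∈ ballots m N ↔ t.Ballot := by
  rw [ballots, Finset.mem_filter, Fintype.mem_piFinset]
  exact ⟨fun h => h.2, fun h => ⟨fun i => mem_rows.2 (snd_lt_of_isPart h.isPart i), h⟩⟩

/-- The number of ballot tabloids of a given content. -/
noncomputable def ballotCount (N : ℕ) (μ : Fin m × ℕ → ℕ) : ℕ :=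
  ((ballots m N).filter fun t => t.content = μ).card

theorem ballotCount_eq_zero {N : ℕ} {μ : Fin m × ℕ → ℕ} (h : ¬ IsPart μ) :
    ballotCount N μ = 0 := by
  rw [ballotCount, Finset.card_eq_zero, Finset.filter_eq_empty_iff]
  rintro t ht rfl
  exact h (mem_ballots.1 ht).isPart

theorem content_zero (t : Tabloid m 0) : t.content = 0 := funext fun s => by simp [content]

theorem ballotCount_zero (μ : Fin m × ℕ → ℕ) : ballotCount 0 μ = if μ = 0 then 1 else 0 := by
  rw [ballotCount]
  simp only [content_zero, eq_comm (a := (0 : Fin m × ℕ → ℕ))]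
  by_cases h : μ = 0
  · have : ballots m 0 = Finset.univ := Finset.eq_univ_of_forall fun t =>
      mem_ballots.2 fun j c r => by simp
    simp [h, this]
  · simp [h]

theorem add_single_sub_single (μ : Fin m × ℕ → ℕ) (s : Fin m × ℕ) :
    μ + Pi.single s 1 - Pi.single s 1 = μ := by
  funext x
  simp

theorem sub_single_add_single {μ : Fin m × ℕ → ℕ} {s : Fin m × ℕ} (h : 0 < μ s) :
    μ - Pi.single s 1 + Pi.single s 1 = μ := by
  funext x
  simp only [Pi.add_apply, Pi.sub_apply, Pi.single_apply]
  split_ifs with hx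
  · subst hx
    omega
  · omega

/-- Ballot tabloids are counted by removing the last position. -/
theorem ballotCount_succ (N K : ℕ) {μ : Fin m × ℕ → ℕ} (hμ : IsPart μ)
    (hK : ∀ c, μ (c, K) = 0) : ballotCount (N + 1) μ =
      ∑ r ∈ rows m K, if 0 < μ r then ballotCount N (μ - Pi.single r 1) else 0 := by
  have hanti : ∀ c, Antitone fun r => μ (c, r) := fun c => antitone_nat_of_succ_le (hμ c)
  rw [ballotCount, Finset.card_eq_sum_card_fiberwise (f := fun t => t (Fin.last N)) (t := rows m K)]
  · refine Finset.sum_congr rfl fun r _ => ?_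
    split_ifs with hr
    · refine Finset.card_nbij' init (fun t => t.snoc r) ?_ ?_ ?_ ?_
      · intro t ht
        simp only [Finset.coe_filter, Finset.mem_filter, Set.mem_ofPred_eq, mem_ballots] at ht ⊢
        obtain ⟨⟨hb, hc⟩, hl⟩ := ht
        rw [← t.snoc_init, hl] at hb hc
        rw [ballot_snoc_iff] at hb
        rw [content_snoc] at hc
        exact ⟨hb.1, by rw [← hc, add_single_sub_single]⟩
      · intro t ht
        simp only [Finset.coe_filter, Finset.mem_filter, Set.mem_ofPred_eq, mem_ballots] at ht ⊢
        rw [ballot_snoc_iff, content_snoc, ht.2, sub_single_add_single hr]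
        exact ⟨⟨⟨ht.1, hμ⟩, rfl⟩, t.snoc_last r⟩
      · intro t ht
        simp only [Finset.coe_filter, Finset.mem_filter, Set.mem_ofPred_eq] at ht
        change t.init.snoc r = t
        rw [← ht.2, snoc_init]
      · intro t _
        exact t.init_snoc r
    · rw [Finset.card_eq_zero, Finset.filter_eq_empty_iff]
      intro t ht hl
      rw [Finset.mem_filter] at ht
      have := t.content_apply_pos (Fin.last N)
      rw [ht.2, hl] at this
      exact hr this
  · intro t ht
    rw [Finset.mem_coe, Finset.mem_filter] at ht
    rw [Finset.mem_coe, mem_rows]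
    by_contra! hlt
    have h1 := t.content_apply_pos (Fin.last N)
    have h2 := hanti (t (Fin.last N)).1 hlt
    simp only [hK] at h2
    rw [ht.2] at h1
    exact absurd h2 (not_le.2 h1)

theorem sum_ballots_succ (N : ℕ) (G : (Fin m × ℕ → ℕ) → ℕ) :
    ∑ t ∈ ballots m (N + 1), G t.content = ∑ t ∈ ballots m N, ∑ s ∈ rows m (N + 1),
      if IsPart (t.content + Pi.single s 1) then G (t.content + Pi.single s 1) else 0 := by
  rw [← Finset.sum_product', ← Finset.sum_filter]
  refine Finset.sum_nbij' (fun t => (t.init, t (Fin.last N))) (fun x => x.1.snoc x.2) ?_ ?_ ?_ ?_ ?_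
  · intro t ht
    rw [mem_ballots] at ht
    have h1 := ht
    rw [← t.snoc_init, ballot_snoc_iff] at h1
    simp only [Finset.mem_filter, Finset.mem_product, mem_ballots, mem_rows]
    exact ⟨⟨h1.1, snd_lt_of_isPart ht.isPart _⟩, h1.2⟩
  · intro x hx
    simp only [Finset.mem_filter, Finset.mem_product, mem_ballots, mem_rows] at hx
    rw [mem_ballots, ballot_snoc_iff]
    exact ⟨hx.1.1, hx.2⟩
  · intro t _
    exact t.snoc_init
  · intro x _
    exact Prod.ext (init_snoc _ _) (snoc_last _ _)
  · intro t _
    change _ = G (t.init.content + Pi.single (t (Fin.last N)) 1)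
    rw [← content_snoc, snoc_init]

theorem isPart_add_single_succ_iff {μ : Fin m × ℕ → ℕ} (hμ : IsPart μ) (c : Fin m) (r : ℕ) :
    IsPart (μ + Pi.single (c, r + 1) 1) ↔ μ (c, r + 1) < μ (c, r) := by
  constructor
  · intro h
    have := h c r
    simpa [Nat.succ_le_iff] using this
  · intro h c' x
    have := hμ c' x
    simp only [Pi.add_apply, Pi.single_apply, Prod.mk.injEq]
    by_cases hc : c' = c
    · subst hc
      by_cases hx : x = r
      · subst hx
        simpa [Nat.succ_le_iff] using h
      · simp only [true_and, add_left_inj, hx, if_false]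
        omega
    · simpa [hc] using this

theorem isPart_add_single_zero {μ : Fin m × ℕ → ℕ} (hμ : IsPart μ) (c : Fin m) :
    IsPart (μ + Pi.single (c, 0) 1) := fun c' x => by
  have := hμ c' x
  simp only [Pi.add_apply, Pi.single_apply, Prod.mk.injEq, Nat.add_eq_zero_iff, one_ne_zero,
    and_false, if_false]
  omega

theorem isPart_sub_single_iff {μ : Fin m × ℕ → ℕ} (hμ : IsPart μ) (c : Fin m) (r : ℕ) :
    (0 < μ (c, r) ∧ IsPart (μ - Pi.single (c, r) 1)) ↔ μ (c, r + 1) < μ (c, r) := by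
  constructor
  · rintro ⟨hpos, h⟩
    have := h c r
    simp at this
    omega
  · intro h
    refine ⟨by omega, fun c' x => ?_⟩
    have := hμ c' x
    simp only [Pi.sub_apply, Pi.single_apply, Prod.mk.injEq]
    by_cases hc : c' = c
    · subst hc
      by_cases hx : x = r
      · subst hx
        simp
        omega
      · simp only [true_and, hx, if_false]
        omega
    · simpa [hc] using this

/-- A tuple of `m` partitions has `m` more addable than removable rows. -/
theorem card_addable {μ : Fin m × ℕ → ℕ} (hμ : IsPart μ) {K : ℕ} (hK : ∀ c, μ (c, K) = 0) :
    ((rows m (K + 1)).filter fun s => IsPart (μ + Pi.single s 1)).card =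
      m + ((rows m (K + 1)).filter fun r => 0 < μ r ∧ IsPart (μ - Pi.single r 1)).card := by
  have h : ((rows m (K + 1)).filter fun s => IsPart (μ + Pi.single s 1)) =
      (Finset.univ.image fun c : Fin m => (c, 0)) ∪
        ((rows m (K + 1)).filter fun r => 0 < μ r ∧ IsPart (μ - Pi.single r 1)).image
          fun r => (r.1, r.2 + 1) := by
    ext ⟨c, x⟩
    simp only [Finset.mem_filter, mem_rows, Finset.mem_union, Finset.mem_image, Finset.mem_univ,
      true_and, Prod.mk.injEq, Prod.exists, exists_eq_left]
    rcases x with _ | x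
    · simp [isPart_add_single_zero hμ c]
    · simp only [isPart_add_single_succ_iff hμ, isPart_sub_single_iff hμ]
      constructor
      · rintro ⟨h1, h2⟩
        exact Or.inr ⟨c, x, ⟨by omega, h2⟩, rfl, rfl⟩
      · rintro (⟨_, ⟨⟩⟩ | ⟨c', x', ⟨h1, h2⟩, rfl, h3⟩)
        obtain rfl : x' = x := by omega
        refine ⟨?_, h2⟩
        have : x' ≠ K := by
          rintro rfl
          rw [hK] at h2
          omega
        omega
  rw [h, Finset.card_union_of_disjoint, Finset.card_image_of_injective,
    Finset.card_image_of_injective, Finset.card_univ, Fintype.card_fin]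
  · rintro ⟨c, x⟩ ⟨c', x'⟩ h
    simpa using h
  · intro c c' h
    simpa using h
  · rw [Finset.disjoint_left]
    intro s hs hs'
    simp only [Finset.mem_image] at hs hs'
    obtain ⟨c, -, rfl⟩ := hs
    obtain ⟨r, -, hr⟩ := hs'
    simp at hr

/-- The contribution to the counts below of adding a box in row `s` and removing one in another
row `r`. -/
noncomputable def moveCount (N : ℕ) (μ : Fin m × ℕ → ℕ) (s r : Fin m × ℕ) : ℕ :=
  if s ≠ r ∧ 0 < μ r then ballotCount N (μ + Pi.single s 1 - Pi.single r 1) else 0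

theorem sub_add_single_eq {μ : Fin m × ℕ → ℕ} {s r : Fin m × ℕ} (hr : 0 < μ r) :
    μ - Pi.single r 1 + Pi.single s 1 = μ + Pi.single s 1 - Pi.single r 1 := by
  funext x
  simp only [Pi.add_apply, Pi.sub_apply, Pi.single_apply]
  by_cases hx : x = r
  · subst hx
    split_ifs <;> omega
  · simp [hx]

theorem isPart_add_of_move {μ : Fin m × ℕ → ℕ} (hμ : IsPart μ) {s r : Fin m × ℕ} (hsr : s ≠ r)
    (h : IsPart (μ + Pi.single s 1 - Pi.single r 1)) : IsPart (μ + Pi.single s 1) := fun c x => by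
  have h1 := hμ c x
  have h2 := h c x
  simp only [Pi.add_apply, Pi.sub_apply, Pi.single_apply] at h2 ⊢
  by_cases hs : (c, x + 1) = s
  · have hr : (c, x + 1) ≠ r := fun h => hsr (hs.symm.trans h)
    simp only [hs, if_true] at h2 ⊢
    subst hs
    split_ifs at h2 ⊢ <;> omega
  · simp only [hs, if_false]
    omega

theorem isPart_sub_of_move {μ : Fin m × ℕ → ℕ} (hμ : IsPart μ) {s r : Fin m × ℕ} (hsr : s ≠ r)
    (h : IsPart (μ + Pi.single s 1 - Pi.single r 1)) :
    IsPart (μ - Pi.single r 1) := fun c x => by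
  have h1 := hμ c x
  have h2 := h c x
  simp only [Pi.add_apply, Pi.sub_apply, Pi.single_apply] at h2 ⊢
  by_cases hx : (c, x) = r
  · have hs : (c, x) ≠ s := fun h => hsr (h.symm.trans hx)
    have hx' : (c, x + 1) ≠ r := by
      rw [← hx]
      simp
    simp only [hx', if_neg hs, if_pos hx, if_false] at h2 ⊢
    omega
  · simp only [hx, if_false]
    omega

/-- Adding a box in row `s` and then removing the last position either takes the same box away or
moves a box from another row to `s`. -/
theorem sum_move_add (N : ℕ) {μ : Fin m × ℕ → ℕ} (hμ : IsPart μ) {K : ℕ}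
    (hK : ∀ c, μ (c, K) = 0) {s : Fin m × ℕ} (hs : s ∈ rows m (K + 1)) :
    (if IsPart (μ + Pi.single s 1) then ballotCount (N + 1) (μ + Pi.single s 1) else 0) =
      (if IsPart (μ + Pi.single s 1) then ballotCount N μ else 0) +
        ∑ r ∈ rows m (K + 1), moveCount N μ s r := by
  by_cases h : IsPart (μ + Pi.single s 1)
  · have hK' : ∀ c, (μ + Pi.single s 1 : Fin m × ℕ → ℕ) (c, K + 1) = 0 := fun c => by
      have h1 := hμ c K
      rw [hK] at h1
      have h2 : (c, K + 1) ≠ s := by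
        rintro rfl
        simp [mem_rows] at hs
      simp only [Pi.add_apply, Pi.single_apply, h2, if_false]
      omega
    rw [if_pos h, if_pos h, ballotCount_succ N (K + 1) h hK', ← Finset.add_sum_erase _ _ hs,
      ← Finset.add_sum_erase _ (moveCount N μ s) hs, add_single_sub_single, if_pos (by simp)]
    have h0 : moveCount N μ s s = 0 := if_neg fun h => h.1 rfl
    rw [h0, zero_add]
    congr 1
    refine Finset.sum_congr rfl fun r hr => ?_
    have hne : s ≠ r := (Finset.ne_of_mem_erase hr).symm
    simp only [moveCount, Pi.add_apply, Pi.single_apply, hne.symm, if_false, add_zero, hne, ne_eq,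
      not_false_eq_true, true_and]
  · rw [if_neg h, if_neg h, zero_add, eq_comm]
    refine Finset.sum_eq_zero fun r _ => ?_
    rw [moveCount]
    split_ifs with hr
    · exact ballotCount_eq_zero fun h' => h (isPart_add_of_move hμ hr.1 h')
    · rfl

/-- Removing a box in row `r` and then adding one either puts the same box back or moves it from
`r` to another row. -/
theorem sum_move_sub (N : ℕ) {μ : Fin m × ℕ → ℕ} (hμ : IsPart μ) {K : ℕ} {r : Fin m × ℕ}
    (hr : r ∈ rows m (K + 1)) :
    (if 0 < μ r ∧ IsPart (μ - Pi.single r 1) then ∑ s ∈ rows m (K + 1),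
      (if IsPart (μ - Pi.single r 1 + Pi.single s 1) then
        ballotCount N (μ - Pi.single r 1 + Pi.single s 1) else 0) else 0) =
      (if 0 < μ r ∧ IsPart (μ - Pi.single r 1) then ballotCount N μ else 0) +
        ∑ s ∈ rows m (K + 1), moveCount N μ s r := by
  have hdrop : ∀ ν : Fin m × ℕ → ℕ, (if IsPart ν then ballotCount N ν else 0) = ballotCount N ν :=
    fun ν => by
      split_ifs with h
      · rfl
      · exact (ballotCount_eq_zero h).symm
  simp only [hdrop]
  by_cases h : 0 < μ r ∧ IsPart (μ - Pi.single r 1)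
  · have h0 : moveCount N μ r r = 0 := if_neg fun h => h.1 rfl
    rw [if_pos h, if_pos h, ← Finset.add_sum_erase _ _ hr, sub_single_add_single h.1,
      ← Finset.add_sum_erase _ (fun s => moveCount N μ s r) hr, h0, zero_add]
    congr 1
    refine Finset.sum_congr rfl fun s hs => ?_
    rw [moveCount, if_pos ⟨Finset.ne_of_mem_erase hs, h.1⟩, sub_add_single_eq h.1]
  · rw [if_neg h, if_neg h, zero_add, eq_comm]
    refine Finset.sum_eq_zero fun s _ => ?_
    rw [moveCount]
    split_ifs with hs
    · exact ballotCount_eq_zero fun h' => h ⟨hs.2, isPart_sub_of_move hμ hs.1 h'⟩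
    · rfl

/-- The branching identity: the numbers of ballot tabloids of the contents obtained by adding a box
sum up to a multiple of the original number. -/
theorem sum_ballotCount_add (N : ℕ) {μ : Fin m × ℕ → ℕ} (hμ : IsPart μ) {K : ℕ}
    (hK : ∀ c, μ (c, K) = 0) : ∑ s ∈ rows m (K + 1),
      (if IsPart (μ + Pi.single s 1) then ballotCount (N + 1) (μ + Pi.single s 1) else 0) =
        (N + 1) * m * ballotCount N μ := by
  induction N generalizing μ with
  | zero =>
    rw [Finset.sum_congr rfl fun s hs => sum_move_add 0 hμ hK hs, Finset.sum_add_distrib,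
      ← Finset.sum_filter, Finset.sum_const, card_addable hμ hK]
    have h1 : ∀ s r, moveCount 0 μ s r = 0 := fun s r => by
      rw [moveCount, ballotCount_zero]
      split_ifs with h1 h2
      · have := congrFun h2 s
        simp [h1.1] at this
      · rfl
      · rfl
    simp only [h1, Finset.sum_const_zero, add_zero, smul_eq_mul, zero_add, one_mul]
    by_cases h : μ = 0
    · subst h
      simp
    · simp [ballotCount_zero, h]
  | succ N ih =>
    have hX : (∑ r ∈ rows m (K + 1), if 0 < μ r ∧ IsPart (μ - Pi.single r 1) then
        ballotCount (N + 1) μ else 0) + ∑ r ∈ rows m (K + 1), ∑ s ∈ rows m (K + 1),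
          moveCount (N + 1) μ s r = (N + 1) * m * ballotCount (N + 1) μ := by
      rw [← Finset.sum_add_distrib, ← Finset.sum_congr rfl fun r hr => sum_move_sub (N + 1) hμ hr,
        ballotCount_succ N (K + 1) hμ (fun c => Nat.le_zero.1 ((hμ c K).trans (hK c).le)),
        Finset.mul_sum]
      refine Finset.sum_congr rfl fun r _ => ?_
      by_cases h : 0 < μ r
      · by_cases h' : IsPart (μ - Pi.single r 1)
        · rw [if_pos ⟨h, h'⟩, if_pos h, ih h' fun c => by simp [hK]]
        · rw [if_neg fun h'' => h' h''.2, if_pos h, ballotCount_eq_zero h', mul_zero]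
      · rw [if_neg fun h'' => h h''.1, if_neg h, mul_zero]
    rw [Finset.sum_comm] at hX
    rw [Finset.sum_congr rfl fun s hs => sum_move_add (N + 1) hμ hK hs, Finset.sum_add_distrib,
      ← Finset.sum_filter, Finset.sum_const, card_addable hμ hK]
    rw [← Finset.sum_filter, Finset.sum_const] at hX
    rw [smul_eq_mul] at hX ⊢
    linarith

/-- The number of pairs of ballot tabloids of equal content is the order of the wreath product. -/
theorem sum_ballotCount (m N : ℕ) :
    ∑ t ∈ ballots m N, ballotCount N t.content = m ^ N * N.factorial := by
  induction N with
  | zero =>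
    have : ballots m 0 = Finset.univ := Finset.eq_univ_of_forall fun t =>
      mem_ballots.2 fun j c r => by simp
    simp [this, content_zero, ballotCount_zero]
  | succ N ih =>
    rw [sum_ballots_succ]
    have h : ∀ t ∈ ballots m N, ∑ s ∈ rows m (N + 1),
        (if IsPart (t.content + Pi.single s 1) then
          ballotCount (N + 1) (t.content + Pi.single s 1) else 0) =
        (N + 1) * m * ballotCount N t.content := fun t ht => by
      have hp := (mem_ballots.1 ht).isPart
      refine sum_ballotCount_add N hp fun c => ?_
      by_contra hne
      obtain ⟨i, hi⟩ := exists_of_content_pos (Nat.pos_of_ne_zero hne)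
      have := snd_lt_of_isPart hp i
      rw [hi] at this
      exact lt_irrefl _ this
    rw [Finset.sum_congr rfl h, ← Finset.mul_sum, ih, Nat.factorial_succ, pow_succ]
    ring

end Counting

end CyclotomicBrauer

namespace CyclotomicBrauer

/-! ### Multipartitions and contents -/

section Young

open scoped Classical
open Tabloid

variable {m N : ℕ}

/-- The column lengths of an `m`-partition, seen as a content. The Murphy elements of the tabloids
of this content belong to the cell of the given `m`-partition, so that the dominance order of
contents, where boxes move to earlier rows, is reversed. -/
noncomputable def colContent (lam : Fin m → YoungDiagram) (s : Fin m × ℕ) : ℕ :=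
  (lam s.1).colLen s.2

theorem isPart_colContent (lam : Fin m → YoungDiagram) : IsPart (colContent lam) :=
  fun c r => (lam c).colLen_anti r (r + 1) (Nat.le_succ r)

theorem colContent_injective : Function.Injective (colContent (m := m)) := fun lam mu h => by
  funext c
  ext ⟨i, j⟩
  have : (lam c).colLen j = (mu c).colLen j := congrFun h (c, j)
  rw [YoungDiagram.mem_cells, YoungDiagram.mem_cells, YoungDiagram.mem_iff_lt_colLen,
    YoungDiagram.mem_iff_lt_colLen, this]

theorem exists_colContent_eq {μ : Fin m × ℕ → ℕ} (hμ : IsPart μ) {K : ℕ}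
    (hK : ∀ c, μ (c, K) = 0) : ∃ lam, colContent lam = μ := by
  have hanti : ∀ c, Antitone fun r => μ (c, r) := fun c => antitone_nat_of_succ_le (hμ c)
  have hmem : ∀ c i j, i < μ (c, j) → i < μ (c, 0) ∧ j < K := fun c i j h => by
    refine ⟨h.trans_le (hanti c (Nat.zero_le j)), ?_⟩
    by_contra! hlt
    have := hanti c hlt
    simp only [hK] at this
    omega
  let lam : Fin m → YoungDiagram := fun c =>
    { cells := (Finset.range (μ (c, 0)) ×ˢ Finset.range K).filter fun p => p.1 < μ (c, p.2)
      isLowerSet := by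
        rintro ⟨i, j⟩ ⟨i', j'⟩ hle h
        simp only [Finset.coe_filter, Finset.mem_product, Finset.mem_range, Set.mem_ofPred_eq]
          at h ⊢
        have h1 : i' < μ (c, j') := (Nat.lt_of_le_of_lt hle.1 h.2).trans_le (hanti c hle.2)
        exact ⟨hmem c i' j' h1, h1⟩ }
  refine ⟨lam, funext fun ⟨c, j⟩ => eq_of_forall_lt_iff fun i => ?_⟩
  change i < (lam c).colLen j ↔ _
  rw [← YoungDiagram.mem_iff_lt_colLen, ← YoungDiagram.mem_cells]
  simp only [lam, Finset.mem_filter, Finset.mem_product, Finset.mem_range]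
  exact ⟨fun h => h.2, fun h => ⟨hmem c i j h, h⟩⟩

/-- Every tuple of partitions is the content of a ballot tabloid. -/
theorem exists_ballot (N : ℕ) {μ : Fin m × ℕ → ℕ} (hμ : IsPart μ) {K : ℕ}
    (hK : ∀ c, μ (c, K) = 0) (hN : ∑ s ∈ rows m K, μ s = N) :
    ∃ t : Tabloid m N, t.Ballot ∧ t.content = μ := by
  have hzero : ∀ {μ : Fin m × ℕ → ℕ}, IsPart μ → (∀ c, μ (c, K) = 0) → ∀ s, s ∉ rows m K →
      μ s = 0 := fun {μ} hμ hK s hs => by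
    rw [mem_rows, not_lt] at hs
    have : Antitone fun r => μ (s.1, r) := antitone_nat_of_succ_le (hμ s.1)
    have := this hs
    simp only [hK] at this
    exact Nat.le_zero.1 this
  induction N generalizing μ with
  | zero =>
    refine ⟨Fin.elim0, fun j c r => by simp, ?_⟩
    rw [content_zero]
    funext s
    by_cases hs : s ∈ rows m K
    · exact ((Finset.sum_eq_zero_iff.1 hN) s hs).symm
    · exact (hzero hμ hK s hs).symm
  | succ N ih =>
    obtain ⟨⟨c, x⟩, hs, hpos⟩ : ∃ s ∈ rows m K, 0 < μ s := by
      by_contra! h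
      rw [Finset.sum_eq_zero fun s hs => Nat.le_zero.1 (h s hs)] at hN
      omega
    -- the last nonempty row of a colour can be shortened
    have hex : ∃ r, μ (c, r) = 0 := ⟨K, hK c⟩
    have hx : x < Nat.find hex := by
      by_contra! hlt
      have : Antitone fun r => μ (c, r) := antitone_nat_of_succ_le (hμ c)
      have := this hlt
      simp only [Nat.find_spec hex] at this
      omega
    obtain ⟨r, hr⟩ : ∃ r, Nat.find hex = r + 1 := ⟨Nat.find hex - 1, by omega⟩
    have hr0 : μ (c, r + 1) = 0 := hr ▸ Nat.find_spec hex
    have hr1 : 0 < μ (c, r) := Nat.pos_of_ne_zero (Nat.find_min hex (by omega))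
    have hrem := (isPart_sub_single_iff hμ c r).2 (by omega)
    have hrK : (c, r) ∈ rows m K := by
      by_contra h
      have := hzero hμ hK _ h
      omega
    obtain ⟨t, ht, hc⟩ := ih hrem.2 (fun c' => by simp [hK]) (by
      rw [← Finset.add_sum_erase _ _ hrK] at hN ⊢
      have : ∑ s ∈ (rows m K).erase (c, r), (μ - Pi.single (c, r) 1 : Fin m × ℕ → ℕ) s =
          ∑ s ∈ (rows m K).erase (c, r), μ s := Finset.sum_congr rfl fun s hs => by
        simp [Finset.ne_of_mem_erase hs]
      rw [this]
      simp only [Pi.sub_apply, Pi.single_eq_same]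
      omega)
    have hc' : t.content + Pi.single (c, r) 1 = μ := by rw [hc, sub_single_add_single hr1]
    refine ⟨t.snoc (c, r), (t.ballot_snoc_iff _).2 ⟨ht, by rwa [hc']⟩, ?_⟩
    rw [content_snoc, hc']

theorem card_filter_col (D : YoungDiagram) {K : ℕ} (hK : D.colLen K = 0) (Q : ℕ → Prop)
    [DecidablePred Q] :
    (D.cells.filter fun p => Q p.2).card = ∑ j ∈ Finset.range K, if Q j then D.colLen j else 0 := by
  rw [Finset.card_eq_sum_card_fiberwise (f := Prod.snd) (t := Finset.range K)]
  · refine Finset.sum_congr rfl fun j _ => ?_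
    rw [Finset.filter_filter]
    split_ifs with h
    · rw [D.colLen_eq_card, YoungDiagram.col]
      congr 1
      refine Finset.filter_congr fun p _ => ?_
      exact ⟨fun h => h.2, fun h' => ⟨h' ▸ h, h'⟩⟩
    · rw [Finset.card_eq_zero, Finset.filter_eq_empty_iff]
      rintro p _ ⟨h1, rfl⟩
      exact h h1
  · intro p hp
    rw [Finset.mem_coe, Finset.mem_filter, YoungDiagram.mem_cells] at hp
    rw [Finset.mem_coe, Finset.mem_range]
    by_contra! hlt
    have h1 : (p.1, p.2) ∈ D := hp.1
    rw [YoungDiagram.mem_iff_lt_colLen] at h1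
    have := D.colLen_anti _ _ hlt
    omega

theorem card_filter_row (D : YoungDiagram) (r : ℕ) :
    (D.cells.filter fun p => p.1 < r).card = ∑ i ∈ Finset.range r, D.rowLen i := by
  rw [Finset.card_eq_sum_card_fiberwise (f := Prod.fst) (t := Finset.range r)]
  · refine Finset.sum_congr rfl fun i hi => ?_
    rw [Finset.filter_filter, D.rowLen_eq_card, YoungDiagram.row]
    congr 1
    refine Finset.filter_congr fun p _ => ?_
    exact ⟨fun h => h.2, fun h' => ⟨h' ▸ Finset.mem_range.1 hi, h'⟩⟩
  · intro p hp
    simpa using (Finset.mem_filter.1 hp).2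

/-- The boxes of an `m`-partition in certain columns, counted by a tabloid that has the column
lengths as content. -/
theorem card_filter_tabloid {lam : Fin m → YoungDiagram} {t : Tabloid m N}
    (h : colContent lam = t.content) (c : Fin m) (Q : ℕ → Prop)
    [DecidablePred Q] :
    ((lam c).cells.filter fun p => Q p.2).card =
      ∑ i, if (t i).1 = c ∧ Q (t i).2 then 1 else 0 := by
  have hp : IsPart t.content := h ▸ isPart_colContent lam
  have hK : (lam c).colLen N = 0 := by
    by_contra hne
    have hpos : 0 < t.content (c, N) := by
      rw [← h]
      exact Nat.pos_of_ne_zero hne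
    obtain ⟨i, hi⟩ := exists_of_content_pos hpos
    have := snd_lt_of_isPart hp i
    rw [hi] at this
    exact lt_irrefl _ this
  rw [card_filter_col _ hK, ← Finset.card_filter,
    Finset.card_eq_sum_card_fiberwise (f := fun i => (t i).2) (t := Finset.range N)]
  · refine Finset.sum_congr rfl fun j _ => ?_
    rw [Finset.filter_filter]
    split_ifs with hQ
    · have : (lam c).colLen j = t.content (c, j) := congrFun h (c, j)
      rw [this, content]
      congr 1
      refine Finset.filter_congr fun i _ => ?_
      rw [Prod.ext_iff]
      exact ⟨fun h => ⟨⟨h.1, h.2 ▸ hQ⟩, h.2⟩, fun h => ⟨h.1.1, h.2⟩⟩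
    · rw [eq_comm, Finset.card_eq_zero, Finset.filter_eq_empty_iff]
      rintro i _ ⟨h1, rfl⟩
      exact hQ h1.2
  · intro i _
    simpa using snd_lt_of_isPart hp i

theorem card_eq_tabloid {lam : Fin m → YoungDiagram} {t : Tabloid m N}
    (h : colContent lam = t.content) (c : Fin m) :
    (lam c).card = ∑ i, if (t i).1 = c then 1 else 0 := by
  have := card_filter_tabloid h c fun _ => True
  simpa using this

theorem size_eq_of_content {lam : Fin m → YoungDiagram} {t : Tabloid m N}
    (h : colContent lam = t.content) : size lam = N := by
  rw [size]
  simp only [card_eq_tabloid h]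
  rw [Finset.sum_comm]
  simp

theorem exists_ballot_of_size {lam : Fin m → YoungDiagram} (h : size lam = N) :
    ∃ t : Tabloid m N, t.Ballot ∧ t.content = colContent lam := by
  have hK : ∀ c, colContent lam (c, ∑ c, (lam c).rowLen 0) = 0 := fun c => by
    by_contra hne
    have h1 : (0, ∑ c, (lam c).rowLen 0) ∈ lam c :=
      YoungDiagram.mem_iff_lt_colLen.2 (Nat.pos_of_ne_zero hne)
    rw [YoungDiagram.mem_iff_lt_rowLen] at h1
    exact absurd h1 (not_lt.2 (Finset.single_le_sum (f := fun c => (lam c).rowLen 0)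
      (fun _ _ => Nat.zero_le _) (Finset.mem_univ c)))
  refine exists_ballot N (isPart_colContent lam) hK ?_
  rw [rows, Finset.sum_product, ← h, size]
  refine Finset.sum_congr rfl fun c _ => ?_
  have := card_filter_col (lam c) (hK c) fun _ => True
  simp only [Finset.filter_true, if_true] at this
  exact this.symm

/-- If the column lengths of `mu` dominate those of `lam`, then `lam` dominates `mu`. -/
theorem partialSum_le_of_dominates {lam mu : Fin m → YoungDiagram} {t t' : Tabloid m N}
    (h : colContent lam = t.content) (h' : colContent mu = t'.content) (hd : Dominates t' t)
    (j : Fin m) (r : ℕ) : partialSum mu j r ≤ partialSum lam j r := by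
  -- testing on functions of the colour alone gives equalities
  have hcard : ∀ c, (mu c).card = (lam c).card := fun c => by
    rw [card_eq_tabloid h, card_eq_tabloid h']
    have h1 := hd.1 (fun s => if s.1 = c then 1 else 0) fun _ _ => le_rfl
    have h2 := hd.1 (fun s => if s.1 = c then 0 else 1) fun _ _ => le_rfl
    have h3 : ∀ t : Tabloid m N, (∑ i, if (t i).1 = c then 1 else 0) +
        (∑ i, if (t i).1 = c then 0 else 1) = N := fun t => by
      rw [← Finset.sum_add_distrib, Finset.sum_congr rfl fun i _ => (by split_ifs <;> rfl :
        (if (t i).1 = c then 1 else 0) + (if (t i).1 = c then 0 else 1) = 1)]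
      simp
    have h4 := h3 t
    have h5 := h3 t'
    omega
  rw [partialSum, partialSum]
  refine add_le_add (Finset.sum_le_sum fun c _ => (hcard c).le) ?_
  rcases r with _ | r
  · simp
  rw [← card_filter_row, ← card_filter_row]
  -- the columns of `lam` before the `b`-th one meet all of the first `r + 1` rows
  set b := (lam j).rowLen r with hb
  have hcol : ((mu j).cells.filter fun p => b ≤ p.2).card ≤
      ((lam j).cells.filter fun p => b ≤ p.2).card := by
    rw [card_filter_tabloid h j (b ≤ ·), card_filter_tabloid h' j (b ≤ ·)]
    have h1 := hd.1 (fun s => if s.1 = j ∧ ¬ b ≤ s.2 then 1 else 0) fun c x => by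
      dsimp only
      split_ifs <;> omega
    have h2 : ∀ t : Tabloid m N, (∑ i, if (t i).1 = j ∧ ¬ b ≤ (t i).2 then 1 else 0) +
        (∑ i, if (t i).1 = j ∧ b ≤ (t i).2 then 1 else 0) =
          ∑ i, if (t i).1 = j then 1 else 0 := fun t => by
      rw [← Finset.sum_add_distrib]
      refine Finset.sum_congr rfl fun i _ => ?_
      split_ifs <;> first | rfl | (exfalso; tauto)
    have h3 := hcard j
    rw [card_eq_tabloid h, card_eq_tabloid h', ← h2, ← h2] at h3
    omega
  have hmu : ((mu j).cells.filter fun p => p.1 < r + 1).card ≤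
      (r + 1) * b + ((mu j).cells.filter fun p => b ≤ p.2).card := by
    have hsub : ((mu j).cells.filter fun p => p.1 < r + 1) ⊆
        (Finset.range (r + 1) ×ˢ Finset.range b) ∪ (mu j).cells.filter fun p => b ≤ p.2 := by
      intro p hp
      rw [Finset.mem_filter] at hp
      rw [Finset.mem_union, Finset.mem_product, Finset.mem_range, Finset.mem_range,
        Finset.mem_filter]
      rcases lt_or_ge p.2 b with hlt | hge
      · exact Or.inl ⟨hp.2, hlt⟩
      · exact Or.inr ⟨hp.1, hge⟩
    refine (Finset.card_le_card hsub).trans ((Finset.card_union_le _ _).trans_eq ?_)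
    simp
  have hlam : (r + 1) * b + ((lam j).cells.filter fun p => b ≤ p.2).card ≤
      ((lam j).cells.filter fun p => p.1 < r + 1).card := by
    have hdisj : Disjoint (Finset.range (r + 1) ×ˢ Finset.range b)
        ((lam j).cells.filter fun p => b ≤ p.2) := by
      rw [Finset.disjoint_left]
      intro p hp hp'
      rw [Finset.mem_product, Finset.mem_range, Finset.mem_range] at hp
      rw [Finset.mem_filter] at hp'
      omega
    have hsub : (Finset.range (r + 1) ×ˢ Finset.range b) ∪
        ((lam j).cells.filter fun p => b ≤ p.2) ⊆ (lam j).cells.filter fun p => p.1 < r + 1 := by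
      intro p hp
      rw [Finset.mem_union, Finset.mem_product, Finset.mem_range, Finset.mem_range,
        Finset.mem_filter] at hp
      rw [Finset.mem_filter]
      rcases hp with hp | hp
      · refine ⟨?_, hp.1⟩
        have : (r, p.2) ∈ lam j := YoungDiagram.mem_iff_lt_rowLen.2 hp.2
        exact (lam j).up_left_mem (Nat.lt_succ_iff.1 hp.1) le_rfl this
      · refine ⟨hp.1, ?_⟩
        by_contra! hlt
        have : (r, p.2) ∈ lam j := (lam j).up_left_mem (by omega) le_rfl hp.1
        rw [YoungDiagram.mem_iff_lt_rowLen] at this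
        omega
    have := Finset.card_le_card hsub
    rw [Finset.card_union_of_disjoint hdisj] at this
    simpa using this
  omega

end Young

end CyclotomicBrauer

namespace CyclotomicBrauer

/-! ### The cell datum -/

section Cells

open scoped Classical
open Tabloid

theorem nonempty_dangle {m n l : ℕ} (h : 2 * l ≤ n) : Nonempty (Dangle m n l) := by
  let e : Fin n → Fin n := fun i => if h : (i : ℕ) < 2 * l then ⟨2 * l - 1 - i, by omega⟩ else i
  have he : ∀ i : Fin n, (i : ℕ) < 2 * l → (e i : ℕ) = 2 * l - 1 - i := fun i hi => by
    simp only [e, dif_pos hi]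
  have he' : ∀ i : Fin n, ¬ (i : ℕ) < 2 * l → e i = i := fun i hi => by simp only [e, dif_neg hi]
  refine ⟨⟨e, 0, fun i => ?_, fun _ => by simp, fun _ _ => rfl, ?_⟩⟩
  · by_cases hi : (i : ℕ) < 2 * l
    · apply Fin.ext
      rw [he _ (by rw [he i hi]; omega), he i hi]
      omega
    · rw [he' i hi, he' i hi]
  · have h1 : (Finset.univ.filter fun i => e i = i) =
        Finset.univ.filter fun i : Fin n => ¬ (i : ℕ) < 2 * l := by
      refine Finset.filter_congr fun i _ => ⟨fun h hi => ?_, he' i⟩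
      have := congrArg Fin.val h
      rw [he i hi] at this
      omega
    have h2 := Finset.card_filter_add_card_filter_not (s := (Finset.univ : Finset (Fin n)))
      fun i : Fin n => (i : ℕ) < 2 * l
    rw [Fin.card_filter_val_lt, Finset.card_univ, Fintype.card_fin] at h2
    rw [h1]
    omega

section Finite

variable {m n l N : ℕ}

/-- The pairs of ballot tabloids of equal content. -/
abbrev BallotPair (m N : ℕ) : Type :=
  {p : Tabloid m N × Tabloid m N // p.1.Ballot ∧ p.2.Ballot ∧ p.1.content = p.2.content}

theorem card_wreath : Nat.card (Wreath m N) = m ^ N * N.factorial := by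
  rw [Nat.card_congr SemidirectProduct.equivProd, Nat.card_prod, Nat.card_perm, Nat.card_fun,
    Nat.card_fin, Nat.card_congr Multiplicative.toAdd, Nat.card_zmod]

theorem card_ballotPair : Nat.card (BallotPair m N) = m ^ N * N.factorial := by
  rw [Nat.subtype_card ((ballots m N ×ˢ ballots m N).filter fun p => p.2.content = p.1.content)
    fun p => by simp only [Finset.mem_filter, Finset.mem_product, mem_ballots, eq_comm, and_assoc],
    Finset.card_filter, Finset.sum_product, ← sum_ballotCount]
  refine Finset.sum_congr rfl fun t _ => ?_
  rw [ballotCount, Finset.card_filter]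

variable [NeZero m]

instance : Finite (Dangle m n l) :=
  Finite.of_injective (fun d : Dangle m n l => (d.partner, d.label)) fun _ _ h =>
    Dangle.ext (congrArg Prod.fst h) (congrArg Prod.snd h)

instance : Finite (Diagram m n) :=
  Finite.of_injective (fun X : Diagram m n => (X.partner, X.label)) fun _ _ h =>
    Diagram.ext (congrArg Prod.fst h) (congrArg Prod.snd h)

noncomputable instance : Fintype (Wreath m N) := Fintype.ofFinite _

instance : Finite (BallotPair m N) := Nat.finite_of_card_ne_zero (by
  rw [card_ballotPair]
  have := NeZero.ne m
  positivity)

/-- Pairs of ballot tabloids are as many as group elements. -/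
theorem nonempty_ballotPair_equiv : Nonempty (BallotPair m N ≃ Wreath m N) :=
  Finite.card_eq.1 (card_ballotPair.trans card_wreath.symm)

end Finite

section Layer

variable {m n : ℕ} (lam : MultiPart m n)

/-- The number of northern arcs of the diagrams in the cell of a multipartition. -/
def MultiPart.layer : ℕ := (n - size lam.1) / 2

theorem MultiPart.layer_spec : lam.layer ≤ n / 2 ∧ size lam.1 = n - 2 * lam.layer := by
  obtain ⟨l, hl, h⟩ := lam.2
  rw [layer]
  omega

/-- The index set of a cell: the pairs of a dangle and a ballot tabloid (a standard tableau) on its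
free nodes, the content of which is given by the column lengths. -/
abbrev CellIndex : Type :=
  Dangle m n lam.layer ×
    {t : Tabloid m (n - 2 * lam.layer) // t.Ballot ∧ t.content = colContent lam.1}

theorem nonempty_cellIndex : Nonempty (CellIndex lam) := by
  obtain ⟨h1, h2⟩ := lam.layer_spec
  obtain ⟨d⟩ := nonempty_dangle (m := m) (n := n) (l := lam.layer) (by omega)
  obtain ⟨t, ht⟩ := exists_ballot_of_size h2
  exact ⟨d, t, ht⟩

instance [NeZero m] : Finite {t : Tabloid m (n - 2 * lam.layer) //
    t.Ballot ∧ t.content = colContent lam.1} :=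
  Finite.of_injective (β := ballots m (n - 2 * lam.layer))
    (fun t => ⟨t.1, mem_ballots.2 t.2.1⟩) fun _ _ h => Subtype.ext (Subtype.mk.inj h)

noncomputable instance [NeZero m] : Fintype (CellIndex lam) := Fintype.ofFinite _

end Layer

variable {m n : ℕ} [NeZero m] {k : Type*} [Field k] (δ : ZMod m → k) (ψ : AddChar (ZMod m) k)

/-- The element of the algebra given by two dangles and a function on the wreath product. -/
noncomputable def layerElem {l : ℕ} (d d' : Dangle m n l) :
    (Wreath m (n - 2 * l) → k) →ₗ[k] BrauerAlg k m n δ :=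
  Fintype.linearCombination k fun g => ofDiagram δ (d.assemble d' g)

theorem layerElem_apply {l : ℕ} (d d' : Dangle m n l) (F : Wreath m (n - 2 * l) → k) :
    layerElem δ d d' F = ∑ g, F g • ofDiagram δ (d.assemble d' g) := rfl

theorem layerElem_single {l : ℕ} (d d' : Dangle m n l) (g : Wreath m (n - 2 * l)) :
    layerElem δ d d' (Pi.single g 1) = ofDiagram δ (d.assemble d' g) := by
  rw [layerElem, Fintype.linearCombination_apply_single, one_smul]

theorem flipMap_layerElem {l : ℕ} (d d' : Dangle m n l) (F : Wreath m (n - 2 * l) → k) :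
    flipMap δ (layerElem δ d d' F) = layerElem δ d' d (flipFun k m _ F) := by
  rw [layerElem_apply, layerElem_apply, map_sum]
  refine Finset.sum_nbij' Wreath.flip Wreath.flip (fun _ _ => Finset.mem_univ _)
    (fun _ _ => Finset.mem_univ _) (fun g _ => g.flip_flip) (fun g _ => g.flip_flip) fun g _ => ?_
  rw [map_smul, flipMap_ofDiagram, Dangle.assemble_flip, flipFun, LinearMap.funLeft_apply,
    Wreath.flip_flip]

/-- The cellular basis: a Murphy element of the free nodes, put between two dangles. -/
noncomputable def cellElem (x : Σ lam : MultiPart m n, CellIndex lam × CellIndex lam) :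
    BrauerAlg k m n δ :=
  layerElem δ x.2.1.1 x.2.2.1 (murphy ψ x.2.1.2.1 x.2.2.2.1)

theorem flipMap_cellElem (lam : MultiPart m n) (S T : CellIndex lam) :
    flipMap δ (cellElem δ ψ ⟨lam, S, T⟩) = cellElem δ ψ ⟨lam, T, S⟩ := by
  rw [cellElem, cellElem, flipMap_layerElem, flipFun_murphy]

/-- All Murphy elements of pairs of ballot tabloids occur in a cell. -/
theorem exists_cellElem_eq {l : ℕ} (d d' : Dangle m n l) {t u : Tabloid m (n - 2 * l)}
    (ht : t.Ballot) (hu : u.Ballot) (hc : t.content = u.content) :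
    ∃ (lam : MultiPart m n) (S T : CellIndex lam), size lam.1 = n - 2 * l ∧
      colContent lam.1 = t.content ∧
      layerElem δ d d' (murphy ψ t u) = cellElem δ ψ ⟨lam, S, T⟩ := by
  have hK : ∀ c, t.content (c, n - 2 * l) = 0 := fun c => by
    by_contra hne
    obtain ⟨i, hi⟩ := exists_of_content_pos (Nat.pos_of_ne_zero hne)
    have := snd_lt_of_isPart ht.isPart i
    rw [hi] at this
    exact lt_irrefl _ this
  obtain ⟨lam, hlam⟩ := exists_colContent_eq ht.isPart hK
  have hl := d.two_mul_le
  have hsize := size_eq_of_content hlam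
  let lam' : MultiPart m n := ⟨lam, l, by omega, hsize⟩
  have hlayer : l = lam'.layer := by
    have := lam'.layer_spec
    have h : size lam'.1 = n - 2 * l := hsize
    omega
  have key : ∀ l' (h : l = l'), ∃ (e e' : Dangle m n l') (t' u' : Tabloid m (n - 2 * l')),
      t'.Ballot ∧ u'.Ballot ∧ t'.content = t.content ∧ u'.content = t.content ∧
        layerElem δ d d' (murphy ψ t u) = layerElem δ e e' (murphy ψ t' u') := by
    rintro l' rfl
    exact ⟨d, d', t, u, ht, hu, rfl, hc.symm, rfl⟩
  obtain ⟨e, e', t', u', ht', hu', hct, hcu, heq⟩ := key _ hlayer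
  exact ⟨lam', ⟨e, t', ht', hct.trans hlam.symm⟩, ⟨e', u', hu', hcu.trans hlam.symm⟩, hsize, hlam,
    heq⟩

variable {ψ} in
theorem ofDiagram_mem_span_cellElem (hψ : ψ.IsPrimitive) (hm : (m : k) ≠ 0) {l : ℕ}
    (d d' : Dangle m n l) (g : Wreath m (n - 2 * l)) :
    ofDiagram δ (d.assemble d' g) ∈ Submodule.span k {x | ∃ (lam : MultiPart m n)
      (S T : CellIndex lam), size lam.1 = n - 2 * l ∧ x = cellElem δ ψ ⟨lam, S, T⟩} := by
  have hle : Submodule.span k {x | ∃ t u : Tabloid m (n - 2 * l), t.Ballot ∧ u.Ballot ∧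
      t.content = u.content ∧ x = murphy ψ t u} ≤ (Submodule.span k {x | ∃ (lam : MultiPart m n)
      (S T : CellIndex lam), size lam.1 = n - 2 * l ∧ x = cellElem δ ψ ⟨lam, S, T⟩}).comap
      (layerElem δ d d') := by
    rw [Submodule.span_le]
    rintro _ ⟨t, u, ht, hu, hc, rfl⟩
    obtain ⟨lam, S, T, h1, -, h2⟩ := exists_cellElem_eq δ ψ d d' ht hu hc
    exact Submodule.subset_span ⟨lam, S, T, h1, h2⟩
  rw [span_ballot_eq_top ψ hψ hm] at hle
  rw [← layerElem_single]
  exact hle (Submodule.mem_top (x := Pi.single g 1))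

variable {ψ} in
theorem span_cellElem (hψ : ψ.IsPrimitive) (hm : (m : k) ≠ 0) :
    ⊤ ≤ Submodule.span k (Set.range (cellElem (n := n) δ ψ)) := by
  rw [← span_ofDiagram, Submodule.span_le]
  rintro _ ⟨X, rfl⟩
  obtain ⟨⟨l, d, d', g⟩, rfl⟩ := (cutEquiv m n).surjective X
  refine Submodule.span_mono ?_ (ofDiagram_mem_span_cellElem δ hψ hm d d' g)
  rintro _ ⟨lam, S, T, -, rfl⟩
  exact ⟨_, rfl⟩

/-- The cellular basis has at most as many elements as there are diagrams. -/
theorem exists_injective_cellIndex : ∃ f : (Σ lam : MultiPart m n, CellIndex lam × CellIndex lam) →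
    Diagram m n, Function.Injective f := by
  let e (N : ℕ) : BallotPair m N ≃ Wreath m N := nonempty_ballotPair_equiv.some
  let e' : (Σ l : Fin (n / 2 + 1), Dangle m n l × (Dangle m n l × BallotPair m (n - 2 * l))) ≃
      Diagram m n :=
    (Equiv.sigmaCongrRight fun l => Equiv.prodCongr (Equiv.refl _)
      (Equiv.prodCongr (Equiv.refl _) (e _))).trans (cutEquiv m n)
  let f : (Σ lam : MultiPart m n, CellIndex lam × CellIndex lam) →
      Σ l : Fin (n / 2 + 1), Dangle m n l × (Dangle m n l × BallotPair m (n - 2 * l)) := fun x =>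
    ⟨⟨x.1.layer, Nat.lt_succ_of_le x.1.layer_spec.1⟩, x.2.1.1, x.2.2.1,
      ⟨(x.2.1.2.1, x.2.2.2.1), x.2.1.2.2.1, x.2.2.2.2.1, x.2.1.2.2.2.trans x.2.2.2.2.2.symm⟩⟩
  refine ⟨fun x => e' (f x), e'.injective.comp ?_⟩
  rintro ⟨lam, S, T⟩ ⟨mu, U, W⟩ h
  -- the content of a tabloid determines the multipartition
  let F : (Σ l : Fin (n / 2 + 1), Dangle m n l × (Dangle m n l × BallotPair m (n - 2 * l))) →
      Fin m × ℕ → ℕ := fun y => y.2.2.2.1.1.content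
  have hF : S.2.1.content = U.2.1.content := congrArg F h
  rw [S.2.2.2, U.2.2.2] at hF
  obtain rfl : lam = mu := Subtype.ext (colContent_injective hF)
  simp only [f, Sigma.mk.injEq, heq_eq_eq, true_and, Prod.mk.injEq, Subtype.mk.injEq] at h
  obtain ⟨h1, h2, h3, h4⟩ := h
  exact congrArg _ (Prod.ext (Prod.ext h1 (Subtype.ext h3)) (Prod.ext h2 (Subtype.ext h4)))

end Cells

end CyclotomicBrauer

namespace CyclotomicBrauer

/-! ### Multiplication on the cells -/

section CellDatum

open scoped Classical
open Tabloid

variable {m n : ℕ} [NeZero m] {k : Type*} [Field k] (δ : ZMod m → k) {ψ : AddChar (ZMod m) k}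

/-- The span of the cells below a given one. -/
noncomputable def lowerSpan (ψ : AddChar (ZMod m) k) (lam : MultiPart m n) :
    Submodule k (BrauerAlg k m n δ) :=
  Submodule.span k {x | ∃ mu < lam, ∃ U W : CellIndex mu, x = cellElem δ ψ ⟨mu, U, W⟩}

theorem ofDiagram_mem_lowerSpan (hψ : ψ.IsPrimitive) (hm : (m : k) ≠ 0) (lam : MultiPart m n)
    {Y : Diagram m n} (hY : Y.through.card < n - 2 * lam.layer) :
    ofDiagram δ Y ∈ lowerSpan δ ψ lam := by
  obtain ⟨⟨l, d, d', g⟩, rfl⟩ := (cutEquiv m n).surjective Y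
  change ofDiagram δ (d.assemble d' g) ∈ _
  change (d.assemble d' g).through.card < _ at hY
  rw [Dangle.card_through_assemble, ← lam.layer_spec.2] at hY
  refine Submodule.span_mono ?_ (ofDiagram_mem_span_cellElem δ hψ hm d d' g)
  rintro _ ⟨mu, U, W, hs, rfl⟩
  have hle : mu ≤ lam := Or.inl (hs.trans_lt hY)
  refine ⟨mu, lt_of_le_of_ne hle ?_, U, W, rfl⟩
  rintro rfl
  omega

/-- A function in the span of the ballot tabloids of larger content gives an element of the lower
cells of the same layer. -/
theorem layerElem_mem_lowerSpan (lam : MultiPart m n) (d d' : Dangle m n lam.layer)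
    {t : Tabloid m (n - 2 * lam.layer)} (ht : t.content = colContent lam.1)
    {x : Wreath m (n - 2 * lam.layer) → k} (hx : x ∈ ballotSpan ψ t) :
    layerElem δ d d' x ∈ lowerSpan δ ψ lam := by
  have hle : ballotSpan ψ t ≤ (lowerSpan δ ψ lam).comap (layerElem δ d d') := by
    rw [ballotSpan, Submodule.span_le]
    rintro _ ⟨t', u', ht', hu', hc, hd, rfl⟩
    obtain ⟨mu, U, W, hs, hmu, heq⟩ := exists_cellElem_eq δ ψ d d' ht' hu' hc
    have hle : mu ≤ lam := Or.inr ⟨hs.trans lam.layer_spec.2.symm,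
      partialSum_le_of_dominates ht.symm hmu hd⟩
    refine Submodule.subset_span ⟨mu, lt_of_le_of_ne hle ?_, U, W, heq⟩
    rintro rfl
    have := hd.2
    rw [weight_eq_of_content_eq (ht.trans hmu)] at this
    exact lt_irrefl _ this
  exact hle hx

/-- Left multiplication by an element of the algebra on a cell, with coefficients that do not depend
on the second index. -/
def ActsOnCell (ψ : AddChar (ZMod m) k) (a : BrauerAlg k m n δ) (lam : MultiPart m n)
    (S : CellIndex lam) : Prop :=
  ∃ r : CellIndex lam → k, ∀ T, a * cellElem δ ψ ⟨lam, S, T⟩ -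
    ∑ S', r S' • cellElem δ ψ ⟨lam, S', T⟩ ∈ lowerSpan δ ψ lam

theorem ActsOnCell.add {a b : BrauerAlg k m n δ} {lam : MultiPart m n} {S : CellIndex lam}
    (ha : ActsOnCell δ ψ a lam S) (hb : ActsOnCell δ ψ b lam S) :
    ActsOnCell δ ψ (a + b) lam S := by
  obtain ⟨r, hr⟩ := ha
  obtain ⟨r', hr'⟩ := hb
  refine ⟨r + r', fun T => ?_⟩
  have := add_mem (hr T) (hr' T)
  simpa only [add_mul, Pi.add_apply, add_smul, Finset.sum_add_distrib, add_sub_add_comm] using this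

theorem ActsOnCell.smul {a : BrauerAlg k m n δ} {lam : MultiPart m n} {S : CellIndex lam} (c : k)
    (ha : ActsOnCell δ ψ a lam S) : ActsOnCell δ ψ (c • a) lam S := by
  obtain ⟨r, hr⟩ := ha
  refine ⟨c • r, fun T => ?_⟩
  have := Submodule.smul_mem _ c (hr T)
  simpa only [smul_mul_assoc, Pi.smul_apply, smul_assoc, ← Finset.smul_sum, smul_sub] using this

theorem actsOnCell_of_mem {a : BrauerAlg k m n δ} {lam : MultiPart m n} {S : CellIndex lam}
    (h : ∀ T, a * cellElem δ ψ ⟨lam, S, T⟩ ∈ lowerSpan δ ψ lam) : ActsOnCell δ ψ a lam S :=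
  ⟨0, fun T => by simpa using h T⟩

theorem ofDiagram_mul_layerElem {l : ℕ} (X : Diagram m n) (d d' : Dangle m n l)
    (F : Wreath m (n - 2 * l) → k) : ofDiagram δ X * layerElem δ d d' F =
      loopFactor δ X (d.assemble d 1) • ∑ g, F g • ofDiagram δ (X.stack (d.assemble d' g)) := by
  rw [layerElem_apply, Finset.mul_sum, Finset.smul_sum]
  refine Finset.sum_congr rfl fun g _ => ?_
  rw [mul_smul_comm, ofDiagram_mul, smul_comm, loopFactor_assemble_right δ X d d' d g 1]

/-- A diagram put above a cell either loses a through strand, and then lands in lower cells, or it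
permutes the free nodes of the first dangle, where the straightening rule applies. -/
theorem actsOnCell_ofDiagram (hψ : ψ.IsPrimitive) (hm : (m : k) ≠ 0) (X : Diagram m n)
    (lam : MultiPart m n) (S : CellIndex lam) : ActsOnCell δ ψ (ofDiagram δ X) lam S := by
  obtain ⟨d, t, ht, htc⟩ := S
  rcases stack_assemble_cases X d with ⟨e, h, hstack⟩ | hlt
  · -- the diagram permutes the free nodes by `h`, and the permuted tabloid is straightened
    set t' : Tabloid m (n - 2 * lam.layer) := fun i => t (h.right⁻¹ i) with ht'
    have htc' : t'.content = colContent lam.1 := (t.content_comp_perm h.right⁻¹).trans htc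
    obtain ⟨r, hr, hru⟩ := exists_straightening ψ t'
    set c : k := loopFactor δ X (d.assemble d 1) * (colourChar ψ t' h)⁻¹ with hc
    refine ⟨fun S' => if S'.1 = e then c * r S'.2.1 else 0, fun T => ?_⟩
    obtain ⟨d', u, hu, huc⟩ := T
    have h0 : ∑ g, murphy ψ t u g • ofDiagram δ (X.stack (d.assemble d' g)) =
        (colourChar ψ t' h)⁻¹ • layerElem δ e d' (murphy ψ t' u) := by
      rw [layerElem_apply, Finset.smul_sum]
      refine (Equiv.sum_comp (Equiv.mulLeft h⁻¹) _).symm.trans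
        (Finset.sum_congr rfl fun g _ => ?_)
      rw [hstack, Equiv.coe_mulLeft, mul_inv_cancel_left, murphy_inv_mul, mul_smul]
    have h1 : ofDiagram δ X * cellElem δ ψ ⟨lam, (d, ⟨t, ht, htc⟩), (d', ⟨u, hu, huc⟩)⟩ =
        c • layerElem δ e d' (murphy ψ t' u) := by
      change ofDiagram δ X * layerElem δ d d' (murphy ψ t u) = _
      rw [ofDiagram_mul_layerElem, h0, hc, mul_smul]
    have h2 : ∑ S' : CellIndex lam, (if S'.1 = e then c * r S'.2.1 else 0) •
        cellElem δ ψ ⟨lam, S', (d', ⟨u, hu, huc⟩)⟩ =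
        c • layerElem δ e d' (r.sum fun t' a => a • murphy ψ t' u) := by
      rw [Finsupp.sum, map_sum, Finset.smul_sum]
      simp only [ite_smul, zero_smul]
      rw [← Finset.sum_filter]
      refine Finset.sum_bij_ne_zero (fun S' _ _ => S'.2.1) ?_ ?_ ?_ ?_
      · intro S' _ hne
        rw [Finsupp.mem_support_iff]
        intro h0
        rw [h0, mul_zero, zero_smul] at hne
        exact hne rfl
      · intro S₁ h₁ _ S₂ h₂ _ heq
        rw [Finset.mem_filter] at h₁ h₂
        exact Prod.ext (h₁.2.trans h₂.2.symm) (Subtype.ext heq)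
      · intro t₁ h₁ hne
        obtain ⟨hb, hcont⟩ := hr t₁ h₁
        refine ⟨(e, ⟨t₁, hb, hcont.trans htc'⟩), by simp, ?_, rfl⟩
        rw [map_smul, smul_smul] at hne
        exact hne
      · intro S' hS' _
        rw [Finset.mem_filter] at hS'
        rw [map_smul, smul_smul, cellElem, hS'.2]
    rw [h1, h2, ← smul_sub, ← map_sub]
    exact Submodule.smul_mem _ _ (layerElem_mem_lowerSpan δ lam e d' htc'
      (hru u (huc.trans htc'.symm)))
  · -- a through strand is lost
    refine actsOnCell_of_mem δ fun T => ?_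
    rw [cellElem, ofDiagram_mul_layerElem]
    exact Submodule.smul_mem _ _ (sum_mem fun g _ => Submodule.smul_mem _ _
      (ofDiagram_mem_lowerSpan δ hψ hm lam (hlt _ _)))

theorem actsOnCell (hψ : ψ.IsPrimitive) (hm : (m : k) ≠ 0) (a : BrauerAlg k m n δ)
    (lam : MultiPart m n) (S : CellIndex lam) : ActsOnCell δ ψ a lam S := by
  have ha : a ∈ Submodule.span k (Set.range (ofDiagram (n := n) δ)) := by
    rw [span_ofDiagram]
    exact Submodule.mem_top
  induction ha using Submodule.span_induction with
  | mem x hx =>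
    obtain ⟨X, rfl⟩ := hx
    exact actsOnCell_ofDiagram δ hψ hm X lam S
  | zero =>
    refine actsOnCell_of_mem δ fun T => ?_
    rw [zero_mul]
    exact zero_mem _
  | add x y _ _ hx hy => exact hx.add δ hy
  | smul c x _ hx => exact hx.smul δ c

/-- The algebra is cellular, with the Murphy elements between two dangles as cellular basis. -/
theorem isCellular (hψ : ψ.IsPrimitive) (hm : (m : k) ≠ 0) :
    IsCellular k (BrauerAlg k m n δ) (MultiPart m n) (flipMap δ) := by
  obtain ⟨f, hf⟩ := exists_injective_cellIndex (m := m) (n := n)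
  have : Finite (Σ lam : MultiPart m n, CellIndex lam × CellIndex lam) := Finite.of_injective f hf
  have := Fintype.ofFinite (Σ lam : MultiPart m n, CellIndex lam × CellIndex lam)
  have := Fintype.ofFinite (Diagram m n)
  have hspan := span_cellElem (n := n) δ hψ hm
  have hfin : Module.Finite k (BrauerAlg k m n δ) := Module.Finite.of_basis (diagramBasis δ)
  have hcard : Fintype.card (Σ lam : MultiPart m n, CellIndex lam × CellIndex lam) =
      Module.finrank k (BrauerAlg k m n δ) := by
    refine le_antisymm ?_ ?_
    · rw [Module.finrank_eq_card_basis (diagramBasis δ)]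
      exact Fintype.card_le_of_injective f hf
    · have := finrank_range_le_card (R := k) (cellElem (n := n) δ ψ)
      rwa [Set.finrank, top_le_iff.1 hspan, finrank_top] at this
  have hC : ∀ x, basisOfTopLeSpanOfCardEqFinrank _ hspan hcard x = cellElem δ ψ x := fun x => by
    rw [coe_basisOfTopLeSpanOfCardEqFinrank]
  choose r hr using fun (a : BrauerAlg k m n δ) lam S => actsOnCell δ hψ hm a lam S
  exact ⟨{
    M := fun lam => CellIndex lam
    fintype := fun lam => inferInstance
    nonempty := nonempty_cellIndex
    C := basisOfTopLeSpanOfCardEqFinrank _ hspan hcard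
    star_antiInvolution := flipMap_antiInvolution δ
    star_C := fun lam S T => by rw [hC, hC, flipMap_cellElem]
    r := fun a lam S' S => r a lam S S'
    mul_C := fun a lam S T => by
      simp only [hC]
      exact hr a lam S T }⟩

end CellDatum

end CyclotomicBrauer

theorem mainTheorem5 {k : Type*} [Field k] [IsAlgClosed k] (m n : ℕ) (hm : (m : k) ≠ 0)
    (δ : ZMod m → k) :
    -- the product of `B^m_n(δ)` is unital, and it is associative exactly for the symmetric `δ`
    (∀ x : CyclotomicBrauer.BrauerAlg k m n δ, 1 * x = x ∧ x * 1 = x) ∧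
    ((∀ x y z : CyclotomicBrauer.BrauerAlg k m n δ, x * y * z = x * (y * z)) ↔
      (2 ≤ n → ∀ i, δ (-i) = δ i)) ∧
    -- the inflation decomposition, given by cutting a diagram into two dangles and a group element
    (∃ Ψ : CyclotomicBrauer.BrauerAlg k m n δ ≃ₗ[k]
        ⨁ l : Fin (n / 2 + 1), CyclotomicBrauer.DangleSpace k m n l ⊗[k]
          (CyclotomicBrauer.DangleSpace k m n l ⊗[k] CyclotomicBrauer.WreathAlg k m (n - 2 * l)),
      (∀ (l : Fin (n / 2 + 1)) (d d' : CyclotomicBrauer.Dangle m n l)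
          (g : CyclotomicBrauer.Wreath m (n - 2 * l)),
        CyclotomicBrauer.ofLayer Ψ l
            (Finsupp.single d 1 ⊗ₜ (Finsupp.single d' 1 ⊗ₜ MonoidAlgebra.single g 1)) =
          CyclotomicBrauer.ofDiagram δ (d.assemble d' g)) ∧
      CyclotomicBrauer.IsIteratedInflation (CyclotomicBrauer.flipMap δ)
        (fun l : Fin (n / 2 + 1) => CyclotomicBrauer.wreathFlipMap k m (n - 2 * l)) Ψ) ∧
    -- cellularity for the extended dominance order and the reflection of diagrams
    CyclotomicBrauer.IsCellular k (CyclotomicBrauer.BrauerAlg k m n δ)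
      (CyclotomicBrauer.MultiPart m n) (CyclotomicBrauer.flipMap δ) := by
  have : NeZero m := ⟨fun h => hm (by simp [h])⟩
  refine ⟨fun x => ⟨CyclotomicBrauer.one_mul_brauer δ x, CyclotomicBrauer.mul_one_brauer δ x⟩,
    CyclotomicBrauer.mul_assoc_brauer_iff_symmetric δ, ⟨CyclotomicBrauer.inflationEquiv δ,
    CyclotomicBrauer.layerMap_single δ, CyclotomicBrauer.isIteratedInflation δ⟩, ?_⟩
  obtain ⟨ψ, hψ⟩ := CyclotomicBrauer.exists_primitive_addChar k hm
  exact CyclotomicBrauer.isCellular δ hψ hm
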